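/- A CNF formula $F$ is a finite collection of clauses, each a finite set of literals without a complementary pair; $\mathrm{var}(F)$ is its set of variables, $\mathrm{var}(c)$ and $\mathrm{lit}(c)$ are the sets of variables and literals of a clause $c$, and $|F| = |\mathrm{var}(F)| + \sum_{c\in F}(1+|\mathrm{lit}(c)|)$. The incidence graph $\mathrm{inc}(F)$ has the variables and the clauses of $F$ as vertices, and a variable $x$ is adjacent to a clause $c$ iff $x\in\mathrm{var}(c)$. For $B\subseteq\mathrm{var}(F)$ and $\tau:B\to\{0,1\}$, the formula $F[\tau]$ is obtained from $F$ by removing every clause that contains a literal set to $1$ by $\tau$, and removing the literals set to $0$ from the remaining clauses (which are not identified with each other, even if they become equal as sets of literals). For $t\ge 0$ let $\mathcal W_{\le t}$ be the class of CNF formulas whose incidence graph has treewidth at most $t$. A set $B\subseteq\mathrm{var}(F)$ is a strong $\mathcal W_{\le t}$-backdoor set of $F$ if $F[\tau]\in\mathcal W_{\le t}$ for every $\tau:B\to\{0,1\}$. The $r$-wall is the graph with vertex set $\{(i,j): 1\le i,j\le r\}$ ($i,j$ integers) in which $(i,j)$ and $(i',j')$ are adjacent iff either $j'=j$ and $i'\in\{i-1,i+1\}$,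 or $i'=i$ and $j'=j+(-1)^{i+j}$. A topological model of a graph $H$ in a graph $G$ is a subgraph of $G$ obtained from $H$ by replacing the edges by independent paths (it is given by the branch vertices and these paths). For integers $t\ge0$, $k\ge1$ put $$\mathrm{nb}(t)=\lceil 16(t+2)\ln(t+2)\rceil,\quad \mathrm{same}(k,t)=3\,\mathrm{nb}(t)^2\,t\,2^{2k},\quad \mathrm{obs}(k,t)=2^k\,\mathrm{same}(k,t)+k,$$ $$\mathrm{wall}(k,t)=(2t+2)\left(1+\sqrt{\mathrm{obs}(k,t)}\right).$$ **Lemma.** There are functions $C,g:\mathbb N^2\to\mathbb N$ and an algorithm (a single random access machine program) which, given integers $t\ge0$ and $k\ge1$, a CNF formula $F$, and a topological model of a $\mathrm{wall}(k,t)$-wall in $\mathrm{inc}(F)$, computes in at most $C(k,t)\cdot|F|^2$ steps a set $S^*\subseteq\mathrm{var}(F)$ with $|S^*|\le g(k,t)$ such that every strong $\mathcal W_{\le t}$-backdoor set of $F$ of size at most $k$ contains a variable from $S^*$. -/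

import Mathlib

namespace Backdoor

/-! ### Treewidth -/

/-- A tree decomposition of a graph `G`: a finite tree with a bag of vertices at every node, such that
every edge lies in a bag and the nodes whose bag contains a given vertex induce a (nonempty) connected
subgraph of the tree. -/
structure TreeDecomposition {V : Type} (G : SimpleGraph V) where
  ι : Type
  [fintypeι : Fintype ι]
  tree : SimpleGraph ι
  isTree : tree.IsTree
  bag : ι → Finset V
  edge_mem : ∀ u v : V, G.Adj u v → ∃ i, u ∈ bag i ∧ v ∈ bag i
  connected : ∀ v : V, (tree.induce {i | v ∈ bag i}).Connected

/-- The width `max |X_i| - 1` of a tree decomposition (read as `0` if all bags are empty, which is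
possible only for the graph without vertices). -/
def TreeDecomposition.width {V : Type} {G : SimpleGraph V} (D : TreeDecomposition G) : ℕ :=
  letI := D.fintypeι
  (Finset.univ.sup fun i => (D.bag i).card) - 1

/-- The treewidth: the minimum width of a tree decomposition. -/
noncomputable def treewidth {V : Type} (G : SimpleGraph V) : ℕ∞ :=
  ⨅ D : TreeDecomposition G, (D.width : ℕ∞)

/-! ### CNF formulas, incidence graphs, strong backdoor sets -/

/-- The literal `(x, true)` is the variable `x`, the literal `(x, false)` is its negation. -/
abbrev Literal := ℕ × Bool

/-- A CNF formula, written down as a list of clauses, each of which is a list of distinct literals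
without a complementary pair. -/
structure CNF where
  clauses : List (List Literal)
  nodup : ∀ c ∈ clauses, c.Nodup
  not_compl : ∀ c ∈ clauses, ∀ x : ℕ, ¬ ((x, true) ∈ c ∧ (x, false) ∈ c)

namespace CNF

/-- `var(F)`. -/
def vars (F : CNF) : Finset ℕ := (F.clauses.flatten.map Prod.fst).toFinset

/-- The size `|F| = |var(F)| + ∑_c (1 + |lit(c)|)`. -/
def size (F : CNF) : ℕ := F.vars.card + (F.clauses.map fun c => 1 + c.length).sum

/-- The vertices of the incidence graph: the variables and the clauses of `F`
(a clause is represented by its position in `F`). -/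
abbrev IncVertex (F : CNF) : Type := {x : ℕ // x ∈ F.vars} ⊕ Fin F.clauses.length

/-- The incidence graph: a variable is adjacent to the clauses in which it occurs. -/
def inc (F : CNF) : SimpleGraph F.IncVertex :=
  SimpleGraph.fromRel fun a b => match a, b with
    | .inl x, .inr j => ∃ s : Bool, (x.1, s) ∈ F.clauses[j]
    | _, _ => False

/-- The value of a literal under a truth assignment of the variables in `B`
(`none` if the variable of the literal is not in `B`). -/
def evalLiteral {B : Finset ℕ} (τ : {x : ℕ // x ∈ B} → Bool) (l : Literal) : Option Bool :=
  if h : l.1 ∈ B then some (if l.2 then τ ⟨l.1, h⟩ else !(τ ⟨l.1, h⟩)) else none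

/-- `F[τ]`: the clauses containing a literal set to `1` are removed, and the literals set to `0` are
removed from the remaining clauses. Remaining clauses stay distinct vertices of the incidence graph
also if they have become equal as sets of literals, so the incidence graph of `F[τ]` is, up to
isolated variables, obtained from that of `F` by deleting the variables in `B` and the satisfied
clauses. -/
def reduce (F : CNF) {B : Finset ℕ} (τ : {x : ℕ // x ∈ B} → Bool) : CNF where
  clauses := (F.clauses.filter fun c => decide (∀ l ∈ c, evalLiteral τ l ≠ some true)).map
    fun c => c.filter fun l => decide (evalLiteral τ l ≠ some false)
  nodup := by
    intro c hc
    obtain ⟨d, hd, rfl⟩ := List.mem_map.1 hc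
    exact (F.nodup d (List.mem_filter.1 hd).1).filter _
  not_compl := by
    intro c hc x hx
    obtain ⟨d, hd, rfl⟩ := List.mem_map.1 hc
    exact F.not_compl d (List.mem_filter.1 hd).1 x
      ⟨(List.mem_filter.1 hx.1).1, (List.mem_filter.1 hx.2).1⟩

/-- The class of all CNF formulas whose incidence graph has treewidth at most `t`. -/
def treewidthAtMost (t : ℕ) : Set CNF := {F | treewidth F.inc ≤ (t : ℕ∞)}

/-- `B` is a strong `𝒞`-backdoor set of `F`. -/
def IsStrongBackdoor (𝒞 : Set CNF) (F : CNF) (B : Finset ℕ) : Prop :=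
  B ⊆ F.vars ∧ ∀ τ : {x : ℕ // x ∈ B} → Bool, F.reduce τ ∈ 𝒞

end CNF

/-! ### Walls and topological models -/

/-- The `r`-wall. The coordinates run from `0` to `r - 1` instead of from `1` to `r`; shifting both of
them by one does not change the parity of `i + j`. -/
def wall (r : ℕ) : SimpleGraph (Fin r × Fin r) where
  Adj p q :=
    (q.2 = p.2 ∧ ((q.1 : ℤ) = (p.1 : ℤ) - 1 ∨ (q.1 : ℤ) = (p.1 : ℤ) + 1)) ∨
    (q.1 = p.1 ∧ (q.2 : ℤ) = (p.2 : ℤ) + (-1) ^ ((p.1 : ℕ) + (p.2 : ℕ)))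
  symm := ⟨by
    rintro ⟨i, j⟩ ⟨i', j'⟩ (⟨h, h'⟩ | ⟨h, h'⟩)
    · left
      simp only at h h' ⊢
      exact ⟨h.symm, by omega⟩
    · right
      simp only at h h' ⊢
      subst h
      refine ⟨rfl, ?_⟩
      rcases Nat.even_or_odd ((i' : ℕ) + (j : ℕ)) with he | ho
      · rw [he.neg_one_pow] at h'
        have : Odd ((i' : ℕ) + (j' : ℕ)) := by
          rw [Nat.even_iff] at he; rw [Nat.odd_iff]; omega
        rw [this.neg_one_pow]; omega
      · rw [ho.neg_one_pow] at h'
        have : Even ((i' : ℕ) + (j' : ℕ)) := by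
          rw [Nat.odd_iff] at ho; rw [Nat.even_iff]; omega
        rw [this.neg_one_pow]; omega⟩
  loopless := ⟨by
    rintro ⟨i, j⟩ (⟨_, h⟩ | ⟨_, h⟩)
    · simp only at h; omega
    · simp only at h
      rcases neg_one_pow_eq_or ℤ ((i : ℕ) + (j : ℕ)) with e | e <;> rw [e] at h <;> omega⟩

/-- A topological model of `H` in `G`: distinct branch vertices for the vertices of `H`, joined by
independent paths of `G` for the edges of `H` (the two orientations of an edge give the same path). -/
structure TopologicalModel {V W : Type} (H : SimpleGraph V) (G : SimpleGraph W) where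
  branch : V → W
  branch_injective : Function.Injective branch
  path : ∀ {u v : V}, H.Adj u v → G.Walk (branch u) (branch v)
  isPath : ∀ {u v : V} (h : H.Adj u v), (path h).IsPath
  path_symm : ∀ {u v : V} (h : H.Adj u v), path h.symm = (path h).reverse
  branch_mem : ∀ {u v : V} (h : H.Adj u v) (z : V), branch z ∈ (path h).support → z = u ∨ z = v
  independent : ∀ {u v u' v' : V} (h : H.Adj u v) (h' : H.Adj u' v'), s(u, v) ≠ s(u', v') →
    ∀ w, w ∈ (path h).support → w ∈ (path h').support → w = branch u' ∨ w = branch v'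

/-! ### The size of the wall -/

noncomputable def nb (t : ℕ) : ℕ := ⌈16 * ((t : ℝ) + 2) * Real.log ((t : ℝ) + 2)⌉₊

noncomputable def same (k t : ℕ) : ℕ := 3 * (nb t) ^ 2 * t * 2 ^ (2 * k)

noncomputable def obs (k t : ℕ) : ℕ := 2 ^ k * same k t + k

/-- The real number `wall(k,t)`. -/
noncomputable def wallSize (k t : ℕ) : ℝ := (2 * (t : ℝ) + 2) * (1 + Real.sqrt (obs k t))

/-! ### Random access machines -/

namespace RAM

/-- The memory: registers and arrays, all of whose cells hold natural numbers. A program mentions only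
finitely many registers and arrays. -/
structure State where
  reg : ℕ → ℕ
  arr : ℕ → ℕ → ℕ

def State.setReg (σ : State) (x v : ℕ) : State :=
  { σ with reg := Function.update σ.reg x v }

def State.setArr (σ : State) (a i v : ℕ) : State :=
  { σ with arr := Function.update σ.arr a (Function.update (σ.arr a) i v) }

/-- Comparisons of two registers. -/
inductive Test where
  | lt (x y : ℕ)
  | eq (x y : ℕ)
  | not (b : Test)

def Test.eval (σ : State) : Test → Bool
  | .lt x y => decide (σ.reg x < σ.reg y)
  | .eq x y => decide (σ.reg x = σ.reg y)
  | .not b => !(b.eval σ)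

/-- Programs. The arguments of the instructions are numbers of registers (`x y z i j`) and of arrays
(`a`), and a constant `c`. A step increases the largest number in the memory (or in the program) by at
most one, so a polynomial number of steps handles only numbers of logarithmic length. -/
inductive Prog where
  /-- no operation -/
  | skip
  /-- `x := c` -/
  | const (x c : ℕ)
  /-- `x := y` -/
  | copy (x y : ℕ)
  /-- `x := y + 1` -/
  | succ (x y : ℕ)
  /-- `x := y - z` (truncated) -/
  | sub (x y z : ℕ)
  /-- `x := a[i + j]` -/
  | load (x a i j : ℕ)
  /-- `a[i + j] := x` -/
  | store (a i j x : ℕ)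
  | seq (p q : Prog)
  | ite (b : Test) (p q : Prog)
  | while (b : Test) (p : Prog)

/-- `Exec p σ σ' n`: the program `p`, started in the state `σ`, halts in the state `σ'` after exactly
`n` steps. Every elementary instruction and every evaluation of the test of a conditional or a loop is
one step. -/
inductive Exec : Prog → State → State → ℕ → Prop
  | skip (σ) : Exec .skip σ σ 1
  | const (σ x c) : Exec (.const x c) σ (σ.setReg x c) 1
  | copy (σ x y) : Exec (.copy x y) σ (σ.setReg x (σ.reg y)) 1
  | succ (σ x y) : Exec (.succ x y) σ (σ.setReg x (σ.reg y + 1)) 1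
  | sub (σ x y z) : Exec (.sub x y z) σ (σ.setReg x (σ.reg y - σ.reg z)) 1
  | load (σ x a i j) : Exec (.load x a i j) σ (σ.setReg x (σ.arr a (σ.reg i + σ.reg j))) 1
  | store (σ a i j x) :
      Exec (.store a i j x) σ (σ.setArr a (σ.reg i + σ.reg j) (σ.reg x)) 1
  | seq {p q σ σ₁ σ₂ m n} : Exec p σ σ₁ m → Exec q σ₁ σ₂ n → Exec (.seq p q) σ σ₂ (m + n)
  | ite_true {b p q σ σ' n} : b.eval σ = true → Exec p σ σ' n →
      Exec (.ite b p q) σ σ' (n + 1)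
  | ite_false {b p q σ σ' n} : b.eval σ = false → Exec q σ σ' n →
      Exec (.ite b p q) σ σ' (n + 1)
  | while_false {b p σ} : b.eval σ = false → Exec (.while b p) σ σ 1
  | while_true {b p σ σ₁ σ₂ m n} : b.eval σ = true → Exec p σ σ₁ m →
      Exec (.while b p) σ₁ σ₂ n → Exec (.while b p) σ σ₂ (m + n + 1)

/-- Executions are deterministic. -/
theorem Exec.deterministic {p : Prog} {σ σ₁ σ₂ : State} {m n : ℕ} (h₁ : Exec p σ σ₁ m)
    (h₂ : Exec p σ σ₂ n) : σ₁ = σ₂ ∧ m = n := by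
  induction h₁ generalizing σ₂ n with
  | seq _ _ ih₁ ih₂ =>
    cases h₂ with
    | seq a b =>
      obtain ⟨rfl, rfl⟩ := ih₁ a
      obtain ⟨rfl, rfl⟩ := ih₂ b
      exact ⟨rfl, rfl⟩
  | ite_true hb _ ih =>
    cases h₂ with
    | ite_true _ a => obtain ⟨rfl, rfl⟩ := ih a; exact ⟨rfl, rfl⟩
    | ite_false hb' _ => simp [hb] at hb'
  | ite_false hb _ ih =>
    cases h₂ with
    | ite_true hb' _ => simp [hb] at hb'
    | ite_false _ a => obtain ⟨rfl, rfl⟩ := ih a; exact ⟨rfl, rfl⟩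
  | while_false hb =>
    cases h₂ with
    | while_false _ => exact ⟨rfl, rfl⟩
    | while_true hb' _ _ => simp [hb] at hb'
  | while_true hb _ _ ih₁ ih₂ =>
    cases h₂ with
    | while_false hb' => simp [hb] at hb'
    | while_true _ a b =>
      obtain ⟨rfl, rfl⟩ := ih₁ a
      obtain ⟨rfl, rfl⟩ := ih₂ b
      exact ⟨rfl, rfl⟩
  | _ => cases h₂; exact ⟨rfl, rfl⟩

/-- The array holding the given list, followed by zeros. -/
def ofList (l : List ℕ) : ℕ → ℕ := fun i => l.getD i 0

/-- The positions in `ls.flatten` at which the members of `ls` start, followed by the length of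
`ls.flatten`. -/
def offsets {α : Type} (ls : List (List α)) : List ℕ := (ls.map List.length).scanl (· + ·) 0

/-- The output of a halted computation: the first `n` cells of array `0`, where `n` is the content of
register `0`. -/
def State.output (σ : State) : List ℕ := (List.range (σ.reg 0)).map (σ.arr 0)

end RAM

/-! ### The input -/

open Classical in
/-- The vertices of the path of a topological model between two branch vertices, in order (the empty
list for nonadjacent vertices). -/
noncomputable def TopologicalModel.pathList {V W : Type} {H : SimpleGraph V} {G : SimpleGraph W}
    (M : TopologicalModel H G) (u v : V) : List W :=
  if h : H.Adj u v then (M.path h).support else []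

/-- The paths of a topological model of an `r`-wall: for each `(i, j)` in lexicographic order, first the
path for the edge to `(i + 1, j)`, then the path for the edge to `(i, j + 1)`, where the list is empty
if this edge does not exist. -/
noncomputable def wallPaths {r : ℕ} {W : Type} {G : SimpleGraph W}
    (M : TopologicalModel (wall r) G) : List (List W) :=
  (List.finRange r).flatMap fun (i : Fin r) => (List.finRange r).flatMap fun (j : Fin r) =>
    [if h : i.val + 1 < r then M.pathList (i, j) (⟨i.val + 1, h⟩, j) else [],
     if h : j.val + 1 < r then M.pathList (i, j) (i, ⟨j.val + 1, h⟩) else []]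

/-- The initial state for `k`, `t`, a formula `F` and a topological model of an `r`-wall in its
incidence graph. Registers `0, 1, 2, 3`: `k`, `t`, `r` and the number of clauses. Array `0`: where each
clause starts in the concatenation of all clauses, which is held by array `1` (the variables) and
array `2` (the signs). Array `3`: where each path of the wall starts in the concatenation of all paths,
which is held by array `4` (`0` for a variable, `1` for a clause) and array `5` (the variable, or
the position of the clause). All other memory cells are `0`. -/
noncomputable def inputState (k t : ℕ) {r : ℕ} (F : CNF) (M : TopologicalModel (wall r) F.inc) :
    RAM.State where
  reg := RAM.ofList [k, t, r, F.clauses.length]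
  arr := fun a => RAM.ofList <| match a with
    | 0 => RAM.offsets F.clauses
    | 1 => F.clauses.flatten.map Prod.fst
    | 2 => F.clauses.flatten.map fun l => l.2.toNat
    | 3 => RAM.offsets (wallPaths M)
    | 4 => (wallPaths M).flatten.map (Sum.elim (fun _ => 0) (fun _ => 1))
    | 5 => (wallPaths M).flatten.map (Sum.elim Subtype.val Fin.val)
    | _ => []

end Backdoor

/-!
The case `t = 0` is degenerate: an edge of the incidence graph at a variable outside of `B` survives an
assignment that falsifies the literals over `B` of its clause, so a strong backdoor set consists of all
variables, and any variable may be output.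

Let `t ≥ 1`, and call the paths of the wall its pieces. A variable touches a piece if it occurs in a
clause of the piece. If all pieces of many rows and columns were untouched by a backdoor set `B` with
at most `k` elements, they would survive every assignment of `B` and form a grid of too large treewidth
(`le_card_touchedLabels`). So `B` touches at least `r / 4` pieces, and deleting the pieces touched by
variables that touch few of them leaves a nonempty set `Q` of pieces touched by `B` such that every
variable in `B` touching a piece in `Q` is heavy: it touches at least `r / (4 k)` pieces in `Q`
(`exists_subset_uniform`). If the set `Z` of heavy variables is small, it is a possible answer.
Otherwise every piece in `Q` is cut greedily into segments with at least `2 t` neighbours in `Z`.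
The following facts bound the numbers involved.

* The clauses with many neighbours in `Z` have only `O(|Z|)` neighbours altogether: each of them survives
  some assignment of `B`, and a bipartite graph of small treewidth is sparse (`sum_card_zNbr_le`). As
  the wall is large and all members of `Z` are heavy, there are many more segments with few neighbours
  than members of `Z` (`sum_touchCount_le`).
* The segments untouched by `B` that avoid `Z` and the branch vertices survive every assignment, and
  contracting them gives a bipartite graph with at least `2 t` edges per segment, so again by sparsity
  there are at most `|Z|` of them (`card_untouched_le`). Only few segments meet `Z` or the branch
  vertices (`card_meeting_le`).

Hence some variable of `B` touches a fraction `1 / (2 k)` of the segments with few neighbours, and only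
few variables do so (`exists_good_labels`). Sparsity and the grid obstruction are both derived from the
Helly type fact `nearest_mem_of_inter` on subtrees of a tree.

The number of sets `Q` of pieces depends only on `k` and `t`, and the algorithm tries all of them. It
need not know which of the two cases applies: one digit of the number encoding `Q` selects the case, and
each selection contributes at most `pw = 2 ^ (2 r ^ 2 + 1)` variables to the output. For a fixed
selection and a fixed literal, one scan of the pieces, which takes linear time, computes how many pieces
and how many segments are touched by the variable of the literal; doing so for all literals takes
quadratic time. The program is verified with a Hoare style calculus `Runs` which also bounds the number
of steps.
-/

namespace Backdoor

/-! ### Subtrees of a tree -/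

section Tree

variable {ι : Type*} {T : SimpleGraph ι}

/-- A shortest walk to a vertex of `A` nearest to `ρ`, continued inside the connected set `A`, is the
path of the tree. -/
theorem exists_path_through_nearest (hT : T.IsTree) {ρ a x : ι} {A : Set ι}
    (hA : (T.induce A).Connected) (ha : a ∈ A) (hmin : ∀ y ∈ A, T.dist ρ a ≤ T.dist ρ y)
    (hx : x ∈ A) :
    ∃ (p : T.Walk ρ a) (q : T.Walk a x), (p.append q).IsPath ∧ p.length = T.dist ρ a ∧
      ∀ y ∈ q.support, y ∈ A := by
  classical
  obtain ⟨p, hp, hlen⟩ := (hT.1 ρ a).exists_path_of_dist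
  obtain ⟨q₀⟩ := hA.preconnected ⟨a, ha⟩ ⟨x, hx⟩
  let f : T.induce A ↪g T := SimpleGraph.Embedding.induce A
  let q : T.Walk a x := q₀.toPath.1.map f.toHom
  have hq : q.IsPath := q₀.toPath.2.map f.injective
  have hqA : ∀ y ∈ q.support, y ∈ A := by
    intro y hy
    have hy' : y ∈ q₀.toPath.1.support.map f.toHom :=
      SimpleGraph.Walk.support_map f.toHom q₀.toPath.1 ▸ hy
    obtain ⟨z, -, rfl⟩ := List.mem_map.1 hy'
    exact z.2
  have hpA : ∀ y ∈ p.support, y ∈ A → y = a := by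
    intro y hy hyA
    by_contra hne
    have h1 := SimpleGraph.Walk.length_takeUntil_lt_length hy hne
    have h2 := SimpleGraph.dist_le (p.takeUntil y hy)
    have h3 := hmin y hyA
    omega
  refine ⟨p, q, ?_, hlen, hqA⟩
  rw [SimpleGraph.Walk.isPath_def, SimpleGraph.Walk.support_append, List.nodup_append']
  have hqn := hq.support_nodup
  refine ⟨hp.support_nodup, hqn.tail, ?_⟩
  intro y hy hy'
  have hya := hpA y hy (hqA y (List.mem_of_mem_tail hy'))
  rw [← SimpleGraph.Walk.cons_tail_support, List.nodup_cons] at hqn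
  exact hqn.1 (hya ▸ hy')

/-- Of two intersecting subtrees, the one whose vertex nearest to the root is farther from the root
has this vertex in common with the other one. -/
theorem nearest_mem_of_inter (hT : T.IsTree) {ρ a b : ι} {A B : Set ι}
    (hA : (T.induce A).Connected) (hB : (T.induce B).Connected) (hAB : (A ∩ B).Nonempty)
    (ha : a ∈ A) (hamin : ∀ y ∈ A, T.dist ρ a ≤ T.dist ρ y)
    (hb : b ∈ B) (hbmin : ∀ y ∈ B, T.dist ρ b ≤ T.dist ρ y)
    (hab : T.dist ρ b ≤ T.dist ρ a) : a ∈ B := by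
  classical
  obtain ⟨x, hxA, hxB⟩ := hAB
  obtain ⟨p, q, hpq, -, -⟩ := exists_path_through_nearest hT hA ha hamin hxA
  obtain ⟨p', q', hpq', hlen', hq'B⟩ := exists_path_through_nearest hT hB hb hbmin hxB
  have heq : p.append q = p'.append q' := by
    have := (hT.2.subsingleton_path ρ x).elim ⟨_, hpq⟩ ⟨_, hpq'⟩
    exact congrArg Subtype.val this
  have hmem : a ∈ (p'.append q').support := by
    rw [← heq, SimpleGraph.Walk.mem_support_append_iff]
    exact Or.inl p.end_mem_support
  rw [SimpleGraph.Walk.mem_support_append_iff] at hmem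
  rcases hmem with h | h
  · by_contra hne
    have hneb : a ≠ b := fun e => hne (e ▸ hb)
    have h1 := SimpleGraph.Walk.length_takeUntil_lt_length h hneb
    have h2 := SimpleGraph.dist_le (p'.takeUntil a h)
    omega
  · exact hq'B a h

theorem exists_nearest (T : SimpleGraph ι) (ρ : ι) {A : Set ι} (hA : A.Nonempty) :
    ∃ a ∈ A, ∀ y ∈ A, T.dist ρ a ≤ T.dist ρ y := by
  classical
  obtain ⟨a, ha⟩ := hA
  have hex : ∃ n, ∃ a ∈ A, T.dist ρ a = n := ⟨_, a, ha, rfl⟩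
  obtain ⟨a, ha, hn⟩ := Nat.find_spec hex
  exact ⟨a, ha, fun y hy => hn ▸ Nat.find_min' hex ⟨y, hy, rfl⟩⟩

/-- Finitely many pairwise intersecting subtrees of a tree have a common vertex. -/
theorem helly_subtrees (hT : T.IsTree) {α : Type*} (s : Finset α) (hs : s.Nonempty)
    (A : α → Set ι) (hA : ∀ a ∈ s, (T.induce (A a)).Connected)
    (hinter : ∀ a ∈ s, ∀ b ∈ s, (A a ∩ A b).Nonempty) : ∃ i, ∀ a ∈ s, i ∈ A a := by
  classical
  obtain ⟨ρ⟩ := hT.1.nonempty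
  have hne : ∀ a, ∃ i, a ∈ s → i ∈ A a ∧ ∀ y ∈ A a, T.dist ρ i ≤ T.dist ρ y := by
    intro a
    by_cases ha : a ∈ s
    · obtain ⟨i, hi, hmin⟩ := exists_nearest T ρ (hinter a ha a ha).left
      exact ⟨i, fun _ => ⟨hi, hmin⟩⟩
    · exact ⟨ρ, fun h => absurd h ha⟩
  choose top htop using hne
  obtain ⟨a, ha, hmax⟩ := s.exists_max_image (fun a => T.dist ρ (top a)) hs
  refine ⟨top a, fun b hb => ?_⟩
  exact nearest_mem_of_inter hT (hA a ha) (hA b hb) (hinter a ha b hb) (htop a ha).1 (htop a ha).2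
    (htop b hb).1 (htop b hb).2 (hmax b hb)

/-- A bipartite intersection graph of subtrees of a tree, at most `t + 1` of which meet in a point, is
sparse: every edge is charged to that one of its ends whose subtree starts farther from the root. -/
theorem card_inter_pairs_le (hT : T.IsTree) {α β : Type*} {t : ℕ}
    (s : Finset α) (s' : Finset β) (A : α → Set ι) (A' : β → Set ι)
    (hA : ∀ a ∈ s, (T.induce (A a)).Connected) (hA' : ∀ b ∈ s', (T.induce (A' b)).Connected)
    (hload : ∀ i, ∀ u ⊆ s, ∀ u' ⊆ s', (∀ a ∈ u, i ∈ A a) → (∀ b ∈ u', i ∈ A' b) →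
      u.card + u'.card ≤ t + 1)
    (E : Finset (α × β)) (hE : ∀ e ∈ E, e.1 ∈ s ∧ e.2 ∈ s' ∧ (A e.1 ∩ A' e.2).Nonempty) :
    E.card ≤ t * (s.card + s'.card) := by
  classical
  obtain ⟨ρ⟩ := hT.1.nonempty
  have hne : ∀ a, ∃ i, a ∈ s → i ∈ A a ∧ ∀ y ∈ A a, T.dist ρ i ≤ T.dist ρ y := by
    intro a
    by_cases ha : a ∈ s
    · obtain ⟨x⟩ := (hA a ha).nonempty
      obtain ⟨i, hi, hmin⟩ := exists_nearest T ρ ⟨x.1, x.2⟩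
      exact ⟨i, fun _ => ⟨hi, hmin⟩⟩
    · exact ⟨ρ, fun h => absurd h ha⟩
  have hne' : ∀ a, ∃ i, a ∈ s' → i ∈ A' a ∧ ∀ y ∈ A' a, T.dist ρ i ≤ T.dist ρ y := by
    intro a
    by_cases ha : a ∈ s'
    · obtain ⟨x⟩ := (hA' a ha).nonempty
      obtain ⟨i, hi, hmin⟩ := exists_nearest T ρ ⟨x.1, x.2⟩
      exact ⟨i, fun _ => ⟨hi, hmin⟩⟩
    · exact ⟨ρ, fun h => absurd h ha⟩
  choose top htop using hne
  choose top' htop' using hne'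
  let E₁ : Finset (α × β) := s.biUnion fun a => (s'.filter fun b => top a ∈ A' b).image fun b => (a, b)
  let E₂ : Finset (α × β) := s'.biUnion fun b => (s.filter fun a => top' b ∈ A a).image fun a => (a, b)
  have hsub : E ⊆ E₁ ∪ E₂ := by
    rintro ⟨a, b⟩ he
    obtain ⟨ha, hb, hab⟩ := hE _ he
    dsimp only at ha hb hab
    rw [Finset.mem_union]
    rcases le_total (T.dist ρ (top' b)) (T.dist ρ (top a)) with h | h
    · left
      have := nearest_mem_of_inter hT (hA a ha) (hA' b hb) hab (htop a ha).1 (htop a ha).2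
        (htop' b hb).1 (htop' b hb).2 h
      simp only [E₁, Finset.mem_biUnion, Finset.mem_image, Finset.mem_filter]
      exact ⟨a, ha, b, ⟨hb, this⟩, rfl⟩
    · right
      have := nearest_mem_of_inter hT (hA' b hb) (hA a ha) (by rwa [Set.inter_comm])
        (htop' b hb).1 (htop' b hb).2 (htop a ha).1 (htop a ha).2 h
      simp only [E₂, Finset.mem_biUnion, Finset.mem_image, Finset.mem_filter]
      exact ⟨b, hb, a, ⟨ha, this⟩, rfl⟩
  have h₁ : E₁.card ≤ s.card * t := by
    refine Finset.card_biUnion_le_card_mul _ _ _ fun a ha => Finset.card_image_le.trans ?_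
    have := hload (top a) {a} (by simpa using ha) (s'.filter fun b => top a ∈ A' b)
      (Finset.filter_subset _ _) (by simpa using (htop a ha).1) (by simp)
    simp only [Finset.card_singleton] at this
    omega
  have h₂ : E₂.card ≤ s'.card * t := by
    refine Finset.card_biUnion_le_card_mul _ _ _ fun b hb => Finset.card_image_le.trans ?_
    have := hload (top' b) (s.filter fun a => top' b ∈ A a) (Finset.filter_subset _ _) {b}
      (by simpa using hb) (by simp) (by simpa using (htop' b hb).1)
    simp only [Finset.card_singleton] at this
    omega
  calc E.card ≤ E₁.card + E₂.card := (Finset.card_le_card hsub).trans (Finset.card_union_le _ _)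
    _ ≤ s.card * t + s'.card * t := by omega
    _ = t * (s.card + s'.card) := by ring

end Tree

/-! ### Tree decompositions of induced subgraphs -/

/-- A tree decomposition of width at most `t` of the subgraph of `G` induced by `U`. -/
structure PartialDecomposition {V : Type*} (G : SimpleGraph V) (U : Set V) (t : ℕ) where
  ι : Type
  tree : SimpleGraph ι
  isTree : tree.IsTree
  bag : ι → Finset V
  card_bag_le : ∀ i, (bag i).card ≤ t + 1
  edge_mem : ∀ u ∈ U, ∀ v ∈ U, G.Adj u v → ∃ i, u ∈ bag i ∧ v ∈ bag i
  connected : ∀ v ∈ U, (tree.induce {i | v ∈ bag i}).Connected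

namespace PartialDecomposition

variable {V : Type*} {G : SimpleGraph V} {U : Set V} {t : ℕ} (D : PartialDecomposition G U t)

/-- The nodes of the tree whose bag meets `S`. -/
def nodes (S : Set V) : Set D.ι := {i | ∃ v ∈ S, v ∈ D.bag i}

/-- The nodes whose bag meets `S` form a subtree. -/
def Conn (S : Set V) : Prop := (D.tree.induce (D.nodes S)).Connected

theorem nodes_union (S S' : Set V) : D.nodes (S ∪ S') = D.nodes S ∪ D.nodes S' := by
  ext i
  simp only [nodes, Set.mem_union, Set.mem_ofPred_eq]
  constructor
  · rintro ⟨v, h | h, hv⟩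
    · exact Or.inl ⟨v, h, hv⟩
    · exact Or.inr ⟨v, h, hv⟩
  · rintro (⟨v, h, hv⟩ | ⟨v, h, hv⟩)
    · exact ⟨v, Or.inl h, hv⟩
    · exact ⟨v, Or.inr h, hv⟩

theorem conn_singleton {v : V} (hv : v ∈ U) : D.Conn {v} := by
  have : D.nodes {v} = {i | v ∈ D.bag i} := by ext i; simp [nodes]
  unfold Conn
  rw [this]
  exact D.connected v hv

theorem nodes_inter_nonempty_of_mem {S S' : Set V} {v : V} (hv : v ∈ U) (h : v ∈ S) (h' : v ∈ S') :
    (D.nodes S ∩ D.nodes S').Nonempty := by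
  obtain ⟨⟨i, hi⟩⟩ := (D.connected v hv).nonempty
  exact ⟨i, ⟨v, h, hi⟩, ⟨v, h', hi⟩⟩

theorem nodes_inter_nonempty_of_adj {S S' : Set V} {u v : V} (hu : u ∈ U) (hv : v ∈ U)
    (h : u ∈ S) (h' : v ∈ S') (huv : G.Adj u v) : (D.nodes S ∩ D.nodes S').Nonempty := by
  obtain ⟨i, hi, hi'⟩ := D.edge_mem u hu v hv huv
  exact ⟨i, ⟨u, h, hi⟩, ⟨v, h', hi'⟩⟩

variable {D}

theorem Conn.union {S S' : Set V} (h : D.Conn S) (h' : D.Conn S')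
    (hi : (D.nodes S ∩ D.nodes S').Nonempty) : D.Conn (S ∪ S') := by
  unfold Conn
  rw [nodes_union]
  exact SimpleGraph.induce_union_connected h.preconnected h'.preconnected hi

variable (D)

theorem conn_of_isChain {l : List V} (hl : l ≠ []) (hc : l.IsChain G.Adj) (hU : ∀ v ∈ l, v ∈ U) :
    D.Conn {v | v ∈ l} := by
  induction l with
  | nil => exact absurd rfl hl
  | cons v l ih =>
    have hv : v ∈ U := hU v (by simp)
    cases l with
    | nil => simpa using D.conn_singleton hv
    | cons w l =>
      have hw : w ∈ U := hU w (by simp)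
      rw [List.isChain_cons_cons] at hc
      have h := ih (by simp) hc.2 fun x hx => hU x (List.mem_cons_of_mem _ hx)
      have := (D.conn_singleton hv).union h
        (D.nodes_inter_nonempty_of_adj hv hw rfl (by simp) hc.1)
      convert this using 1
      ext x
      simp

/-- Two disjoint families of disjoint connected sets span a sparse bipartite minor. -/
theorem card_minor_edges_le {α β : Type*} (s : Finset α) (s' : Finset β)
    (A : α → Set V) (A' : β → Set V) (hA : ∀ a ∈ s, D.Conn (A a)) (hA' : ∀ b ∈ s', D.Conn (A' b))
    (hd : ∀ a ∈ s, ∀ b ∈ s, ∀ v, v ∈ A a → v ∈ A b → a = b)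
    (hd' : ∀ a ∈ s', ∀ b ∈ s', ∀ v, v ∈ A' a → v ∈ A' b → a = b)
    (hdd : ∀ a ∈ s, ∀ b ∈ s', ∀ v, v ∈ A a → v ∉ A' b)
    (E : Finset (α × β))
    (hE : ∀ e ∈ E, e.1 ∈ s ∧ e.2 ∈ s' ∧ ∃ u ∈ A e.1, ∃ v ∈ A' e.2, u ∈ U ∧ v ∈ U ∧ G.Adj u v) :
    E.card ≤ t * (s.card + s'.card) := by
  classical
  refine card_inter_pairs_le D.isTree s s' (fun a => D.nodes (A a)) (fun b => D.nodes (A' b)) hA hA'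
    ?_ E ?_
  · intro i u hu u' hu' hi hi'
    rcases isEmpty_or_nonempty V with hV | hV
    · have h₁ : u = ∅ := Finset.eq_empty_of_forall_notMem fun a ha => hV.false (hi a ha).choose
      have h₂ : u' = ∅ := Finset.eq_empty_of_forall_notMem fun a ha => hV.false (hi' a ha).choose
      simp [h₁, h₂]
    choose! f hf hfb using hi
    choose! f' hf' hfb' using hi'
    have h₁ : (u.image f).card = u.card := Finset.card_image_of_injOn fun a ha b hb hab =>
      hd a (hu ha) b (hu hb) (f a) (hf a ha) (by rw [hab]; exact hf b hb)
    have h₂ : (u'.image f').card = u'.card := Finset.card_image_of_injOn fun a ha b hb hab =>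
      hd' a (hu' ha) b (hu' hb) (f' a) (hf' a ha) (by rw [hab]; exact hf' b hb)
    have h₃ : Disjoint (u.image f) (u'.image f') := by
      rw [Finset.disjoint_left]
      intro v hv hv'
      obtain ⟨a, ha, rfl⟩ := Finset.mem_image.1 hv
      obtain ⟨b, hb, hab⟩ := Finset.mem_image.1 hv'
      exact hdd a (hu ha) b (hu' hb) (f a) (hf a ha) (hab ▸ hf' b hb)
    rw [← h₁, ← h₂, ← Finset.card_union_of_disjoint h₃]
    refine (Finset.card_le_card ?_).trans (D.card_bag_le i)
    intro v hv
    rcases Finset.mem_union.1 hv with hv | hv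
    · obtain ⟨a, ha, rfl⟩ := Finset.mem_image.1 hv
      exact hfb a ha
    · obtain ⟨a, ha, rfl⟩ := Finset.mem_image.1 hv
      exact hfb' a ha
  · intro e he
    obtain ⟨h1, h2, u, hu, v, hv, hu', hv', huv⟩ := hE e he
    exact ⟨h1, h2, D.nodes_inter_nonempty_of_adj hu' hv' hu hv huv⟩

theorem exists_disjoint_bag (i : D.ι) {γ : Type*} (s : Finset γ) (A : γ → Set V)
    (hs : t + 2 ≤ s.card) (hd : ∀ a ∈ s, ∀ b ∈ s, ∀ v, v ∈ A a → v ∈ A b → a = b) :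
    ∃ a ∈ s, ∀ v ∈ D.bag i, v ∉ A a := by
  classical
  by_contra hcon
  push Not at hcon
  obtain ⟨a₀, ha₀⟩ := Finset.card_pos.1 (show 0 < s.card by omega)
  have : Nonempty V := ⟨(hcon a₀ ha₀).choose⟩
  choose! f hf hfA using hcon
  have : (s.image f).card = s.card := Finset.card_image_of_injOn fun a ha b hb hab =>
    hd a ha b hb (f a) (hfA a ha) (by rw [hab]; exact hfA b hb)
  have h2 : s.image f ⊆ D.bag i := by
    intro v hv
    obtain ⟨a, ha, rfl⟩ := Finset.mem_image.1 hv
    exact hf a ha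
  have := Finset.card_le_card h2
  have := D.card_bag_le i
  omega

/-- A grid of `t + 2` disjoint connected rows and `t + 2` disjoint connected columns, every row meeting
every column, does not fit into width `t`: the bag common to all crosses would meet every row or every
column. -/
theorem false_of_grid {α β : Type*} (s : Finset α) (s' : Finset β) (hs : t + 2 ≤ s.card)
    (hs' : t + 2 ≤ s'.card) (A : α → Set V) (A' : β → Set V)
    (hA : ∀ a ∈ s, D.Conn (A a)) (hA' : ∀ b ∈ s', D.Conn (A' b))
    (hd : ∀ a ∈ s, ∀ b ∈ s, ∀ v, v ∈ A a → v ∈ A b → a = b)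
    (hd' : ∀ a ∈ s', ∀ b ∈ s', ∀ v, v ∈ A' a → v ∈ A' b → a = b)
    (hm : ∀ a ∈ s, ∀ b ∈ s', ∃ v ∈ U, v ∈ A a ∧ v ∈ A' b) : False := by
  classical
  have hne : (s ×ˢ s').Nonempty :=
    Finset.Nonempty.product (Finset.card_pos.1 (by omega)) (Finset.card_pos.1 (by omega))
  obtain ⟨i, hi⟩ := helly_subtrees D.isTree (s ×ˢ s') hne
    (fun e => D.nodes (A e.1 ∪ A' e.2)) (by
      rintro ⟨a, b⟩ h
      obtain ⟨ha, hb⟩ := Finset.mem_product.1 h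
      obtain ⟨v, hv, h1, h2⟩ := hm a ha b hb
      exact (hA a ha).union (hA' b hb) (D.nodes_inter_nonempty_of_mem hv h1 h2)) (by
      rintro ⟨a, b⟩ h ⟨c, d⟩ h'
      obtain ⟨ha, hb⟩ := Finset.mem_product.1 h
      obtain ⟨hc, hd⟩ := Finset.mem_product.1 h'
      obtain ⟨v, hv, h1, h2⟩ := hm a ha d hd
      exact D.nodes_inter_nonempty_of_mem hv (Or.inl h1) (Or.inr h2))
  obtain ⟨a, ha, ha'⟩ := D.exists_disjoint_bag i s A hs hd
  obtain ⟨b, hb, hb'⟩ := D.exists_disjoint_bag i s' A' hs' hd'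
  obtain ⟨v, hv, hvi⟩ := hi (a, b) (Finset.mk_mem_product ha hb)
  rcases hv with hv | hv
  · exact ha' v hvi hv
  · exact hb' v hvi hv

/-- Tree decompositions pull back along embeddings of an induced subgraph. -/
theorem exists_of_treewidth_le {V W : Type} {G : SimpleGraph V} {H : SimpleGraph W} {t : ℕ}
    (U : Set V) (f : U → W) (hf : Function.Injective f)
    (hadj : ∀ u v : U, G.Adj u v → H.Adj (f u) (f v)) (ht : treewidth H ≤ (t : ℕ∞)) :
    Nonempty (PartialDecomposition G U t) := by
  classical
  have hlt : treewidth H < ((t + 1 : ℕ) : ℕ∞) := lt_of_le_of_lt ht (by exact_mod_cast t.lt_succ_self)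
  obtain ⟨D, hD⟩ := iInf_lt_iff.1 hlt
  have hD' : D.width < t + 1 := by exact_mod_cast hD
  let := D.fintypeι
  refine ⟨⟨D.ι, D.tree, D.isTree,
    fun i => ((D.bag i).preimage f hf.injOn).map (Function.Embedding.subtype _), ?_, ?_, ?_⟩⟩
  · intro i
    have h1 : (D.bag i).card ≤ Finset.univ.sup fun i => (D.bag i).card :=
      Finset.le_sup (f := fun i => (D.bag i).card) (Finset.mem_univ i)
    have h2 : ((D.bag i).preimage f hf.injOn).card ≤ (D.bag i).card :=
      Finset.card_le_card_of_injOn f (fun v hv => by simpa using hv) hf.injOn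
    rw [Finset.card_map]
    unfold TreeDecomposition.width at hD'
    omega
  · intro u hu v hv h
    obtain ⟨i, hi, hi'⟩ := D.edge_mem _ _ (hadj ⟨u, hu⟩ ⟨v, hv⟩ h)
    exact ⟨i, by simpa using ⟨hu, hi⟩, by simpa using ⟨hv, hi'⟩⟩
  · intro v hv
    convert D.connected (f ⟨v, hv⟩) using 2
    all_goals simp [hv]

end PartialDecomposition

/-! ### Tree decompositions of reduced formulas -/

theorem getElem?_filter_countP_take {α : Type*} (p : α → Bool) (l : List α) (j : ℕ)
    (hj : j < l.length) (hp : p l[j] = true) :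
    (l.filter p)[(l.take j).countP p]? = some l[j] := by
  induction l generalizing j with
  | nil => simp at hj
  | cons a l ih =>
    cases j with
    | zero => simp only [List.getElem_cons_zero] at hp; simp [hp]
    | succ j =>
      simp only [List.getElem_cons_succ] at hp
      have := ih j (by simpa using hj) hp
      by_cases ha : p a = true
      · simpa [List.filter_cons, ha, List.countP_cons] using this
      · simpa [List.filter_cons, ha, List.countP_cons] using this

theorem countP_take_lt_countP_take {α : Type*} (p : α → Bool) (l : List α) {i j : ℕ}
    (hi : i < l.length) (hij : i < j) (hp : p l[i] = true) :
    (l.take i).countP p < (l.take j).countP p := by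
  have h1 : (l.take (i + 1)).countP p = (l.take i).countP p + 1 := by
    rw [List.take_succ_eq_append_getElem hi, List.countP_append]
    simp [hp]
  have h2 : (l.take (i + 1)).countP p ≤ (l.take j).countP p :=
    (List.take_prefix_take_left (by omega)).sublist.countP_le
  omega

namespace CNF

variable (F : CNF)

/-- The variables of a clause vertex of the incidence graph; a variable vertex has none. -/
def nbr : F.IncVertex → Finset ℕ
  | .inl _ => ∅
  | .inr j => (F.clauses[j].map Prod.fst).toFinset

variable {F}

theorem mem_nbr_inr {x : ℕ} {j : Fin F.clauses.length} :
    x ∈ F.nbr (.inr j) ↔ ∃ s : Bool, (x, s) ∈ F.clauses[j] := by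
  simp [nbr]

theorem nbr_subset_vars (v : F.IncVertex) : F.nbr v ⊆ F.vars := by
  intro x hx
  cases v with
  | inl y => simp [nbr] at hx
  | inr j =>
    obtain ⟨s, hs⟩ := mem_nbr_inr.1 hx
    simp only [vars, List.mem_toFinset, List.mem_map, List.mem_flatten]
    exact ⟨(x, s), ⟨F.clauses[j], List.getElem_mem _, hs⟩, rfl⟩

theorem inc_adj_iff {u v : F.IncVertex} : F.inc.Adj u v ↔
    ∃ x j, x.1 ∈ F.nbr (.inr j) ∧ ((u = .inl x ∧ v = .inr j) ∨ (u = .inr j ∧ v = .inl x)) := by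
  rw [inc, SimpleGraph.fromRel_adj]
  constructor
  · rintro ⟨-, h⟩
    rcases u with x | j <;> rcases v with y | i <;> simp only [or_self, or_false, false_or] at h
    · exact ⟨x, i, mem_nbr_inr.2 h, Or.inl ⟨rfl, rfl⟩⟩
    · exact ⟨y, j, mem_nbr_inr.2 h, Or.inr ⟨rfl, rfl⟩⟩
  · rintro ⟨x, j, h, ⟨rfl, rfl⟩ | ⟨rfl, rfl⟩⟩
    · exact ⟨by simp, Or.inl (mem_nbr_inr.1 h)⟩
    · exact ⟨by simp, Or.inr (mem_nbr_inr.1 h)⟩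

theorem adj_inl_inr {x : {x : ℕ // x ∈ F.vars}} {j : Fin F.clauses.length}
    (h : x.1 ∈ F.nbr (.inr j)) : F.inc.Adj (.inl x) (.inr j) :=
  inc_adj_iff.2 ⟨x, j, h, Or.inl ⟨rfl, rfl⟩⟩

variable (F)

/-- The clauses that `τ` does not satisfy and the variables outside of `B` occurring in them. -/
def surviving {B : Finset ℕ} (τ : {x : ℕ // x ∈ B} → Bool) : Set F.IncVertex := fun v =>
  match v with
  | .inr j => ∀ l ∈ F.clauses[j], evalLiteral τ l ≠ some true
  | .inl x => x.1 ∉ B ∧ ∃ j : Fin F.clauses.length,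
      (∀ l ∈ F.clauses[j], evalLiteral τ l ≠ some true) ∧ x.1 ∈ F.nbr (.inr j)

variable {F}

theorem inr_mem_surviving {B : Finset ℕ} {τ : {x : ℕ // x ∈ B} → Bool} {j : Fin F.clauses.length} :
    (Sum.inr j : F.IncVertex) ∈ F.surviving τ ↔
      ∀ l ∈ F.clauses[j], evalLiteral τ l ≠ some true := Iff.rfl

theorem inl_mem_surviving {B : Finset ℕ} {τ : {x : ℕ // x ∈ B} → Bool} {x : {x : ℕ // x ∈ F.vars}} :
    (Sum.inl x : F.IncVertex) ∈ F.surviving τ ↔ x.1 ∉ B ∧ ∃ j : Fin F.clauses.length,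
      (Sum.inr j : F.IncVertex) ∈ F.surviving τ ∧ x.1 ∈ F.nbr (.inr j) := Iff.rfl

theorem inr_mem_surviving_of_disjoint {B : Finset ℕ} (τ : {x : ℕ // x ∈ B} → Bool)
    {j : Fin F.clauses.length} (h : ∀ x ∈ F.nbr (.inr j), x ∉ B) :
    (Sum.inr j : F.IncVertex) ∈ F.surviving τ := by
  intro l hl
  have : l.1 ∉ B := h l.1 (mem_nbr_inr.2 ⟨l.2, hl⟩)
  simp [evalLiteral, this]

/-- The assignment falsifying all literals over `B` of a clause. -/
def falsify (F : CNF) (B : Finset ℕ) (j : Fin F.clauses.length) : {x : ℕ // x ∈ B} → Bool :=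
  fun x => decide ((x.1, false) ∈ F.clauses[j])

theorem inr_mem_surviving_falsify (B : Finset ℕ) (j : Fin F.clauses.length) :
    (Sum.inr j : F.IncVertex) ∈ F.surviving (F.falsify B j) := by
  rintro ⟨x, s⟩ hl
  by_cases hx : x ∈ B
  · cases s with
    | true =>
      have := F.not_compl F.clauses[j] (List.getElem_mem _) x
      have h2 : (x, false) ∉ F.clauses[j] := fun h => this ⟨hl, h⟩
      simpa [evalLiteral, hx, falsify] using h2
    | false => simpa [evalLiteral, hx, falsify] using hl
  · simp [evalLiteral, hx]

section Reduce

variable {B : Finset ℕ} (τ : {x : ℕ // x ∈ B} → Bool)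

theorem reduce_clauses_getElem? {j : Fin F.clauses.length}
    (hj : (Sum.inr j : F.IncVertex) ∈ F.surviving τ) :
    (F.reduce τ).clauses[(F.clauses.take j).countP
        fun c => decide (∀ l ∈ c, evalLiteral τ l ≠ some true)]? =
      some (F.clauses[j].filter fun l => decide (evalLiteral τ l ≠ some false)) := by
  have := getElem?_filter_countP_take (fun c => decide (∀ l ∈ c, evalLiteral τ l ≠ some true))
    F.clauses j j.2 (by simpa using inr_mem_surviving.1 hj)
  simp only [reduce, List.getElem?_map, this, Option.map_some]
  rfl

/-- The position in `F[τ]` of a surviving clause. -/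
def reduceIndex {j : Fin F.clauses.length} (hj : (Sum.inr j : F.IncVertex) ∈ F.surviving τ) :
    Fin (F.reduce τ).clauses.length :=
  ⟨_, (List.getElem?_eq_some_iff.1 (reduce_clauses_getElem? τ hj)).1⟩

theorem mem_nbr_reduceIndex {j : Fin F.clauses.length}
    (hj : (Sum.inr j : F.IncVertex) ∈ F.surviving τ) {x : ℕ} (hx : x ∈ F.nbr (.inr j))
    (hxB : x ∉ B) : x ∈ (F.reduce τ).nbr (.inr (reduceIndex τ hj)) := by
  obtain ⟨s, hs⟩ := mem_nbr_inr.1 hx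
  refine mem_nbr_inr.2 ⟨s, ?_⟩
  have := (List.getElem?_eq_some_iff.1 (reduce_clauses_getElem? τ hj)).2
  change (x, s) ∈ (F.reduce τ).clauses[(reduceIndex τ hj).1]
  simp only [reduceIndex, this, List.mem_filter]
  exact ⟨hs, by simp [evalLiteral, hxB]⟩

theorem reduceIndex_injective {i j : Fin F.clauses.length}
    (hi : (Sum.inr i : F.IncVertex) ∈ F.surviving τ)
    (hj : (Sum.inr j : F.IncVertex) ∈ F.surviving τ)
    (h : reduceIndex τ hi = reduceIndex τ hj) : i = j := by
  have h' := congrArg Fin.val h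
  simp only [reduceIndex] at h'
  rcases lt_trichotomy i.1 j.1 with hlt | heq | hlt
  · have := countP_take_lt_countP_take (fun c => decide (∀ l ∈ c, evalLiteral τ l ≠ some true))
      F.clauses i.2 hlt (by simpa using inr_mem_surviving.1 hi)
    omega
  · exact Fin.ext heq
  · have := countP_take_lt_countP_take (fun c => decide (∀ l ∈ c, evalLiteral τ l ≠ some true))
      F.clauses j.2 hlt (by simpa using inr_mem_surviving.1 hj)
    omega

theorem mem_vars_reduce {x : {x : ℕ // x ∈ F.vars}} (hx : (Sum.inl x : F.IncVertex) ∈ F.surviving τ) :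
    x.1 ∈ (F.reduce τ).vars := by
  obtain ⟨hxB, j, hj, hxj⟩ := inl_mem_surviving.1 hx
  exact nbr_subset_vars _ (mem_nbr_reduceIndex τ hj hxj hxB)

/-- The surviving vertices, as vertices of the incidence graph of `F[τ]`. -/
def reduceVertex : F.surviving τ → (F.reduce τ).IncVertex
  | ⟨.inl x, h⟩ => .inl ⟨x.1, mem_vars_reduce τ h⟩
  | ⟨.inr _, h⟩ => .inr (reduceIndex τ h)

theorem reduceVertex_injective : Function.Injective (reduceVertex (F := F) τ) := by
  rintro ⟨x | i, hu⟩ ⟨y | j, hv⟩ h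
  · simp only [reduceVertex, Sum.inl.injEq, Subtype.mk.injEq] at h
    exact Subtype.ext (congrArg Sum.inl (Subtype.ext h))
  · simp [reduceVertex] at h
  · simp [reduceVertex] at h
  · simp only [reduceVertex, Sum.inr.injEq] at h
    exact Subtype.ext (congrArg Sum.inr (reduceIndex_injective τ hu hv h))

/-- Small treewidth of `F[τ]` bounds the part of the incidence graph of `F` that survives `τ`. -/
theorem exists_partialDecomposition {t : ℕ} (h : F.reduce τ ∈ treewidthAtMost t) :
    Nonempty (PartialDecomposition F.inc (F.surviving τ) t) := by
  refine PartialDecomposition.exists_of_treewidth_le _ (reduceVertex τ) (reduceVertex_injective τ)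
    ?_ h
  have key : ∀ (x : {x : ℕ // x ∈ F.vars}) (j : Fin F.clauses.length)
      (hx : (Sum.inl x : F.IncVertex) ∈ F.surviving τ)
      (hj : (Sum.inr j : F.IncVertex) ∈ F.surviving τ), x.1 ∈ F.nbr (.inr j) →
      (F.reduce τ).inc.Adj (reduceVertex τ ⟨_, hx⟩) (reduceVertex τ ⟨_, hj⟩) := fun x j hx hj hxj =>
    adj_inl_inr (mem_nbr_reduceIndex τ hj hxj (inl_mem_surviving.1 hx).1)
  rintro ⟨u, hu⟩ ⟨v, hv⟩ huv
  obtain ⟨x, j, hxj, ⟨rfl, rfl⟩ | ⟨rfl, rfl⟩⟩ := inc_adj_iff.1 huv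
  · exact key x j hu hv hxj
  · exact (key x j hv hu hxj).symm

end Reduce

/-- In the case of width `0`, no edge may survive any assignment, so a strong backdoor set consists of
all variables: falsify the literals of a clause containing the variable. -/
theorem vars_subset_of_isStrongBackdoor_zero {B : Finset ℕ}
    (hB : IsStrongBackdoor (treewidthAtMost 0) F B) : F.vars ⊆ B := by
  intro x hx
  by_contra hxB
  have hx' := hx
  simp only [vars, List.mem_toFinset, List.mem_map, List.mem_flatten] at hx'
  obtain ⟨⟨_, s⟩, ⟨c, hc, hl⟩, rfl⟩ := hx'
  obtain ⟨j, hj, rfl⟩ := List.mem_iff_getElem.1 hc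
  let j' : Fin F.clauses.length := ⟨j, hj⟩
  have hxj := (mem_nbr_inr (j := j')).2 ⟨s, hl⟩
  obtain ⟨D⟩ := exists_partialDecomposition _ (hB.2 (F.falsify B j'))
  have hjs := inr_mem_surviving_falsify B j'
  obtain ⟨i, h1, h2⟩ := D.edge_mem _ (inl_mem_surviving.2 ⟨hxB, j', hjs, hxj⟩) _ hjs
    (adj_inl_inr (x := ⟨_, hx⟩) hxj)
  have := Finset.one_lt_card.2 ⟨_, h1, _, h2, by simp⟩
  have := D.card_bag_le i
  omega

end CNF

/-! ### The pieces of a topological wall -/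

/-- The names of the pieces of an `r`-wall: `(i, j, true)` stands for the edge from `(i, j)` to
`(i + 1, j)`, and `(i, j, false)` for the edge from `(i, j)` to `(i, j + 1)`. -/
abbrev WallLabel (r : ℕ) : Type := Fin r × Fin r × Bool

/-- The names of the pieces in the order in which the input lists the pieces. -/
def wallLabels (r : ℕ) : List (WallLabel r) :=
  (List.finRange r).flatMap fun i => (List.finRange r).flatMap fun j => [(i, j, true), (i, j, false)]

theorem mem_wallLabels {r : ℕ} (e : WallLabel r) : e ∈ wallLabels r := by
  obtain ⟨i, j, d⟩ := e
  simp only [wallLabels, List.mem_flatMap, List.mem_finRange, true_and]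
  exact ⟨i, j, by cases d <;> simp⟩

theorem nodup_wallLabels (r : ℕ) : (wallLabels r).Nodup := by
  refine List.nodup_flatMap.2 ⟨fun i _ => List.nodup_flatMap.2 ⟨fun j _ => by simp, ?_⟩, ?_⟩
  · refine (List.nodup_finRange r).imp ?_
    intro a b hab x hx hx'
    simp only [List.mem_cons, List.not_mem_nil, or_false] at hx hx'
    rcases hx with rfl | rfl <;> rcases hx' with h | h <;> simp_all
  · refine (List.nodup_finRange r).imp ?_
    intro a b hab x hx hx'
    simp only [List.mem_flatMap, List.mem_cons, List.not_mem_nil, or_false, List.mem_finRange,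
      true_and] at hx hx'
    obtain ⟨j, rfl | rfl⟩ := hx <;> obtain ⟨j', h | h⟩ := hx' <;> simp_all

theorem length_wallLabels (r : ℕ) : (wallLabels r).length = 2 * (r * r) := by
  classical
  have h : (wallLabels r).toFinset = Finset.univ := by
    ext e
    simp [mem_wallLabels]
  rw [← List.toFinset_card_of_nodup (nodup_wallLabels r), h]
  simp only [Finset.card_univ, Fintype.card_prod, Fintype.card_fin, Fintype.card_bool]
  ring

section Pieces

variable {r : ℕ} {W : Type} {G : SimpleGraph W} (M : TopologicalModel (wall r) G)

/-- The vertices of the piece with the given name (none if the wall lacks this edge). -/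
noncomputable def piece (e : WallLabel r) : List W :=
  match e.2.2 with
  | true => if h : e.1.val + 1 < r then M.pathList (e.1, e.2.1) (⟨e.1.val + 1, h⟩, e.2.1) else []
  | false => if h : e.2.1.val + 1 < r then M.pathList (e.1, e.2.1) (e.1, ⟨e.2.1.val + 1, h⟩) else []

theorem wallPaths_eq_map_piece : wallPaths M = (wallLabels r).map (piece M) := by
  simp only [wallPaths, wallLabels, List.map_flatMap]
  rfl

/-- `u` and `v` are the lower and the upper end of the piece with the given name. -/
def IsEnds (e : WallLabel r) (u v : Fin r × Fin r) : Prop :=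
  u = (e.1, e.2.1) ∧ ((e.2.2 = true ∧ v.1.val = e.1.val + 1 ∧ v.2 = e.2.1) ∨
    (e.2.2 = false ∧ v.1 = e.1 ∧ v.2.val = e.2.1.val + 1))

variable {M}

theorem exists_piece_eq {e : WallLabel r} (h : piece M e ≠ []) :
    ∃ (u v : Fin r × Fin r) (hadj : (wall r).Adj u v), IsEnds e u v ∧
      piece M e = (M.path hadj).support := by
  obtain ⟨i, j, d⟩ := e
  cases d with
  | true =>
    simp only [piece, ne_eq, dite_eq_right_iff, not_forall] at h
    obtain ⟨hi, h⟩ := h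
    simp only [TopologicalModel.pathList, dite_eq_right_iff, not_forall] at h
    obtain ⟨hadj, -⟩ := h
    refine ⟨_, _, hadj, ⟨rfl, Or.inl ⟨rfl, rfl, rfl⟩⟩, ?_⟩
    simp [piece, hi, TopologicalModel.pathList, hadj]
  | false =>
    simp only [piece, ne_eq, dite_eq_right_iff, not_forall] at h
    obtain ⟨hi, h⟩ := h
    simp only [TopologicalModel.pathList, dite_eq_right_iff, not_forall] at h
    obtain ⟨hadj, -⟩ := h
    refine ⟨_, _, hadj, ⟨rfl, Or.inr ⟨rfl, rfl, rfl⟩⟩, ?_⟩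
    simp [piece, hi, TopologicalModel.pathList, hadj]

theorem IsEnds.label_eq {e e' : WallLabel r} {u v u' v' : Fin r × Fin r} (h : IsEnds e u v)
    (h' : IsEnds e' u' v') (hs : s(u, v) = s(u', v')) : e = e' := by
  obtain ⟨i, j, d⟩ := e
  obtain ⟨i', j', d'⟩ := e'
  obtain ⟨v1, v2⟩ := v
  obtain ⟨w1, w2⟩ := v'
  obtain ⟨rfl, h⟩ := h
  obtain ⟨rfl, h'⟩ := h'
  simp only [Sym2.eq_iff, Prod.mk.injEq] at hs h h'
  simp only [Prod.mk.injEq]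
  simp only [Fin.ext_iff] at *
  rcases h with ⟨rfl, h1, h2⟩ | ⟨rfl, h1, h2⟩ <;> rcases h' with ⟨rfl, h3, h4⟩ | ⟨rfl, h3, h4⟩ <;>
    simp only [and_true, reduceCtorEq, and_false] <;> omega

theorem nodup_piece (e : WallLabel r) : (piece M e).Nodup := by
  by_cases h : piece M e = []
  · simp [h]
  · obtain ⟨u, v, hadj, -, he⟩ := exists_piece_eq h
    rw [he]
    exact (M.isPath hadj).support_nodup

theorem isChain_piece (e : WallLabel r) : (piece M e).IsChain G.Adj := by
  by_cases h : piece M e = []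
  · simp [h]
  · obtain ⟨u, v, hadj, -, he⟩ := exists_piece_eq h
    rw [he]
    exact (M.path hadj).isChain_adj_support

theorem exists_adj_mem_support {V : Type*} {G : SimpleGraph V} {u v : V} (p : G.Walk u v)
    (huv : u ≠ v) {w : V} (hw : w ∈ p.support) : ∃ x ∈ p.support, G.Adj w x := by
  induction p with
  | nil => exact absurd rfl huv
  | @cons a b c hab q ih =>
    rw [SimpleGraph.Walk.support_cons, List.mem_cons] at hw
    rcases hw with rfl | hw
    · exact ⟨b, by simp, hab⟩
    · by_cases hbc : b = c
      · subst hbc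
        by_cases hwb : w = b
        · exact ⟨a, by simp, hwb ▸ hab.symm⟩
        · obtain ⟨n, hn, hn'⟩ := SimpleGraph.Walk.mem_support_iff_exists_getVert.1 hw
          rcases Nat.eq_zero_or_pos n with rfl | hpos
          · exact absurd (by simpa using hn.symm) hwb
          · refine ⟨q.getVert (n - 1), by simp [SimpleGraph.Walk.getVert_mem_support], ?_⟩
            have := q.adj_getVert_succ (i := n - 1) (by omega)
            rw [Nat.sub_add_cancel hpos, hn] at this
            exact this.symm
      · obtain ⟨x, hx, hwx⟩ := ih hbc hw
        exact ⟨x, by simp [hx], hwx⟩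

/-- No vertex is alone in a piece. -/
theorem exists_adj_mem_piece {e : WallLabel r} {w : W} (hw : w ∈ piece M e) :
    ∃ x ∈ piece M e, G.Adj w x := by
  obtain ⟨u, v, hadj, -, he⟩ := exists_piece_eq (List.ne_nil_of_mem hw)
  rw [he] at hw ⊢
  exact exists_adj_mem_support _ (M.branch_injective.ne hadj.ne) hw

/-- Different pieces share only branch vertices. -/
theorem exists_common_end {e e' : WallLabel r} (hne : e ≠ e') {w : W} (hw : w ∈ piece M e)
    (hw' : w ∈ piece M e') : ∃ z u v u' v', w = M.branch z ∧ IsEnds e u v ∧ IsEnds e' u' v' ∧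
      (z = u ∨ z = v) ∧ (z = u' ∨ z = v') := by
  obtain ⟨u, v, hadj, hends, he⟩ := exists_piece_eq (List.ne_nil_of_mem hw)
  obtain ⟨u', v', hadj', hends', he'⟩ := exists_piece_eq (List.ne_nil_of_mem hw')
  rw [he] at hw
  rw [he'] at hw'
  have hs : s(u, v) ≠ s(u', v') := fun h => hne (hends.label_eq hends' h)
  have h1 := M.independent hadj hadj' hs w hw hw'
  have h2 := M.independent hadj' hadj hs.symm w hw' hw
  rcases h1 with h1 | h1
  · refine ⟨u', u, v, u', v', h1, hends, hends', ?_, Or.inl rfl⟩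
    rcases h2 with h2 | h2
    · exact Or.inl (M.branch_injective (h1.symm.trans h2))
    · exact Or.inr (M.branch_injective (h1.symm.trans h2))
  · refine ⟨v', u, v, u', v', h1, hends, hends', ?_, Or.inr rfl⟩
    rcases h2 with h2 | h2
    · exact Or.inl (M.branch_injective (h1.symm.trans h2))
    · exact Or.inr (M.branch_injective (h1.symm.trans h2))

theorem subsingleton_piece_of_not_branch {w : W} (hw : w ∉ Set.range M.branch) {e e' : WallLabel r}
    (h : w ∈ piece M e) (h' : w ∈ piece M e') : e = e' := by
  by_contra hne
  obtain ⟨z, _, _, _, _, rfl, -⟩ := exists_common_end hne h h'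
  exact hw ⟨z, rfl⟩

/-- A vertex of the wall lies in at most four pieces. -/
theorem card_pieces_le (w : W) (s : Finset (WallLabel r)) (hs : ∀ e ∈ s, w ∈ piece M e) :
    s.card ≤ 4 := by
  classical
  by_cases hcard : s.card ≤ 1
  · omega
  obtain ⟨e₁, he₁, e₂, he₂, hne⟩ := Finset.one_lt_card.1 (not_le.1 hcard)
  obtain ⟨z, _, _, _, _, rfl, -⟩ := exists_common_end hne (hs _ he₁) (hs _ he₂)
  have hend : ∀ e ∈ s, ∃ u v, IsEnds e u v ∧ (z = u ∨ z = v) := by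
    intro e he
    obtain ⟨u, v, hadj, hends, hp⟩ := exists_piece_eq (List.ne_nil_of_mem (hs e he))
    exact ⟨u, v, hends, M.branch_mem hadj z (hp ▸ hs e he)⟩
  let f : WallLabel r → ℕ × ℕ × Bool := fun e => (e.1, e.2.1, e.2.2)
  have hf : Function.Injective f := by
    rintro ⟨i, j, d⟩ ⟨i', j', d'⟩ h
    simp only [f, Prod.mk.injEq] at h
    simp only [Prod.mk.injEq, Fin.ext_iff]
    exact h
  let s' : Finset (ℕ × ℕ × Bool) :=
    {(z.1.val, z.2.val, true), (z.1.val, z.2.val, false), (z.1.val - 1, z.2.val, true),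
      (z.1.val, z.2.val - 1, false)}
  have hsub : s.image f ⊆ s' := by
    intro x hx
    obtain ⟨⟨i, j, d⟩, he, rfl⟩ := Finset.mem_image.1 hx
    obtain ⟨u, v, ⟨hu, hv⟩, hz⟩ := hend _ he
    simp only [f, s', Finset.mem_insert, Finset.mem_singleton, Prod.mk.injEq]
    dsimp only at hu hv
    rcases hz with rfl | rfl
    · subst hu
      cases d <;> simp
    · simp only [Fin.ext_iff] at hv
      rcases hv with ⟨rfl, h1, h2⟩ | ⟨rfl, h1, h2⟩
      · right; right; left
        exact ⟨by omega, by omega, rfl⟩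
      · right; right; right
        exact ⟨by omega, by omega, rfl⟩
  rw [← Finset.card_image_of_injective s hf]
  exact (Finset.card_le_card hsub).trans Finset.card_le_four

theorem wall_adj_right {i j : Fin r} (h : i.val + 1 < r) :
    (wall r).Adj (i, j) (⟨i.val + 1, h⟩, j) := Or.inl ⟨rfl, Or.inr (by simp)⟩

theorem wall_adj_up {i j : Fin r} (h : j.val + 1 < r) (he : Even (i.val + j.val)) :
    (wall r).Adj (i, j) (i, ⟨j.val + 1, h⟩) := Or.inr ⟨rfl, by simp [he.neg_one_pow]⟩

variable (M)

theorem piece_right {i j : Fin r} (h : i.val + 1 < r) :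
    piece M (i, j, true) = (M.path (wall_adj_right (j := j) h)).support := by
  simp [piece, h, TopologicalModel.pathList, wall_adj_right]

theorem piece_up {i j : Fin r} (h : j.val + 1 < r) (he : Even (i.val + j.val)) :
    piece M (i, j, false) = (M.path (wall_adj_up h he)).support := by
  simp [piece, h, TopologicalModel.pathList, wall_adj_up h he]

end Pieces

/-! ### A wall of small treewidth is touched often -/

/-- A chain of connected sets, each of which meets the next one, has a connected union. -/
theorem PartialDecomposition.conn_iUnion_le {V : Type*} {G : SimpleGraph V} {U : Set V} {t : ℕ}
    (D : PartialDecomposition G U t) (S : ℕ → Set V) (n : ℕ) (hS : ∀ i ≤ n, D.Conn (S i))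
    (hi : ∀ i < n, ∃ v ∈ U, v ∈ S i ∧ v ∈ S (i + 1)) : D.Conn {v | ∃ i ≤ n, v ∈ S i} := by
  induction n with
  | zero => simpa using hS 0 le_rfl
  | succ n ih =>
    obtain ⟨v, hv, h1, h2⟩ := hi n n.lt_succ_self
    have := (ih (fun i h => hS i (by omega)) fun i h => hi i (by omega)).union (hS (n + 1) le_rfl)
      (D.nodes_inter_nonempty_of_mem hv (S := {v | ∃ i ≤ n, v ∈ S i}) ⟨n, le_rfl, h1⟩ h2)
    convert this using 1
    ext w
    constructor
    · rintro ⟨i, hi, hw⟩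
      rcases Nat.le_succ_iff.1 hi with h | rfl
      · exact Or.inl ⟨i, h, hw⟩
      · exact Or.inr hw
    · rintro (⟨i, hi, hw⟩ | hw)
      · exact ⟨i, by omega, hw⟩
      · exact ⟨n + 1, le_rfl, hw⟩

section Touched

variable {F : CNF} {r : ℕ} (M : TopologicalModel (wall r) F.inc) (B : Finset ℕ)

/-- The variable `x` occurs in a clause of the list `l`. -/
def Touches (F : CNF) (x : ℕ) (l : List F.IncVertex) : Prop := ∃ v ∈ l, x ∈ F.nbr v

open Classical in
/-- The pieces of the wall with a clause in which a variable of `B` occurs. -/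
noncomputable def touchedLabels : Finset (WallLabel r) :=
  Finset.univ.filter fun e => ∃ x ∈ B, Touches F x (piece M e)

variable {M B}

theorem mem_touchedLabels {e : WallLabel r} :
    e ∈ touchedLabels M B ↔ ∃ x ∈ B, Touches F x (piece M e) := by
  simp [touchedLabels]

/-- A connected stretch of the incidence graph without clauses over `B` survives every assignment
of `B`. -/
theorem CNF.mem_surviving_of_adj (τ : {x : ℕ // x ∈ B} → Bool) {l : List F.IncVertex}
    (hl : ∀ x ∈ B, ¬ Touches F x l) {v w : F.IncVertex} (hv : v ∈ l) (hw : w ∈ l)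
    (hvw : F.inc.Adj v w) : v ∈ F.surviving τ := by
  obtain ⟨x, j, hxj, ⟨rfl, rfl⟩ | ⟨rfl, rfl⟩⟩ := CNF.inc_adj_iff.1 hvw
  · exact CNF.inl_mem_surviving.2 ⟨fun hx => hl _ hx ⟨_, hw, hxj⟩, j,
      CNF.inr_mem_surviving_of_disjoint τ fun x hx hxB => hl x hxB ⟨_, hw, hx⟩, hxj⟩
  · exact CNF.inr_mem_surviving_of_disjoint τ fun x hx hxB => hl x hxB ⟨_, hv, hx⟩

theorem piece_subset_surviving (τ : {x : ℕ // x ∈ B} → Bool) {e : WallLabel r}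
    (he : e ∉ touchedLabels M B) {v : F.IncVertex} (hv : v ∈ piece M e) : v ∈ F.surviving τ := by
  rw [mem_touchedLabels] at he
  push Not at he
  obtain ⟨w, hw, hvw⟩ := exists_adj_mem_piece hv
  exact CNF.mem_surviving_of_adj τ he hv hw hvw

/-- If fewer than `r / 4` pieces were touched by a strong backdoor set, then the rows and the pairs of
consecutive columns without touched pieces would survive every assignment and form a grid of large
treewidth. -/
theorem le_card_touchedLabels {t : ℕ} (hB : CNF.IsStrongBackdoor (CNF.treewidthAtMost t) F B)
    (hr : 4 * t + 12 ≤ r) : r ≤ 4 * (touchedLabels M B).card := by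
  classical
  by_contra! hlt
  -- no clause of an untouched piece contains a variable of `B`, so any assignment will do
  let τ : {x : ℕ // x ∈ B} → Bool := fun _ => false
  obtain ⟨D⟩ := CNF.exists_partialDecomposition τ (hB.2 τ)
  set E := touchedLabels M B with hE
  let s : Finset ℕ := Finset.range (r - 1) \ E.image fun e => e.2.1.val
  let s' : Finset ℕ := Finset.range (r / 2) \ E.image fun e => e.1.val / 2
  have hs : t + 2 ≤ s.card := by
    have h1 := Finset.le_card_sdiff (E.image fun e => e.2.1.val) (Finset.range (r - 1))
    have h2 : (E.image fun e => e.2.1.val).card ≤ E.card := Finset.card_image_le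
    rw [Finset.card_range] at h1
    change t + 2 ≤ (Finset.range (r - 1) \ E.image fun e => e.2.1.val).card
    omega
  have hs' : t + 2 ≤ s'.card := by
    have h1 := Finset.le_card_sdiff (E.image fun e => e.1.val / 2) (Finset.range (r / 2))
    have h2 : (E.image fun e => e.1.val / 2).card ≤ E.card := Finset.card_image_le
    rw [Finset.card_range] at h1
    change t + 2 ≤ (Finset.range (r / 2) \ E.image fun e => e.1.val / 2).card
    omega
  have hrow : ∀ j ∈ s, j + 1 < r ∧ ∀ e : WallLabel r, e.2.1.val = j → e ∉ E := by
    intro j hj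
    simp only [s, Finset.mem_sdiff, Finset.mem_range, Finset.mem_image, not_exists, not_and] at hj
    exact ⟨by omega, fun e he heE => hj.2 e heE he⟩
  have hcol : ∀ a ∈ s', 2 * a + 1 < r ∧ ∀ e : WallLabel r, e.1.val / 2 = a → e ∉ E := by
    intro a ha
    simp only [s', Finset.mem_sdiff, Finset.mem_range, Finset.mem_image, not_exists, not_and] at ha
    exact ⟨by omega, fun e he heE => ha.2 e heE he⟩
  have hpiece : ∀ e ∉ E, piece M e ≠ [] → D.Conn {v | v ∈ piece M e} := fun e he hne =>
    D.conn_of_isChain hne (isChain_piece e) fun v hv => piece_subset_surviving τ he hv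
  -- the row at height `j`, up to its part with first coordinates `i` and `i + 1`
  let R : ℕ → ℕ → Set F.IncVertex := fun j i =>
    {v | ∃ (hi : i < r) (hj : j < r), v ∈ piece M (⟨i, hi⟩, ⟨j, hj⟩, true)}
  -- the zigzag in the columns `2 a` and `2 a + 1`: the horizontal edge at height `j` and the
  -- vertical edge leaving this height
  let K : ℕ → ℕ → Set F.IncVertex := fun a j =>
    {v | ∃ (hi : 2 * a + j % 2 < r) (hj : j < r), v ∈ piece M (⟨2 * a + j % 2, hi⟩, ⟨j, hj⟩, false)} ∪
    {v | ∃ (hi : 2 * a < r) (hj : j < r), v ∈ piece M (⟨2 * a, hi⟩, ⟨j, hj⟩, true)}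
  refine D.false_of_grid s s' hs hs' (fun j => {v | ∃ i ≤ r - 2, v ∈ R j i})
    (fun a => {v | ∃ j ≤ r - 2, v ∈ K a j}) ?_ ?_ ?_ ?_ ?_
  · intro j hj
    obtain ⟨hjr, hrow⟩ := hrow j hj
    have hmem : ∀ i, (hi : i + 1 < r) → M.branch (⟨i, by omega⟩, ⟨j, by omega⟩) ∈ R j i ∧
        M.branch (⟨i + 1, hi⟩, ⟨j, by omega⟩) ∈ R j i := fun i hi => by
      constructor <;> refine ⟨by omega, by omega, ?_⟩ <;> rw [piece_right M hi] <;> simp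
    refine D.conn_iUnion_le (R j) (r - 2) ?_ ?_
    · intro i hi
      have hset : R j i = {v | v ∈ piece M (⟨i, by omega⟩, ⟨j, by omega⟩, true)} := by
        ext v
        exact ⟨fun ⟨_, _, h⟩ => h, fun h => ⟨by omega, by omega, h⟩⟩
      rw [hset]
      exact hpiece _ (hrow _ rfl) (List.ne_nil_of_mem (hset ▸ (hmem i (by omega)).1))
    · intro i hi
      have h1 := (hmem i (by omega)).2
      refine ⟨_, ?_, h1, (hmem (i + 1) (by omega)).1⟩
      obtain ⟨_, _, h1⟩ := h1
      exact piece_subset_surviving τ (hrow _ rfl) h1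
  · intro a ha
    obtain ⟨har, hcol⟩ := hcol a ha
    have hup : ∀ j, (hj : j + 1 < r) →
        piece M (⟨2 * a + j % 2, by omega⟩, ⟨j, by omega⟩, false) =
        (M.path (wall_adj_up (i := ⟨2 * a + j % 2, by omega⟩) (j := ⟨j, by omega⟩) hj
          (by rw [Nat.even_iff]; dsimp only; omega))).support := fun j hj =>
      piece_up M hj (by rw [Nat.even_iff]; dsimp only; omega)
    have hright : ∀ j, (hj : j < r) → piece M (⟨2 * a, by omega⟩, ⟨j, hj⟩, true) =
        (M.path (wall_adj_right (i := ⟨2 * a, by omega⟩) (j := ⟨j, hj⟩) har)).support :=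
      fun j hj => piece_right M har
    have hmemR : ∀ j (hj : j < r) (i : ℕ) (hi : i < r), i / 2 = a →
        M.branch (⟨i, hi⟩, ⟨j, hj⟩) ∈ piece M (⟨2 * a, by omega⟩, ⟨j, hj⟩, true) := by
      intro j hj i hi hia
      rw [hright j hj]
      obtain rfl | rfl : i = 2 * a ∨ i = 2 * a + 1 := by omega
      · simp
      · exact SimpleGraph.Walk.end_mem_support _
    refine D.conn_iUnion_le (K a) (r - 2) ?_ ?_
    · intro j hj
      have hset : K a j = {v | v ∈ piece M (⟨2 * a + j % 2, by omega⟩, ⟨j, by omega⟩, false)} ∪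
          {v | v ∈ piece M (⟨2 * a, by omega⟩, ⟨j, by omega⟩, true)} := by
        ext v
        constructor
        · rintro (⟨_, _, h⟩ | ⟨_, _, h⟩)
          · exact Or.inl h
          · exact Or.inr h
        · rintro (h | h)
          · exact Or.inl ⟨by omega, by omega, h⟩
          · exact Or.inr ⟨by omega, by omega, h⟩
      have hb : M.branch (⟨2 * a + j % 2, by omega⟩, ⟨j, by omega⟩) ∈
          piece M (⟨2 * a + j % 2, by omega⟩, ⟨j, by omega⟩, false) := by
        rw [hup j (by omega)]
        exact SimpleGraph.Walk.start_mem_support _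
      have hb' := hmemR j (by omega) (2 * a + j % 2) (by omega) (by omega)
      have hno := hcol (⟨2 * a + j % 2, by omega⟩, ⟨j, by omega⟩, false) (by dsimp only; omega)
      rw [hset]
      exact (hpiece _ hno (List.ne_nil_of_mem hb)).union
        (hpiece _ (hcol _ (by dsimp only; omega)) (List.ne_nil_of_mem hb'))
        (D.nodes_inter_nonempty_of_mem (piece_subset_surviving τ hno hb) hb hb')
    · intro j hj
      have hb : M.branch (⟨2 * a + j % 2, by omega⟩, ⟨j + 1, by omega⟩) ∈
          piece M (⟨2 * a + j % 2, by omega⟩, ⟨j, by omega⟩, false) := by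
        rw [hup j (by omega)]
        exact SimpleGraph.Walk.end_mem_support _
      exact ⟨_, piece_subset_surviving τ (hcol _ (by dsimp only; omega)) hb,
        Or.inl ⟨by omega, by omega, hb⟩, Or.inr ⟨by omega, by omega,
          hmemR (j + 1) (by omega) (2 * a + j % 2) (by omega) (by omega)⟩⟩
  · rintro j hj j' hj' v ⟨i, hi, hir, hjr, hv⟩ ⟨i', hi', hir', hjr', hv'⟩
    by_contra hne
    obtain ⟨z, u, w, u', w', -, ⟨rfl, h⟩, ⟨rfl, h'⟩, hz, hz'⟩ := exists_common_end (by
      simp only [ne_eq, Prod.mk.injEq, Fin.mk.injEq]; tauto) hv hv'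
    simp only [Fin.ext_iff] at h h'
    have h1 : z.2.val = j := by
      rcases hz with rfl | rfl
      · rfl
      · simp at h; exact h.2
    have h2 : z.2.val = j' := by
      rcases hz' with rfl | rfl
      · rfl
      · simp at h'; exact h'.2
    omega
  · rintro a ha b hb v ⟨i, hi, hv⟩ ⟨i', hi', hv'⟩
    by_contra hne
    have hK : ∀ a i, v ∈ K a i → ∃ e : WallLabel r, v ∈ piece M e ∧ ∀ u w, IsEnds e u w →
        u.1.val / 2 = a ∧ w.1.val / 2 = a := by
      rintro a i (⟨h1, h2, hv⟩ | ⟨h1, h2, hv⟩)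
      · refine ⟨_, hv, ?_⟩
        rintro u w ⟨rfl, h⟩
        simp only [Fin.ext_iff] at h
        simp at h
        dsimp only
        omega
      · refine ⟨_, hv, ?_⟩
        rintro u w ⟨rfl, h⟩
        simp only [Fin.ext_iff] at h
        simp at h
        dsimp only
        omega
    obtain ⟨e, he, hae⟩ := hK a i hv
    obtain ⟨e', he', hbe⟩ := hK b i' hv'
    by_cases hee : e = e'
    · subst hee
      obtain ⟨u, w, -, hends, -⟩ := exists_piece_eq (List.ne_nil_of_mem he)
      have := hae u w hends
      have := hbe u w hends
      omega
    · obtain ⟨z, u, w, u', w', -, h, h', hz, hz'⟩ := exists_common_end hee he he'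
      have h1 := hae u w h
      have h2 := hbe u' w' h'
      rcases hz with rfl | rfl <;> rcases hz' with rfl | rfl <;> omega
  · intro j hj a ha
    obtain ⟨hjr, hrow⟩ := hrow j hj
    obtain ⟨har, hcol⟩ := hcol a ha
    have hb : M.branch (⟨2 * a, by omega⟩, ⟨j, by omega⟩) ∈
        piece M (⟨2 * a, by omega⟩, ⟨j, by omega⟩, true) := by
      rw [piece_right M har]
      simp
    exact ⟨_, piece_subset_surviving τ (hrow _ rfl) hb, ⟨2 * a, by omega, by omega, by omega, hb⟩,
      ⟨j, by omega, Or.inr ⟨by omega, by omega, hb⟩⟩⟩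

end Touched

/-! ### Greedy segmentation of a list -/

section Chunks

variable {V : Type*} (P : List V → Prop) [DecidablePred P]

/-- One step of the greedy segmentation: the current segment is closed as soon as it satisfies `P`. -/
def chunkStep (s : List (List V) × List V) (v : V) : List (List V) × List V :=
  if P (s.2 ++ [v]) then (s.1 ++ [s.2 ++ [v]], []) else (s.1, s.2 ++ [v])

/-- The greedy segmentation of a list: the closed segments, and the remaining end of the list. -/
def chunks (l : List V) : List (List V) × List V := l.foldl (chunkStep P) ([], [])

theorem chunks_concat (l : List V) (v : V) : chunks P (l ++ [v]) = chunkStep P (chunks P l) v := by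
  simp [chunks]

theorem chunks_flatten (l : List V) : (chunks P l).1.flatten ++ (chunks P l).2 = l := by
  induction l using List.reverseRecOn with
  | nil => simp [chunks]
  | append_singleton l v ih =>
    rw [chunks_concat, chunkStep]
    split_ifs
    · simp only [List.flatten_append, List.flatten_cons, List.flatten_nil, List.append_nil]
      rw [← List.append_assoc, ih]
    · simp only [← List.append_assoc, ih]

theorem chunks_spec (l : List V) {c : List V} (hc : c ∈ (chunks P l).1) :
    P c ∧ ∃ d v, c = d ++ [v] ∧ (d = [] ∨ ¬ P d) := by
  suffices h : (∀ c ∈ (chunks P l).1, P c ∧ ∃ d v, c = d ++ [v] ∧ (d = [] ∨ ¬ P d)) ∧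
      ((chunks P l).2 = [] ∨ ¬ P (chunks P l).2) from h.1 c hc
  clear hc
  induction l using List.reverseRecOn with
  | nil => simp [chunks]
  | append_singleton l v ih =>
    rw [chunks_concat, chunkStep]
    split_ifs with h
    · refine ⟨fun c hc => ?_, Or.inl rfl⟩
      rcases List.mem_append.1 hc with hc | hc
      · exact ih.1 c hc
      · obtain rfl : c = _ := by simpa using hc
        exact ⟨h, _, v, rfl, ih.2⟩
    · exact ⟨ih.1, Or.inr h⟩

theorem chunks_rest (l : List V) : (chunks P l).2 = [] ∨ ¬ P (chunks P l).2 := by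
  induction l using List.reverseRecOn with
  | nil => simp [chunks]
  | append_singleton l v ih =>
    rw [chunks_concat, chunkStep]
    split_ifs with h
    · exact Or.inl rfl
    · exact Or.inr h

variable {P}

theorem mem_of_mem_chunks {l c : List V} (hc : c ∈ (chunks P l).1) {v : V} (hv : v ∈ c) : v ∈ l := by
  rw [← chunks_flatten P l]
  exact List.mem_append_left _ (List.mem_flatten.2 ⟨c, hc, hv⟩)

theorem isChain_of_mem_chunks {R : V → V → Prop} {l c : List V} (hl : l.IsChain R)
    (hc : c ∈ (chunks P l).1) : c.IsChain R := by
  refine hl.infix ?_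
  obtain ⟨l₁, l₂, h⟩ := List.append_of_mem hc
  refine ⟨l₁.flatten, l₂.flatten ++ (chunks P l).2, ?_⟩
  conv_rhs => rw [← chunks_flatten P l, h]
  simp

theorem eq_of_mem_chunks {l c c' : List V} (hl : l.Nodup) (hc : c ∈ (chunks P l).1)
    (hc' : c' ∈ (chunks P l).1) {v : V} (hv : v ∈ c) (hv' : v ∈ c') : c = c' := by
  rw [← chunks_flatten P l, List.nodup_append', List.nodup_flatten] at hl
  by_contra hne
  have : Std.Symm (List.Disjoint (α := V)) := ⟨fun _ _ h => h.symm⟩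
  exact hl.1.2.forall hc hc' hne hv hv'

theorem nodup_chunks {l : List V} (hl : l.Nodup) : (chunks P l).1.Nodup := by
  have hl' := hl
  rw [← chunks_flatten P l, List.nodup_append', List.nodup_flatten] at hl'
  refine List.Pairwise.imp_of_mem ?_ hl'.1.2
  rintro a b ha - hab rfl
  obtain ⟨-, d, v, rfl, -⟩ := chunks_spec P l ha
  exact hab (a := v) (by simp) (by simp)

end Chunks

/-! ### Clauses with many neighbours -/

section Counting

open Classical

variable {F : CNF}

/-- The variables of `Z` occurring in the clauses of a list of vertices. -/
noncomputable def zNbr (F : CNF) (Z : Finset ℕ) (l : List F.IncVertex) : Finset ℕ :=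
  Z.filter fun x => Touches F x l

theorem mem_zNbr {Z : Finset ℕ} {l : List F.IncVertex} {x : ℕ} :
    x ∈ zNbr F Z l ↔ x ∈ Z ∧ Touches F x l := by simp [zNbr]

theorem touches_append {x : ℕ} {l l' : List F.IncVertex} :
    Touches F x (l ++ l') ↔ Touches F x l ∨ Touches F x l' := by
  simp only [Touches, List.mem_append]
  constructor
  · rintro ⟨v, h | h, hv⟩
    exacts [Or.inl ⟨v, h, hv⟩, Or.inr ⟨v, h, hv⟩]
  · rintro (⟨v, h, hv⟩ | ⟨v, h, hv⟩)
    exacts [⟨v, Or.inl h, hv⟩, ⟨v, Or.inr h, hv⟩]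

theorem touches_singleton {x : ℕ} {v : F.IncVertex} : Touches F x [v] ↔ x ∈ F.nbr v := by
  simp [Touches]

theorem not_touches_nil {x : ℕ} : ¬ Touches F x [] := by simp [Touches]

theorem zNbr_append (Z : Finset ℕ) (l l' : List F.IncVertex) :
    zNbr F Z (l ++ l') = zNbr F Z l ∪ zNbr F Z l' := by
  ext x
  simp only [mem_zNbr, touches_append, Finset.mem_union]
  tauto

theorem zNbr_nil (Z : Finset ℕ) : zNbr F Z [] = ∅ := by
  ext x
  simp [mem_zNbr, not_touches_nil]

theorem zNbr_singleton_inl (Z : Finset ℕ) (y : {x : ℕ // x ∈ F.vars}) :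
    zNbr F Z [.inl y] = ∅ := by
  ext x
  simp [mem_zNbr, touches_singleton, CNF.nbr]

variable {B : Finset ℕ} {k t : ℕ}

/-- The clauses with many neighbours in `Z` have altogether few of them: every clause survives an
assignment of `B`, and for each of the few assignments the surviving clauses and `Z` span a sparse
graph. -/
theorem sum_card_zNbr_le (hB : CNF.IsStrongBackdoor (CNF.treewidthAtMost t) F B) (hk : B.card ≤ k)
    (Z : Finset ℕ) (C : Finset (Fin F.clauses.length))
    (hC : ∀ j ∈ C, 2 * t + 2 * k ≤ (zNbr F Z [.inr j]).card) :
    ∑ j ∈ C, (zNbr F Z [.inr j]).card ≤ 2 ^ (k + 2) * t * Z.card := by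
  have key : ∀ τ : {x : ℕ // x ∈ B} → Bool,
      ∑ j ∈ C.filter (fun j => (Sum.inr j : F.IncVertex) ∈ F.surviving τ),
        (zNbr F Z [.inr j]).card ≤ 4 * t * Z.card := by
    intro τ
    obtain ⟨D⟩ := CNF.exists_partialDecomposition τ (hB.2 τ)
    set s := C.filter (fun j => (Sum.inr j : F.IncVertex) ∈ F.surviving τ) with hs
    have hsC : ∀ j ∈ s, j ∈ C ∧ (Sum.inr j : F.IncVertex) ∈ F.surviving τ := fun j hj =>
      Finset.mem_filter.1 hj
    let s' : Finset {x : ℕ // x ∈ F.vars} := Finset.univ.filter fun x =>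
      x.1 ∈ Z ∧ (Sum.inl x : F.IncVertex) ∈ F.surviving τ
    let E : Finset (Fin F.clauses.length × {x : ℕ // x ∈ F.vars}) :=
      (s ×ˢ s').filter fun e => e.2.1 ∈ F.nbr (.inr e.1)
    have hE := D.card_minor_edges_le s s' (fun j => {.inr j}) (fun x => {.inl x})
      (fun j hj => D.conn_singleton (hsC j hj).2)
      (fun x hx => D.conn_singleton (Finset.mem_filter.1 hx).2.2)
      (by rintro a - b - v rfl h; simpa using h) (by rintro a - b - v rfl h; simpa using h)
      (by rintro a - b - v rfl h; simp at h) E (by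
        rintro ⟨j, x⟩ he
        obtain ⟨h1, h2⟩ := Finset.mem_filter.1 he
        obtain ⟨hj, hx⟩ := Finset.mem_product.1 h1
        exact ⟨hj, hx, _, rfl, _, rfl, (hsC j hj).2, (Finset.mem_filter.1 hx).2.2,
          (CNF.adj_inl_inr h2).symm⟩)
    have hs' : s'.card ≤ Z.card :=
      Finset.card_le_card_of_injOn Subtype.val (fun x hx => (Finset.mem_filter.1 hx).2.1)
        Subtype.val_injective.injOn
    have hEcard : ∑ j ∈ s, ((zNbr F Z [.inr j]).card - k) ≤ E.card := by
      have hmap : ∀ e ∈ E, e.1 ∈ s := fun e he =>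
        (Finset.mem_product.1 (Finset.mem_filter.1 he).1).1
      rw [Finset.card_eq_sum_card_fiberwise hmap]
      refine Finset.sum_le_sum fun j hj => ?_
      have h1 : (zNbr F Z [.inr j]).card - k ≤ (zNbr F Z [.inr j] \ B).card :=
        (Nat.sub_le_sub_left hk _).trans (Finset.le_card_sdiff B _)
      refine h1.trans (Finset.card_le_card_of_surjOn (fun e => e.2.1) ?_)
      intro x hx
      obtain ⟨hx, hxB⟩ := Finset.mem_sdiff.1 hx
      obtain ⟨hxZ, hxj⟩ := mem_zNbr.1 hx
      rw [touches_singleton] at hxj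
      have hxs : (Sum.inl ⟨x, CNF.nbr_subset_vars _ hxj⟩ : F.IncVertex) ∈ F.surviving τ :=
        CNF.inl_mem_surviving.2 ⟨hxB, j, (hsC j hj).2, hxj⟩
      refine ⟨(j, ⟨x, CNF.nbr_subset_vars _ hxj⟩), ?_, rfl⟩
      simp only [E, s', Finset.coe_filter, Finset.mem_filter, Finset.mem_product, Finset.mem_univ,
        true_and, Set.mem_ofPred_eq]
      exact ⟨⟨⟨hj, hxZ, hxs⟩, hxj⟩, trivial⟩
    have h2t : s.card * (2 * t) ≤ ∑ j ∈ s, ((zNbr F Z [.inr j]).card - k) := by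
      rw [← smul_eq_mul]
      refine Finset.card_nsmul_le_sum _ _ _ fun j hj => ?_
      have := hC j (hsC j hj).1
      omega
    have h2w : ∑ j ∈ s, (zNbr F Z [.inr j]).card ≤ 2 * ∑ j ∈ s, ((zNbr F Z [.inr j]).card - k) := by
      rw [Finset.mul_sum]
      refine Finset.sum_le_sum fun j hj => ?_
      have := hC j (hsC j hj).1
      omega
    have : t * s'.card ≤ t * Z.card := Nat.mul_le_mul_left _ hs'
    nlinarith
  calc ∑ j ∈ C, (zNbr F Z [.inr j]).card
      ≤ ∑ j ∈ C, ∑ τ : {x : ℕ // x ∈ B} → Bool,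
          if (Sum.inr j : F.IncVertex) ∈ F.surviving τ then (zNbr F Z [.inr j]).card else 0 := by
        refine Finset.sum_le_sum fun j _ => ?_
        have := Finset.single_le_sum (f := fun τ : {x : ℕ // x ∈ B} → Bool =>
          if (Sum.inr j : F.IncVertex) ∈ F.surviving τ then (zNbr F Z [.inr j]).card else 0)
          (fun _ _ => Nat.zero_le _) (Finset.mem_univ (F.falsify B j))
        simpa [CNF.inr_mem_surviving_falsify] using this
    _ = ∑ τ : {x : ℕ // x ∈ B} → Bool,
          ∑ j ∈ C.filter (fun j => (Sum.inr j : F.IncVertex) ∈ F.surviving τ),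
            (zNbr F Z [.inr j]).card := by
        rw [Finset.sum_comm]
        simp_rw [Finset.sum_filter]
    _ ≤ ∑ _τ : {x : ℕ // x ∈ B} → Bool, 4 * t * Z.card := Finset.sum_le_sum fun τ _ => key τ
    _ = 2 ^ B.card * (4 * t * Z.card) := by simp
    _ ≤ 2 ^ k * (4 * t * Z.card) := Nat.mul_le_mul_right _ (Nat.pow_le_pow_right (by norm_num) hk)
    _ = 2 ^ (k + 2) * t * Z.card := by ring

end Counting

/-! ### Counting segments -/

section Segments

open Classical

variable {F : CNF} {r : ℕ} (M : TopologicalModel (wall r) F.inc) (Z : Finset ℕ) (ν : ℕ)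

/-- The greedy segmentation of a piece into segments with at least `ν` neighbours in `Z`. -/
noncomputable def segs (e : WallLabel r) : List (List F.IncVertex) :=
  (chunks (fun c => ν ≤ (zNbr F Z c).card) (piece M e)).1

/-- The segments with the property `p` of the pieces in `Q`. -/
noncomputable def segSet (Q : Finset (WallLabel r)) (p : List F.IncVertex → Prop) :
    Finset (Σ _ : WallLabel r, List F.IncVertex) :=
  Q.sigma fun e => (segs M Z ν e).toFinset.filter p

variable {M Z ν} {Q : Finset (WallLabel r)} {p : List F.IncVertex → Prop}

theorem mem_segSet {a : Σ _ : WallLabel r, List F.IncVertex} :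
    a ∈ segSet M Z ν Q p ↔ a.1 ∈ Q ∧ a.2 ∈ segs M Z ν a.1 ∧ p a.2 := by
  simp [segSet]

theorem card_segSet : (segSet M Z ν Q p).card = ∑ e ∈ Q, (segs M Z ν e).countP fun c => p c := by
  rw [segSet, Finset.card_sigma]
  refine Finset.sum_congr rfl fun e _ => ?_
  have hn : (segs M Z ν e).Nodup := nodup_chunks (nodup_piece e)
  rw [List.countP_eq_length_filter, ← List.toFinset_card_of_nodup (hn.filter _), List.toFinset_filter]
  simp

theorem mem_piece_of_mem_segs {e : WallLabel r} {c : List F.IncVertex} (hc : c ∈ segs M Z ν e)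
    {v : F.IncVertex} (hv : v ∈ c) : v ∈ piece M e := mem_of_mem_chunks hc hv

theorem eq_of_mem_segs {e : WallLabel r} {c c' : List F.IncVertex} (hc : c ∈ segs M Z ν e)
    (hc' : c' ∈ segs M Z ν e) {v : F.IncVertex} (hv : v ∈ c) (hv' : v ∈ c') : c = c' :=
  eq_of_mem_chunks (nodup_piece e) hc hc' hv hv'

/-- A segment ends with a clause, and without this clause it would have fewer than `ν` neighbours. -/
theorem exists_eq_concat (hν : 0 < ν) {e : WallLabel r} {c : List F.IncVertex}
    (hc : c ∈ segs M Z ν e) : ν ≤ (zNbr F Z c).card ∧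
      ∃ d j, c = d ++ [.inr j] ∧ (zNbr F Z d).card < ν := by
  obtain ⟨h1, d, v, rfl, hd⟩ := chunks_spec _ _ hc
  have hd' : (zNbr F Z d).card < ν := by
    rcases hd with rfl | hd
    · simpa [zNbr_nil] using hν
    · exact not_le.1 hd
  refine ⟨h1, d, ?_⟩
  cases v with
  | inl x =>
    rw [zNbr_append, zNbr_singleton_inl, Finset.union_empty] at h1
    omega
  | inr j => exact ⟨j, rfl, hd'⟩

/-- A vertex lies in at most four segments, and in at most one if it is not a branch vertex. -/
theorem card_segs_through_le {v : F.IncVertex} {s : Finset (Σ _ : WallLabel r, List F.IncVertex)}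
    (hs : ∀ a ∈ s, a ∈ segSet M Z ν Q p ∧ v ∈ a.2) :
    s.card ≤ 4 ∧ (v ∉ Set.range M.branch → s.card ≤ 1) := by
  have hinj : Set.InjOn Sigma.fst (s : Set (Σ _ : WallLabel r, List F.IncVertex)) := by
    rintro ⟨e, c⟩ ha ⟨e', c'⟩ hb hab
    obtain rfl : e = e' := hab
    obtain ⟨h1, h2⟩ := hs _ ha
    obtain ⟨h3, h4⟩ := hs _ hb
    obtain rfl := eq_of_mem_segs (mem_segSet.1 h1).2.1 (mem_segSet.1 h3).2.1 h2 h4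
    rfl
  have hmem : ∀ e ∈ s.image Sigma.fst, v ∈ piece M e := by
    intro e he
    obtain ⟨a, ha, rfl⟩ := Finset.mem_image.1 he
    exact mem_piece_of_mem_segs (mem_segSet.1 (hs a ha).1).2.1 (hs a ha).2
  rw [← Finset.card_image_of_injOn hinj]
  refine ⟨card_pieces_le v _ hmem, fun hv => ?_⟩
  rw [Finset.card_le_one]
  exact fun e he e' he' => subsingleton_piece_of_not_branch hv (hmem e he) (hmem e' he')

/-- The number of pieces in `Q` touched by a variable. -/
noncomputable def touchCount (M : TopologicalModel (wall r) F.inc) (Q : Finset (WallLabel r))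
    (x : ℕ) : ℕ := (Q.filter fun e => Touches F x (piece M e)).card

theorem sum_touchCount : ∑ x ∈ Z, touchCount M Q x = ∑ e ∈ Q, (zNbr F Z (piece M e)).card := by
  simp only [touchCount, zNbr, Finset.card_filter]
  exact Finset.sum_comm

theorem card_zNbr_flatten_le (L : List (List F.IncVertex)) :
    (zNbr F Z L.flatten).card ≤ (L.map fun c => (zNbr F Z c).card).sum := by
  induction L with
  | nil => simp [zNbr_nil]
  | cons c L ih =>
    rw [List.flatten_cons, zNbr_append, List.map_cons, List.sum_cons]
    exact (Finset.card_union_le _ _).trans (by omega)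

/-- The incidences between `Z` and the pieces in `Q` are distributed among small segments, unfinished
segments, and clauses with many neighbours. -/
theorem sum_touchCount_le {D : ℕ} (hν : 0 < ν) (hD : 2 * ν ≤ D) :
    ∑ x ∈ Z, touchCount M Q x ≤
      D * (segSet M Z ν Q fun c => (zNbr F Z c).card < D).card + ν * Q.card +
      8 * ∑ j ∈ Finset.univ.filter (fun j : Fin F.clauses.length =>
        D - ν ≤ (zNbr F Z [.inr j]).card), (zNbr F Z [.inr j]).card := by
  set C := Finset.univ.filter (fun j : Fin F.clauses.length => D - ν ≤ (zNbr F Z [.inr j]).card)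
    with hC
  have h1 : ∀ e ∈ Q, (zNbr F Z (piece M e)).card ≤
      ∑ c ∈ (segs M Z ν e).toFinset, (zNbr F Z c).card + ν := by
    intro e _
    have hn : (segs M Z ν e).Nodup := nodup_chunks (nodup_piece e)
    conv_lhs => rw [← chunks_flatten (fun c => ν ≤ (zNbr F Z c).card) (piece M e)]
    rw [zNbr_append, List.sum_toFinset _ hn]
    refine (Finset.card_union_le _ _).trans (Nat.add_le_add (card_zNbr_flatten_le _) ?_)
    rcases chunks_rest (fun c => ν ≤ (zNbr F Z c).card) (piece M e) with h | h
    · simp [h, zNbr_nil]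
    · omega
  have h2 : ∑ e ∈ Q, ∑ c ∈ (segs M Z ν e).toFinset, (zNbr F Z c).card =
      ∑ a ∈ segSet M Z ν Q (fun c => (zNbr F Z c).card < D), (zNbr F Z a.2).card +
      ∑ a ∈ segSet M Z ν Q (fun c => ¬ (zNbr F Z c).card < D), (zNbr F Z a.2).card := by
    simp only [segSet, Finset.sum_sigma, ← Finset.sum_add_distrib]
    refine Finset.sum_congr rfl fun e _ => ?_
    rw [← Finset.sum_filter_add_sum_filter_not (segs M Z ν e).toFinset
      fun c => (zNbr F Z c).card < D]
    congr!
  have h3 : ∑ a ∈ segSet M Z ν Q (fun c => (zNbr F Z c).card < D), (zNbr F Z a.2).card ≤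
      (segSet M Z ν Q fun c => (zNbr F Z c).card < D).card * D := by
    rw [← smul_eq_mul]
    exact Finset.sum_le_card_nsmul _ _ _ fun a ha => (mem_segSet.1 ha).2.2.le
  set S := segSet M Z ν Q (fun c => ¬ (zNbr F Z c).card < D) with hS
  -- a segment with at least `D ≥ 2 ν` neighbours owes at least half of them to its last clause, and a
  -- clause lies in at most four segments
  have h4 : ∑ a ∈ S, (zNbr F Z a.2).card ≤
      ∑ a ∈ S, ∑ j ∈ C, if Sum.inr j ∈ a.2 then 2 * (zNbr F Z [.inr j]).card else 0 := by
    refine Finset.sum_le_sum fun a ha => ?_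
    obtain ⟨-, hc, hD'⟩ := mem_segSet.1 ha
    obtain ⟨-, d, j, hcd, hd⟩ := exists_eq_concat hν hc
    have h5 : (zNbr F Z a.2).card ≤ (zNbr F Z d).card + (zNbr F Z [.inr j]).card := by
      rw [hcd, zNbr_append]
      exact Finset.card_union_le _ _
    have hj : j ∈ C := by
      simp only [hC, Finset.mem_filter, Finset.mem_univ, true_and]
      omega
    have h6 := Finset.single_le_sum (s := C)
      (f := fun j => if Sum.inr j ∈ a.2 then 2 * (zNbr F Z [.inr j]).card else 0)
      (fun _ _ => Nat.zero_le _) hj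
    have h7 : Sum.inr j ∈ a.2 := by rw [hcd]; simp
    simp only [h7, if_true] at h6
    omega
  have h5 : ∑ a ∈ S, ∑ j ∈ C, (if Sum.inr j ∈ a.2 then 2 * (zNbr F Z [.inr j]).card else 0) ≤
      8 * ∑ j ∈ C, (zNbr F Z [.inr j]).card := by
    rw [Finset.sum_comm, Finset.mul_sum]
    refine Finset.sum_le_sum fun j _ => ?_
    rw [← Finset.sum_filter, Finset.sum_const, smul_eq_mul]
    have := (card_segs_through_le (v := .inr j) (s := S.filter fun a => Sum.inr j ∈ a.2)
      fun a ha => Finset.mem_filter.1 ha).1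
    nlinarith
  calc ∑ x ∈ Z, touchCount M Q x = ∑ e ∈ Q, (zNbr F Z (piece M e)).card := sum_touchCount
    _ ≤ ∑ e ∈ Q, (∑ c ∈ (segs M Z ν e).toFinset, (zNbr F Z c).card + ν) := Finset.sum_le_sum h1
    _ = ∑ e ∈ Q, ∑ c ∈ (segs M Z ν e).toFinset, (zNbr F Z c).card + Q.card * ν := by
      rw [Finset.sum_add_distrib, Finset.sum_const, smul_eq_mul]
    _ ≤ _ := by rw [h2]; nlinarith

theorem exists_adj_of_isChain {V : Type*} {R : V → V → Prop} {d : List V} {v w : V}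
    (h : (d ++ [v]).IsChain R) (hw : w ∈ d) : ∃ x ∈ d ++ [v], R w x := by
  induction d with
  | nil => simp at hw
  | cons a d ih =>
    rcases List.mem_cons.1 hw with rfl | hw'
    · cases d with
      | nil => exact ⟨v, by simp, by simpa using h⟩
      | cons b d =>
        simp only [List.cons_append, List.isChain_cons_cons] at h
        exact ⟨b, by simp, h.1⟩
    · obtain ⟨x, hx, hwx⟩ := ih (by
        cases d with
        | nil => simp
        | cons b d =>
          simp only [List.cons_append, List.isChain_cons_cons] at h ⊢
          exact h.2) hw'
      exact ⟨x, List.mem_cons_of_mem _ hx, hwx⟩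

variable {B : Finset ℕ} {k t : ℕ}

/-- Segments that are untouched by a strong backdoor set, disjoint from each other and disjoint from
`Z` are few, as they span a sparse bipartite minor with `Z`. -/
theorem card_untouched_le (ht : 1 ≤ t) (hν : ν = 2 * t)
    (hB : CNF.IsStrongBackdoor (CNF.treewidthAtMost t) F B)
    (T : Finset (Σ _ : WallLabel r, List F.IncVertex)) (hT : T ⊆ segSet M Z ν Q p)
    (hTB : ∀ a ∈ T, ∀ x ∈ B, ¬ Touches F x a.2)
    (hTb : ∀ a ∈ T, ∀ v ∈ a.2, v ∉ Set.range M.branch)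
    (hTZ : ∀ a ∈ T, ∀ x : {x : ℕ // x ∈ F.vars}, .inl x ∈ a.2 → x.1 ∉ Z) : T.card ≤ Z.card := by
  let τ : {x : ℕ // x ∈ B} → Bool := fun _ => false
  obtain ⟨D⟩ := CNF.exists_partialDecomposition τ (hB.2 τ)
  have hν0 : 0 < ν := by omega
  have hseg : ∀ a ∈ T, a.2 ∈ segs M Z ν a.1 := fun a ha => (mem_segSet.1 (hT ha)).2.1
  have hsurv : ∀ a ∈ T, ∀ v ∈ a.2, v ∈ F.surviving τ := by
    intro a ha v hv
    obtain ⟨-, d, j, hcd, -⟩ := exists_eq_concat hν0 (hseg a ha)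
    have hch : a.2.IsChain F.inc.Adj := isChain_of_mem_chunks (isChain_piece _) (hseg a ha)
    rw [hcd] at hv hch
    rcases List.mem_append.1 hv with hv | hv
    · obtain ⟨x, hx, hvx⟩ := exists_adj_of_isChain hch hv
      exact CNF.mem_surviving_of_adj τ (hTB a ha) (hcd ▸ List.mem_append_left _ hv) (hcd ▸ hx) hvx
    · obtain rfl : v = .inr j := by simpa using hv
      exact CNF.inr_mem_surviving_of_disjoint τ fun x hx hxB =>
        hTB a ha x hxB ⟨.inr j, by rw [hcd]; simp, hx⟩
  let s' : Finset {x : ℕ // x ∈ F.vars} := Finset.univ.filter fun x =>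
    x.1 ∈ Z ∧ (Sum.inl x : F.IncVertex) ∈ F.surviving τ
  have hs' : s'.card ≤ Z.card :=
    Finset.card_le_card_of_injOn Subtype.val (fun x hx => (Finset.mem_filter.1 hx).2.1)
      Subtype.val_injective.injOn
  let E : Finset ((Σ _ : WallLabel r, List F.IncVertex) × {x : ℕ // x ∈ F.vars}) :=
    (T ×ˢ s').filter fun e => Touches F e.2.1 e.1.2
  have hE := D.card_minor_edges_le T s' (fun a => {v | v ∈ a.2}) (fun x => {.inl x})
    (fun a ha => D.conn_of_isChain (by
        obtain ⟨-, d, j, hcd, -⟩ := exists_eq_concat hν0 (hseg a ha)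
        rw [hcd]; simp)
      (isChain_of_mem_chunks (isChain_piece _) (hseg a ha)) (hsurv a ha))
    (fun x hx => D.conn_singleton (Finset.mem_filter.1 hx).2.2)
    (by
      rintro ⟨e, c⟩ ha ⟨e', c'⟩ hb v hv hv'
      obtain rfl : e = e' := subsingleton_piece_of_not_branch (hTb _ ha v hv)
        (mem_piece_of_mem_segs (hseg _ ha) hv) (mem_piece_of_mem_segs (hseg _ hb) hv')
      have hcc : c = c' := eq_of_mem_segs (hseg _ ha) (hseg _ hb) hv hv'
      rw [hcc])
    (by rintro a - b - v rfl h; simpa using h)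
    (by
      rintro a ha x hx v hv rfl
      exact hTZ a ha x hv (Finset.mem_filter.1 hx).2.1) E (by
      rintro ⟨a, x⟩ he
      obtain ⟨h1, w, hw, hxw⟩ := Finset.mem_filter.1 he
      obtain ⟨ha, hx⟩ := Finset.mem_product.1 h1
      refine ⟨ha, hx, w, hw, _, rfl, hsurv a ha w hw, (Finset.mem_filter.1 hx).2.2, ?_⟩
      cases w with
      | inl y => simp [CNF.nbr] at hxw
      | inr j => exact (CNF.adj_inl_inr hxw).symm)
  have hEcard : T.card * ν ≤ E.card := by
    have hmap : ∀ e ∈ E, e.1 ∈ T := fun e he =>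
      (Finset.mem_product.1 (Finset.mem_filter.1 he).1).1
    rw [Finset.card_eq_sum_card_fiberwise hmap, ← smul_eq_mul]
    refine Finset.card_nsmul_le_sum _ _ _ fun a ha => ?_
    refine (exists_eq_concat hν0 (hseg a ha)).1.trans
      (Finset.card_le_card_of_surjOn (fun e => e.2.1) ?_)
    intro x hx
    obtain ⟨hxZ, w, hw, hxw⟩ := mem_zNbr.1 hx
    have hxv := CNF.nbr_subset_vars _ hxw
    have hxs : (Sum.inl ⟨x, hxv⟩ : F.IncVertex) ∈ F.surviving τ := by
      cases w with
      | inl y => simp [CNF.nbr] at hxw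
      | inr j => exact CNF.inl_mem_surviving.2 ⟨fun hxB => hTB a ha x hxB ⟨_, hw, hxw⟩, j,
          hsurv a ha _ hw, hxw⟩
    refine ⟨(a, ⟨x, hxv⟩), ?_, rfl⟩
    simp only [E, s', Finset.coe_filter, Finset.mem_filter, Finset.mem_product, Finset.mem_univ,
      true_and, Set.mem_ofPred_eq]
    exact ⟨⟨⟨ha, hxZ, hxs⟩, w, hw, hxw⟩, trivial⟩
  have h1 : t * s'.card ≤ t * Z.card := Nat.mul_le_mul_left _ hs'
  -- the `ν = 2 t` edges of each segment outweigh its contribution `t` to the sparsity bound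
  subst hν
  have h2 : t * T.card ≤ t * Z.card := by nlinarith
  exact Nat.le_of_mul_le_mul_left h2 (by omega)

/-- Few segments meet a branch vertex or contain a variable of `Z`. -/
theorem card_meeting_le (T : Finset (Σ _ : WallLabel r, List F.IncVertex))
    (hT : T ⊆ segSet M Z ν Q p)
    (hTZ : ∀ a ∈ T, (∃ v ∈ a.2, v ∈ Set.range M.branch) ∨
      ∃ x : {x : ℕ // x ∈ F.vars}, .inl x ∈ a.2 ∧ x.1 ∈ Z) : T.card ≤ Z.card + 4 * (r * r) := by
  let s₁ : Finset F.IncVertex := Finset.univ.image M.branch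
  let s₂ : Finset {x : ℕ // x ∈ F.vars} := Finset.univ.filter fun x =>
    x.1 ∈ Z ∧ (Sum.inl x : F.IncVertex) ∉ Set.range M.branch
  have hs₁ : s₁.card ≤ r * r := by
    refine Finset.card_image_le.trans ?_
    simp
  have hs₂ : s₂.card ≤ Z.card :=
    Finset.card_le_card_of_injOn Subtype.val (fun x hx => (Finset.mem_filter.1 hx).2.1)
      Subtype.val_injective.injOn
  have hsub : T ⊆ (s₁.biUnion fun v => T.filter fun a => v ∈ a.2) ∪
      (s₂.biUnion fun x => T.filter fun a => Sum.inl x ∈ a.2) := by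
    intro a ha
    simp only [Finset.mem_union, Finset.mem_biUnion, Finset.mem_filter, s₁, s₂, Finset.mem_image,
      Finset.mem_univ, true_and]
    by_cases hb : ∃ v ∈ a.2, v ∈ Set.range M.branch
    · obtain ⟨v, hv, z, hz⟩ := hb
      exact Or.inl ⟨v, ⟨z, hz⟩, ha, hv⟩
    · obtain ⟨x, hx, hxZ⟩ := (hTZ a ha).resolve_left hb
      exact Or.inr ⟨x, ⟨hxZ, fun h => hb ⟨_, hx, h⟩⟩, ha, hx⟩
  have h1 : (s₁.biUnion fun v => T.filter fun a => v ∈ a.2).card ≤ s₁.card * 4 :=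
    Finset.card_biUnion_le_card_mul _ _ _ fun v _ => (card_segs_through_le (v := v) fun a ha =>
      ⟨hT (Finset.mem_filter.1 ha).1, (Finset.mem_filter.1 ha).2⟩).1
  have h2 : (s₂.biUnion fun x => T.filter fun a => Sum.inl x ∈ a.2).card ≤ s₂.card * 1 :=
    Finset.card_biUnion_le_card_mul _ _ _ fun x hx => (card_segs_through_le (v := .inl x) fun a ha =>
      ⟨hT (Finset.mem_filter.1 ha).1, (Finset.mem_filter.1 ha).2⟩).2 (Finset.mem_filter.1 hx).2.2
  have h3 := (Finset.card_le_card hsub).trans (Finset.card_union_le _ _)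
  omega

end Segments

/-! ### Variables touching many segments -/

/-- From a set covered by `B`, the elements covered by members of `B` with few elements can be removed,
so that the other members of `B` keep many elements. -/
theorem exists_subset_uniform {α : Type*} [DecidableEq α] (T : ℕ → Finset α) (c r : ℕ)
    (B : Finset ℕ) (E : Finset α) : ∃ Q ⊆ E,
      (∀ b ∈ B, Disjoint Q (T b) ∨ r ≤ c * (Q ∩ T b).card) ∧
      c * E.card ≤ c * Q.card + B.card * (r - 1) := by
  induction hn : B.card generalizing B E with
  | zero =>
    obtain rfl := Finset.card_eq_zero.1 hn
    exact ⟨E, subset_rfl, by simp, by simp⟩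
  | succ n ih =>
    by_cases h : ∀ b ∈ B, r ≤ c * (E ∩ T b).card
    · exact ⟨E, subset_rfl, fun b hb => Or.inr (h b hb), by omega⟩
    push Not at h
    obtain ⟨b, hb, hlt⟩ := h
    obtain ⟨Q, hQ, hQB, hcard⟩ := ih (B.erase b) (E \ T b) (by
      rw [Finset.card_erase_of_mem hb]; omega)
    refine ⟨Q, hQ.trans Finset.sdiff_subset, fun b' hb' => ?_, ?_⟩
    · by_cases hbb : b' = b
      · subst hbb
        exact Or.inl (Finset.disjoint_of_subset_left hQ Finset.sdiff_disjoint)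
      · exact hQB b' (Finset.mem_erase.2 ⟨hbb, hb'⟩)
    · have := Finset.card_sdiff_add_card_inter E (T b)
      calc c * E.card = c * (E \ T b).card + c * (E ∩ T b).card := by rw [← this]; ring
        _ ≤ c * Q.card + n * (r - 1) + (r - 1) := by omega
        _ = c * Q.card + (n + 1) * (r - 1) := by ring

section Frequent

open Classical

variable {F : CNF} {r : ℕ} (M : TopologicalModel (wall r) F.inc)

/-- The number of segments with fewer than `D` neighbours in `Z` of the pieces in `Q`. -/
noncomputable def smallCount (Z : Finset ℕ) (ν D : ℕ) (Q : Finset (WallLabel r)) : ℕ :=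
  (segSet M Z ν Q fun c => (zNbr F Z c).card < D).card

/-- The number of segments with fewer than `D` neighbours in `Z` of the pieces in `Q` that are touched
by `x`. -/
noncomputable def hitCount (Z : Finset ℕ) (ν D : ℕ) (Q : Finset (WallLabel r)) (x : ℕ) : ℕ :=
  (segSet M Z ν Q fun c => (zNbr F Z c).card < D ∧ Touches F x c).card

/-- The variables touching at least `r / (4 k)` of the pieces in `Q`. -/
noncomputable def heavy (k : ℕ) (Q : Finset (WallLabel r)) : Finset ℕ :=
  F.vars.filter fun x => r ≤ 4 * k * touchCount M Q x

variable {M} {B : Finset ℕ} {k t : ℕ} {Q : Finset (WallLabel r)}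

/-- Provided that all variables of `B` touching a piece in `Q` are heavy, and that there are many heavy
variables, one of the variables in `B` touches a considerable part of the segments. -/
theorem exists_mem_of_heavy (hk : 1 ≤ k) (ht : 1 ≤ t)
    (hr : 4 * k * (32 * 2 ^ k * t + 4 * (4 * t + 2 * k) + 1) ≤ r)
    (hB : CNF.IsStrongBackdoor (CNF.treewidthAtMost t) F B) (hBk : B.card ≤ k)
    (hQB : ∀ b ∈ B, ∀ e ∈ Q, Touches F b (piece M e) → b ∈ heavy M k Q)
    (hlarge : (2 * t + 4 * (4 * t + 2 * k)) * (2 * (r * r)) < (heavy M k Q).card) :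
    0 < smallCount M (heavy M k Q) (2 * t) (4 * t + 2 * k) Q ∧
    ∃ b ∈ B, b ∈ heavy M k Q ∧ smallCount M (heavy M k Q) (2 * t) (4 * t + 2 * k) Q ≤
      2 * k * hitCount M (heavy M k Q) (2 * t) (4 * t + 2 * k) Q b := by
  set Z := heavy M k Q with hZ
  set D := 4 * t + 2 * k with hD
  set m := smallCount M Z (2 * t) D Q with hm
  set n := Z.card with hn
  have hQ : Q.card ≤ 2 * (r * r) := by
    refine (Finset.card_le_univ Q).trans_eq ?_
    simp only [Fintype.card_prod, Fintype.card_fin, Fintype.card_bool]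
    ring
  have h1 : n * r ≤ 4 * k * ∑ x ∈ Z, touchCount M Q x := by
    rw [Finset.mul_sum, hn, ← smul_eq_mul]
    exact Finset.card_nsmul_le_sum _ _ _ fun x hx => (Finset.mem_filter.1 hx).2
  have h2 := sum_touchCount_le (M := M) (Z := Z) (ν := 2 * t) (Q := Q) (D := D) (by omega) (by omega)
  have h3 := sum_card_zNbr_le hB hBk Z (Finset.univ.filter (fun j : Fin F.clauses.length =>
        D - 2 * t ≤ (zNbr F Z [.inr j]).card)) (fun j hj => by
      have := (Finset.mem_filter.1 hj).2
      omega)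
  have h4 : ∑ x ∈ Z, touchCount M Q x ≤ D * m + 2 * t * (2 * (r * r)) +
      8 * (2 ^ (k + 2) * t * n) := by
    refine h2.trans ?_
    have : 2 * t * Q.card ≤ 2 * t * (2 * (r * r)) := Nat.mul_le_mul_left _ hQ
    rw [← hn] at h3
    change D * m + _ + _ ≤ _
    omega
  -- with fewer segments, the pieces would have too few incidences for all members of `Z` to be heavy
  have hm4 : 4 * n + 8 * (r * r) ≤ m := by
    by_contra! hlt
    have h5 : D * m ≤ D * (4 * n + 8 * (r * r)) := Nat.mul_le_mul_left _ hlt.le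
    have h6 : ∑ x ∈ Z, touchCount M Q x < n * (32 * 2 ^ k * t + 4 * D + 1) := by
      calc ∑ x ∈ Z, touchCount M Q x
          ≤ D * (4 * n + 8 * (r * r)) + 2 * t * (2 * (r * r)) + 8 * (2 ^ (k + 2) * t * n) := by
            omega
        _ = n * (32 * 2 ^ k * t + 4 * D) + (2 * t + 4 * D) * (2 * (r * r)) := by ring
        _ < n * (32 * 2 ^ k * t + 4 * D) + n := by omega
        _ = _ := by ring
    have h7 : 4 * k * ∑ x ∈ Z, touchCount M Q x < 4 * k * (n * (32 * 2 ^ k * t + 4 * D + 1)) :=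
      Nat.mul_lt_mul_of_pos_left h6 (by omega)
    have h8 : n * (4 * k * (32 * 2 ^ k * t + 4 * D + 1)) ≤ n * r := Nat.mul_le_mul_left _ hr
    have h9 : n * (4 * k * (32 * 2 ^ k * t + 4 * D + 1)) =
      4 * k * (n * (32 * 2 ^ k * t + 4 * D + 1)) := by ring
    omega
  -- the segments are of three kinds: touched by `B`, untouched and disjoint from `Z` and from the
  -- branch vertices, or neither
  let S := segSet M Z (2 * t) Q fun c => (zNbr F Z c).card < D
  let S₁ := S.filter fun a => ∃ x ∈ B, Touches F x a.2
  let S₂ := S.filter fun a => (∃ v ∈ a.2, v ∈ Set.range M.branch) ∨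
      ∃ x : {x : ℕ // x ∈ F.vars}, .inl x ∈ a.2 ∧ x.1 ∈ Z
  let S₃ := S.filter fun a => (∀ x ∈ B, ¬ Touches F x a.2) ∧
    (∀ v ∈ a.2, v ∉ Set.range M.branch) ∧ ∀ x : {x : ℕ // x ∈ F.vars}, .inl x ∈ a.2 → x.1 ∉ Z
  have hS₂ : S₂.card ≤ n + 4 * (r * r) := card_meeting_le S₂ (Finset.filter_subset _ _)
    fun a ha => (Finset.mem_filter.1 ha).2
  have hS₃ : S₃.card ≤ n := card_untouched_le ht rfl hB S₃ (Finset.filter_subset _ _)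
    (fun a ha => (Finset.mem_filter.1 ha).2.1) (fun a ha => (Finset.mem_filter.1 ha).2.2.1)
    (fun a ha => (Finset.mem_filter.1 ha).2.2.2)
  have hS : S ⊆ S₁ ∪ (S₂ ∪ S₃) := by
    intro a ha
    simp only [Finset.mem_union, S₁, S₂, S₃, Finset.mem_filter, ha, true_and]
    by_cases h1 : ∃ x ∈ B, Touches F x a.2
    · exact Or.inl h1
    · by_cases h2 : (∃ v ∈ a.2, v ∈ Set.range M.branch) ∨
        ∃ x : {x : ℕ // x ∈ F.vars}, .inl x ∈ a.2 ∧ x.1 ∈ Z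
      · exact Or.inr (Or.inl h2)
      · push Not at h1 h2
        exact Or.inr (Or.inr ⟨h1, h2⟩)
  have hmS : m ≤ S₁.card + (S₂.card + S₃.card) :=
    (Finset.card_le_card hS).trans ((Finset.card_union_le _ _).trans
      (Nat.add_le_add_left (Finset.card_union_le _ _) _))
  have hS₁ : S₁.card ≤ ∑ b ∈ B, hitCount M Z (2 * t) D Q b := by
    refine le_trans (Finset.card_le_card (t := B.biUnion fun b => segSet M Z (2 * t) Q
      fun c => (zNbr F Z c).card < D ∧ Touches F b c) ?_) Finset.card_biUnion_le
    intro a ha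
    obtain ⟨haS, b, hb, hab⟩ := Finset.mem_filter.1 ha
    obtain ⟨h1, h2, h3⟩ := mem_segSet.1 haS
    exact Finset.mem_biUnion.2 ⟨b, hb, mem_segSet.2 ⟨h1, h2, h3, hab⟩⟩
  have hmpos : 0 < m := by
    have : 0 < n := by omega
    omega
  refine ⟨hmpos, ?_⟩
  obtain ⟨b, hb, hbm⟩ : ∃ b ∈ B, m ≤ 2 * k * hitCount M Z (2 * t) D Q b := by
    by_contra! hcon
    have h5 : ∑ b ∈ B, 2 * k * hitCount M Z (2 * t) D Q b ≤ B.card • (m - 1) :=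
      Finset.sum_le_card_nsmul _ _ _ fun b hb => Nat.le_sub_one_of_lt (hcon b hb)
    rw [← Finset.mul_sum, smul_eq_mul] at h5
    have h6 : B.card * (m - 1) ≤ k * (m - 1) := Nat.mul_le_mul_right _ hBk
    have h7 : k * (2 * S₁.card) ≤ k * (m - 1) := by
      have : 2 * k * S₁.card ≤ 2 * k * ∑ b ∈ B, hitCount M Z (2 * t) D Q b :=
        Nat.mul_le_mul_left _ hS₁
      calc k * (2 * S₁.card) = 2 * k * S₁.card := by ring
        _ ≤ _ := by omega
    have h8 := Nat.le_of_mul_le_mul_left h7 (by omega)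
    omega
  -- `b` touches a segment, hence a piece in `Q`
  refine ⟨b, hb, ?_, hbm⟩
  have hpos : 0 < hitCount M Z (2 * t) D Q b := by
    by_contra! h0
    rw [Nat.le_zero.1 h0] at hbm
    omega
  obtain ⟨a, ha⟩ := Finset.card_pos.1 hpos
  obtain ⟨h1, h2, -, v, hv, hbv⟩ := mem_segSet.1 ha
  exact hQB b hb a.1 h1 ⟨v, mem_piece_of_mem_segs h2 hv, hbv⟩

/-- Few variables touch a considerable part of the segments, as all segments have few neighbours. -/
theorem card_frequent_le {Z : Finset ℕ} {ν D : ℕ} (hpos : 0 < smallCount M Z ν D Q) :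
    (Z.filter fun z => smallCount M Z ν D Q ≤ 2 * k * hitCount M Z ν D Q z).card ≤ 2 * k * D := by
  set R := Z.filter fun z => smallCount M Z ν D Q ≤ 2 * k * hitCount M Z ν D Q z with hR
  have h1 : R.card • smallCount M Z ν D Q ≤ ∑ z ∈ R, 2 * k * hitCount M Z ν D Q z :=
    Finset.card_nsmul_le_sum _ _ _ fun z hz => (Finset.mem_filter.1 hz).2
  have h2 : ∑ z ∈ R, hitCount M Z ν D Q z ≤ ∑ z ∈ Z, hitCount M Z ν D Q z :=
    Finset.sum_le_sum_of_subset (Finset.filter_subset _ _)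
  have h3 : ∑ z ∈ Z, hitCount M Z ν D Q z ≤ smallCount M Z ν D Q * D := by
    have h4 : ∀ z, hitCount M Z ν D Q z = ((segSet M Z ν Q fun c => (zNbr F Z c).card < D).filter
        fun a => Touches F z a.2).card := by
      intro z
      rw [hitCount]
      congr 1
      ext a
      simp only [mem_segSet, Finset.mem_filter]
      tauto
    simp only [h4, Finset.card_filter]
    rw [Finset.sum_comm, smallCount, ← smul_eq_mul]
    refine Finset.sum_le_card_nsmul _ _ _ fun a ha => ?_
    rw [← Finset.card_filter]
    exact (mem_segSet.1 ha).2.2.le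
  rw [← Finset.mul_sum, smul_eq_mul] at h1
  have h5 : R.card * smallCount M Z ν D Q ≤ 2 * k * D * smallCount M Z ν D Q :=
    calc _ ≤ 2 * k * (smallCount M Z ν D Q * D) := h1.trans (Nat.mul_le_mul_left _ (h2.trans h3))
      _ = _ := by ring
  exact Nat.le_of_mul_le_mul_right h5 hpos

/-- For a suitable choice of `Q`, a variable of the backdoor set is found among the heavy variables, if
they are few, or among those touching a considerable part of the segments. -/
theorem exists_good_labels (hk : 1 ≤ k) (ht : 1 ≤ t)
    (hr : 4 * k * (32 * 2 ^ k * t + 4 * (4 * t + 2 * k) + 1) ≤ r)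
    (hB : CNF.IsStrongBackdoor (CNF.treewidthAtMost t) F B) (hBk : B.card ≤ k)
    (M : TopologicalModel (wall r) F.inc) : ∃ Q : Finset (WallLabel r),
      ((heavy M k Q).card ≤ (2 * t + 4 * (4 * t + 2 * k)) * (2 * (r * r)) ∧ ∃ b ∈ B, b ∈ heavy M k Q) ∨
      (((heavy M k Q).filter fun z => smallCount M (heavy M k Q) (2 * t) (4 * t + 2 * k) Q ≤
          2 * k * hitCount M (heavy M k Q) (2 * t) (4 * t + 2 * k) Q z).card ≤
            2 * k * (4 * t + 2 * k) ∧
        ∃ b ∈ B, b ∈ heavy M k Q ∧ smallCount M (heavy M k Q) (2 * t) (4 * t + 2 * k) Q ≤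
          2 * k * hitCount M (heavy M k Q) (2 * t) (4 * t + 2 * k) Q b) := by
  obtain ⟨Q, hQE, hQB, hcard⟩ := exists_subset_uniform
    (fun b => Finset.univ.filter fun e => Touches F b (piece M e)) (4 * k) r B (touchedLabels M B)
  have hinter : ∀ b, (Q ∩ Finset.univ.filter fun e => Touches F b (piece M e)).card =
      touchCount M Q b := by
    intro b
    rw [touchCount]
    congr 1
    ext e
    simp
  have hr1 : 4 * t + 12 ≤ r := by
    refine le_trans ?_ hr
    have h1 : 1 ≤ 2 ^ k := Nat.one_le_two_pow
    have h2 : 32 * t ≤ 32 * 2 ^ k * t := Nat.mul_le_mul_right _ (by omega)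
    nlinarith
  have hE := le_card_touchedLabels (M := M) hB hr1
  have hheavy : ∀ b ∈ B, ∀ e ∈ Q, Touches F b (piece M e) → b ∈ heavy M k Q := by
    intro b hb e he hbe
    refine Finset.mem_filter.2 ⟨hB.1 hb, ?_⟩
    rcases hQB b hb with h | h
    · exact absurd (by simpa using hbe) (Finset.disjoint_left.1 h he)
    · rwa [hinter] at h
  have hQne : Q.Nonempty := by
    rw [Finset.nonempty_iff_ne_empty]
    rintro rfl
    rw [Finset.card_empty, Nat.mul_zero, Nat.zero_add] at hcard
    have h1 : B.card * (r - 1) ≤ k * (r - 1) := Nat.mul_le_mul_right _ hBk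
    have h2 : k * r ≤ k * (4 * (touchedLabels M B).card) := Nat.mul_le_mul_left _ hE
    have h3 : k * (4 * (touchedLabels M B).card) = 4 * k * (touchedLabels M B).card := by ring
    have h4 : k * (r - 1) < k * r := Nat.mul_lt_mul_of_pos_left (by omega) (by omega)
    omega
  refine ⟨Q, ?_⟩
  rcases le_or_gt (heavy M k Q).card ((2 * t + 4 * (4 * t + 2 * k)) * (2 * (r * r))) with h | h
  · obtain ⟨e, he⟩ := hQne
    obtain ⟨b, hb, hbe⟩ := mem_touchedLabels.1 (hQE he)
    exact Or.inl ⟨h, b, hb, hheavy b hb e he hbe⟩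
  · obtain ⟨hpos, hex⟩ := exists_mem_of_heavy hk ht hr hB hBk hheavy h
    exact Or.inr ⟨card_frequent_le hpos, hex⟩

end Frequent

/-! ### The size of the wall -/

theorem le_nb {t : ℕ} (ht : 1 ≤ t) : 48 ≤ nb t := by
  have h3 : (3 : ℝ) ≤ (t : ℝ) + 2 := by
    have : (1 : ℝ) ≤ t := by exact_mod_cast ht
    linarith
  have hlog : 1 ≤ Real.log ((t : ℝ) + 2) := by
    rw [Real.le_log_iff_exp_le (by linarith)]
    have := Real.exp_one_lt_d9
    linarith
  have : (48 : ℝ) ≤ 16 * ((t : ℝ) + 2) * Real.log ((t : ℝ) + 2) := by nlinarith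
  unfold nb
  exact_mod_cast this.trans (Nat.le_ceil _)

/-- The constant is `6912 = 3 * 48 ^ 2`, where `48 ≤ nb t`. -/
theorem sq_le_eight_pow {k : ℕ} (hk : 1 ≤ k) :
    (64 * k * 2 ^ k + 32 * k + 16 * k ^ 2) ^ 2 ≤ 6912 * 8 ^ k := by
  rcases lt_or_ge k 5 with h | h
  · interval_cases k <;> norm_num
  · induction k, h using Nat.le_induction with
    | base => norm_num
    | succ k hk5 ih =>
      have ih := ih (by omega)
      have hp : 1 ≤ 2 ^ k := Nat.one_le_two_pow
      -- passing from `k` to `k + 1` multiplies the base by at most `12 / 5`, and `(12 / 5) ^ 2 ≤ 8`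
      have h1 : 5 * (64 * (k + 1) * 2 ^ (k + 1) + 32 * (k + 1) + 16 * (k + 1) ^ 2) ≤
          12 * (64 * k * 2 ^ k + 32 * k + 16 * k ^ 2) := by
        have h2 : 5 * (2 * (k + 1)) * 2 ^ k ≤ 12 * k * 2 ^ k := Nat.mul_le_mul_right _ (by omega)
        have h3 : 5 * (k + 1) ^ 2 ≤ 12 * k ^ 2 := by nlinarith
        rw [pow_succ]
        nlinarith
      have h4 := Nat.pow_le_pow_left h1 2
      rw [mul_pow, mul_pow] at h4
      rw [pow_succ 8]
      omega

/-- The wall is large enough for the counting of segments. -/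
theorem le_floor_wallSize {k t : ℕ} (hk : 1 ≤ k) (ht : 1 ≤ t) :
    4 * k * (32 * 2 ^ k * t + 4 * (4 * t + 2 * k) + 1) ≤ ⌊wallSize k t⌋₊ := by
  set Y := 64 * k * 2 ^ k + 32 * k + 16 * k ^ 2 with hY
  have hobs : Y ^ 2 ≤ obs k t := by
    have h1 : 48 ^ 2 ≤ nb t ^ 2 := Nat.pow_le_pow_left (le_nb ht) 2
    have h8 : 2 ^ k * 2 ^ (2 * k) = 8 ^ k := by
      rw [← pow_add, show k + 2 * k = 3 * k by ring, pow_mul]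
      norm_num
    calc Y ^ 2 ≤ 6912 * 8 ^ k := sq_le_eight_pow hk
      _ = 3 * 48 ^ 2 * 1 * 8 ^ k := by norm_num
      _ ≤ 3 * nb t ^ 2 * t * 8 ^ k := by gcongr
      _ = 2 ^ k * same k t := by rw [same, ← h8]; ring
      _ ≤ obs k t := by rw [obs]; omega
  have hsqrt : (Y : ℝ) ≤ Real.sqrt (obs k t) := by
    apply Real.le_sqrt_of_sq_le
    exact_mod_cast hobs
  refine Nat.le_floor ?_
  have hnat : 4 * k * (32 * 2 ^ k * t + 4 * (4 * t + 2 * k) + 1) ≤ (2 * t + 2) * Y := by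
    have hp : 1 ≤ 2 ^ k := Nat.one_le_two_pow
    have : 0 ≤ t * k ^ 2 := Nat.zero_le _
    rw [hY]
    nlinarith [Nat.zero_le (k * 2 ^ k)]
  calc ((4 * k * (32 * 2 ^ k * t + 4 * (4 * t + 2 * k) + 1) : ℕ) : ℝ) ≤ ((2 * t + 2) * Y : ℕ) := by
        exact_mod_cast hnat
    _ = (2 * (t : ℝ) + 2) * Y := by push_cast; ring
    _ ≤ (2 * (t : ℝ) + 2) * (1 + Real.sqrt (obs k t)) := by gcongr; linarith

theorem four_le_floor_wallSize {k t : ℕ} (hk : 1 ≤ k) : 4 ≤ ⌊wallSize k t⌋₊ := by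
  refine Nat.le_floor ?_
  have h1 : (1 : ℝ) ≤ Real.sqrt (obs k t) := by
    apply Real.le_sqrt_of_sq_le
    have : 1 ≤ obs k t := by rw [obs]; omega
    rw [one_pow]
    exact_mod_cast this
  have h2 : (0 : ℝ) ≤ t := Nat.cast_nonneg t
  unfold wallSize
  push_cast
  nlinarith

namespace RAM

/-! ### Reasoning about programs -/

infixr:60 " ;; " => Prog.seq

/-- Total correctness with a bound on the running time: the program `p`, started in `σ`, halts after at
most `N` steps in a state with the property `Q`. -/
def Runs (p : Prog) (σ : State) (N : ℕ) (Q : State → Prop) : Prop :=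
  ∃ σ' n, Exec p σ σ' n ∧ n ≤ N ∧ Q σ'

namespace Runs

variable {p q : Prog} {σ : State} {N N' N₁ N₂ : ℕ} {Q Q' : State → Prop}

theorem of_le (h : Runs p σ N Q) (hN : N ≤ N') : Runs p σ N' Q := by
  obtain ⟨σ', n, h1, h2, h3⟩ := h
  exact ⟨σ', n, h1, h2.trans hN, h3⟩

theorem mono (h : Runs p σ N Q) (hQ : ∀ σ', Q σ' → Q' σ') : Runs p σ N Q' := by
  obtain ⟨σ', n, h1, h2, h3⟩ := h
  exact ⟨σ', n, h1, h2, hQ _ h3⟩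

theorem skip (h : Q σ) : Runs .skip σ (N + 1) Q := ⟨_, _, .skip σ, by omega, h⟩

theorem const {x c : ℕ} (h : Q (σ.setReg x c)) :
    Runs (.const x c) σ (N + 1) Q :=
  ⟨_, _, .const σ x c, by omega, h⟩

theorem copy {x y : ℕ} (h : Q (σ.setReg x (σ.reg y))) :
    Runs (.copy x y) σ (N + 1) Q :=
  ⟨_, _, .copy σ x y, by omega, h⟩

theorem succ {x y : ℕ} (h : Q (σ.setReg x (σ.reg y + 1))) :
    Runs (.succ x y) σ (N + 1) Q :=
  ⟨_, _, .succ σ x y, by omega, h⟩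

theorem sub {x y z : ℕ} (h : Q (σ.setReg x (σ.reg y - σ.reg z))) :
    Runs (.sub x y z) σ (N + 1) Q :=
  ⟨_, _, .sub σ x y z, by omega, h⟩

theorem load {x a i j : ℕ} (h : Q (σ.setReg x (σ.arr a (σ.reg i + σ.reg j)))) :
    Runs (.load x a i j) σ (N + 1) Q :=
  ⟨_, _, .load σ x a i j, by omega, h⟩

theorem store {a i j x : ℕ} (h : Q (σ.setArr a (σ.reg i + σ.reg j) (σ.reg x))) :
    Runs (.store a i j x) σ (N + 1) Q :=
  ⟨_, _, .store σ a i j x, by omega, h⟩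

theorem seq (h : Runs p σ N₁ fun σ₁ => Runs q σ₁ N₂ Q) : Runs (p ;; q) σ (N₁ + N₂) Q := by
  obtain ⟨σ₁, m, h1, h2, σ₂, n, h3, h4, h5⟩ := h
  exact ⟨σ₂, m + n, .seq h1 h3, Nat.add_le_add h2 h4, h5⟩

/-- Sequential composition with an intermediate assertion `R`. -/
theorem seq_mid (N₁ N₂ : ℕ) (hN : N₁ + N₂ ≤ N) (R : State → Prop) (hp : Runs p σ N₁ R)
    (hq : ∀ τ, R τ → Runs q τ N₂ Q) : Runs (p ;; q) σ N Q :=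
  (seq (hp.mono hq)).of_le hN

theorem const_seq {x c : ℕ} (h : Runs q (σ.setReg x c) N Q) :
    Runs (.const x c ;; q) σ (N + 1) Q := by
  rw [Nat.add_comm]
  exact seq (const (N := 0) h)

theorem copy_seq {x y : ℕ} (h : Runs q (σ.setReg x (σ.reg y)) N Q) :
    Runs (.copy x y ;; q) σ (N + 1) Q := by
  rw [Nat.add_comm]
  exact seq (copy (N := 0) h)

theorem succ_seq {x y : ℕ} (h : Runs q (σ.setReg x (σ.reg y + 1)) N Q) :
    Runs (.succ x y ;; q) σ (N + 1) Q := by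
  rw [Nat.add_comm]
  exact seq (succ (N := 0) h)

theorem sub_seq {x y z : ℕ} (h : Runs q (σ.setReg x (σ.reg y - σ.reg z)) N Q) :
    Runs (.sub x y z ;; q) σ (N + 1) Q := by
  rw [Nat.add_comm]
  exact seq (sub (N := 0) h)

theorem load_seq {x a i j : ℕ} (h : Runs q (σ.setReg x (σ.arr a (σ.reg i + σ.reg j))) N Q) :
    Runs (.load x a i j ;; q) σ (N + 1) Q := by
  rw [Nat.add_comm]
  exact seq (load (N := 0) h)

theorem store_seq {a i j x : ℕ} (h : Runs q (σ.setArr a (σ.reg i + σ.reg j) (σ.reg x)) N Q) :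
    Runs (.store a i j x ;; q) σ (N + 1) Q := by
  rw [Nat.add_comm]
  exact seq (store (N := 0) h)

theorem ite {b : Test} (ht : b.eval σ = true → Runs p σ N Q) (hf : b.eval σ = false → Runs q σ N Q) :
    Runs (.ite b p q) σ (N + 1) Q := by
  cases hb : b.eval σ with
  | true =>
    obtain ⟨σ', n, h1, h2, h3⟩ := ht hb
    exact ⟨σ', n + 1, .ite_true hb h1, by omega, h3⟩
  | false =>
    obtain ⟨σ', n, h1, h2, h3⟩ := hf hb
    exact ⟨σ', n + 1, .ite_false hb h1, by omega, h3⟩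

/-- A loop with a known number of rounds: `I i` is the invariant before round `i`, and `f i` bounds the
cost of this round. -/
theorem while_loop {b : Test} (I : ℕ → State → Prop) (n : ℕ) (f : ℕ → ℕ) (h0 : I 0 σ)
    (hstep : ∀ i < n, ∀ σ, I i σ → b.eval σ = true ∧ Runs p σ (f i) (I (i + 1)))
    (hend : ∀ σ, I n σ → b.eval σ = false) :
    Runs (.while b p) σ (∑ i ∈ Finset.range n, (f i + 1) + 1) (I n) := by
  suffices h : ∀ m i σ, i + m = n → I i σ →
      Runs (.while b p) σ (∑ j ∈ Finset.Ico i n, (f j + 1) + 1) (I n) by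
    simpa using h n 0 σ (by omega) h0
  intro m
  induction m with
  | zero =>
    intro i σ hi hI
    obtain rfl : i = n := by omega
    exact ⟨σ, 1, .while_false (hend σ hI), by simp, hI⟩
  | succ m ih =>
    intro i σ hi hI
    obtain ⟨hb, σ₁, a, h1, h2, h3⟩ := hstep i (by omega) σ hI
    obtain ⟨σ₂, c, h4, h5, h6⟩ := ih (i + 1) σ₁ (by omega) h3
    refine ⟨σ₂, a + c + 1, .while_true hb h1 h4, ?_, h6⟩
    rw [Finset.sum_eq_sum_Ico_succ_bot (show i < n by omega)]
    omega

/-- A loop with a known number of rounds and a uniform bound on their cost. -/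
theorem while_uniform {b : Test} (I : ℕ → State → Prop) (n c : ℕ) (h0 : I 0 σ)
    (hstep : ∀ i < n, ∀ σ, I i σ → b.eval σ = true ∧ Runs p σ c (I (i + 1)))
    (hend : ∀ σ, I n σ → b.eval σ = false) :
    Runs (.while b p) σ (n * (c + 1) + 1) (I n) := by
  simpa using while_loop I n (fun _ => c) h0 hstep hend

end Runs

section State

variable (σ : State)

@[simp] theorem reg_setReg (x v y : ℕ) : (σ.setReg x v).reg y = if y = x then v else σ.reg y := by
  simp [State.setReg, Function.update_apply]

@[simp] theorem arr_setReg (x v : ℕ) : (σ.setReg x v).arr = σ.arr := rfl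

@[simp] theorem reg_setArr (a i v : ℕ) : (σ.setArr a i v).reg = σ.reg := rfl

@[simp] theorem arr_setArr (a i v b : ℕ) :
    (σ.setArr a i v).arr b = if b = a then Function.update (σ.arr a) i v else σ.arr b := by
  simp only [State.setArr, Function.update_apply]

@[simp] theorem eval_lt (x y : ℕ) : (Test.lt x y).eval σ = decide (σ.reg x < σ.reg y) := rfl

@[simp] theorem eval_eq (x y : ℕ) : (Test.eq x y).eval σ = decide (σ.reg x = σ.reg y) := rfl

end State

/-- `σ'` differs from `σ` only in registers with numbers at least `n` and in arrays belonging to `A`. -/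
def Keeps (n : ℕ) (A : List ℕ) (σ σ' : State) : Prop :=
  (∀ x < n, σ'.reg x = σ.reg x) ∧ ∀ a, a ∉ A → σ'.arr a = σ.arr a

namespace Keeps

variable {n n' : ℕ} {A A' : List ℕ} {σ σ₁ σ₂ : State}

theorem refl (n : ℕ) (A : List ℕ) (σ : State) : Keeps n A σ σ := ⟨fun _ _ => rfl, fun _ _ => rfl⟩

theorem trans (h : Keeps n A σ σ₁) (h' : Keeps n A σ₁ σ₂) : Keeps n A σ σ₂ :=
  ⟨fun x hx => (h'.1 x hx).trans (h.1 x hx), fun a ha => (h'.2 a ha).trans (h.2 a ha)⟩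

theorem weaken (h : Keeps n A σ σ₁) (hn : n' ≤ n) (hA : ∀ a ∈ A, a ∈ A') : Keeps n' A' σ σ₁ :=
  ⟨fun x hx => h.1 x (by omega), fun a ha => h.2 a fun h' => ha (hA a h')⟩

theorem setReg (h : Keeps n A σ σ₁) {x v : ℕ} (hx : n ≤ x) : Keeps n A σ (σ₁.setReg x v) :=
  ⟨fun y hy => by rw [reg_setReg, if_neg (by omega), h.1 y hy], fun a ha => h.2 a ha⟩

theorem setArr (h : Keeps n A σ σ₁) {a i v : ℕ} (ha : a ∈ A) : Keeps n A σ (σ₁.setArr a i v) :=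
  ⟨fun y hy => h.1 y hy, fun b hb => by
    rw [arr_setArr, if_neg (fun e : b = a => hb (e ▸ ha)), h.2 b hb]⟩

end Keeps

/-! ### Reading the input -/

/-- The position at which the `i`-th list starts in a concatenation. -/
def start {α : Type} (ls : List (List α)) (i : ℕ) : ℕ := ((ls.take i).map List.length).sum

theorem scanl_getElem? (l : List ℕ) (a i : ℕ) (hi : i ≤ l.length) :
    (l.scanl (· + ·) a)[i]? = some (a + (l.take i).sum) := by
  induction l generalizing a i with
  | nil =>
    obtain rfl : i = 0 := by simpa using hi
    simp
  | cons b l ih =>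
    cases i with
    | zero => simp
    | succ i =>
      rw [List.scanl_cons, List.getElem?_cons_succ, ih _ _ (by simpa using hi)]
      simp [add_assoc]

theorem ofList_offsets {α : Type} (ls : List (List α)) {i : ℕ} (hi : i ≤ ls.length) :
    ofList (offsets ls) i = start ls i := by
  rw [ofList, offsets, List.getD_eq_getElem?_getD, scanl_getElem? _ _ _ (by simpa using hi)]
  simp [start, List.map_take]

theorem start_succ {α : Type} (ls : List (List α)) {i : ℕ} (hi : i < ls.length) :
    start ls (i + 1) = start ls i + ls[i].length := by
  rw [start, start, List.take_succ_eq_append_getElem hi, List.map_append, List.sum_append]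
  simp only [List.map_cons, List.map_nil, List.sum_cons, List.sum_nil, add_zero]

theorem start_length {α : Type} (ls : List (List α)) : start ls ls.length = ls.flatten.length := by
  simp [start, List.length_flatten]

theorem flatten_getElem?_start {α : Type} (ls : List (List α)) {i j : ℕ} (hi : i < ls.length)
    (hj : j < ls[i].length) : ls.flatten[start ls i + j]? = some ls[i][j] := by
  induction ls generalizing i with
  | nil => simp at hi
  | cons l ls ih =>
    cases i with
    | zero =>
      simp only [List.getElem_cons_zero] at hj
      simp [start, List.getElem?_append_left hj, hj]
    | succ i =>
      simp only [List.getElem_cons_succ] at hj ⊢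
      rw [List.flatten_cons, List.getElem?_append_right (by simp [start]; omega),
        ← ih (by simpa using hi) hj]
      congr 1
      simp [start]
      omega

theorem ofList_map_flatten {α : Type} (ls : List (List α)) (f : α → ℕ) {i j : ℕ}
    (hi : i < ls.length) (hj : j < ls[i].length) :
    ofList (ls.flatten.map f) (start ls i + j) = f ls[i][j] := by
  rw [ofList, List.getD_eq_getElem?_getD, List.getElem?_map, flatten_getElem?_start ls hi hj]
  rfl

/-! ### The scanning program -/

/-- Runs through the literals from position `reg 24` up to position `reg 25`. Registers `28`, `29`
record whether the variable in register `15` occurs; the variables marked in array `6` are counted in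
register `27`, where array `7` holds the stamp in register `26` for those counted before. -/
def litLoop : Prog :=
  .while (.lt 24 25) <|
    .load 30 1 24 10 ;;
    .ite (.eq 30 15) (.const 28 1 ;; .const 29 1) .skip ;;
    .load 31 6 30 10 ;;
    .ite (.eq 31 4)
      (.load 31 7 30 10 ;; .ite (.eq 31 26) .skip (.store 7 30 10 26 ;; .succ 27 27)) .skip ;;
    .succ 24 24

/-- Closes the current segment if it has at least `ν` neighbours. If it has fewer than `D`, it is
counted in register `22`, and in register `23` if it is touched. -/
def closeSegment : Prog :=
  .ite (.lt 27 7) .skip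
    (.ite (.lt 27 8) (.succ 22 22 ;; .ite (.eq 28 4) (.succ 23 23) .skip) .skip ;;
      .const 27 0 ;; .const 28 0 ;; .succ 26 26)

/-- Runs through the vertices of a piece from position `reg 20` up to position `reg 21`. -/
def posLoop : Prog :=
  .while (.lt 20 21) <|
    .load 32 4 20 10 ;;
    .ite (.eq 32 4)
      (.load 32 5 20 10 ;; .load 24 0 32 10 ;; .load 25 0 32 4 ;; litLoop ;; closeSegment) .skip ;;
    .succ 20 20

/-- Halves register `16`: the quotient is left in register `19` and the remainder in register `16`. -/
def halve : Prog :=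
  .const 19 0 ;;
  .while (.lt 4 16) (.sub 16 16 4 ;; .sub 16 16 4 ;; .succ 19 19)

/-- Processes the piece with the number in register `17`, if the last binary digit of register `16`
is `1`, and removes this digit. -/
def pieceBody : Prog :=
  halve ;;
  .ite (.eq 16 4)
    (.succ 26 26 ;; .const 27 0 ;; .const 28 0 ;; .const 29 0 ;;
      .load 20 3 17 10 ;; .load 21 3 17 4 ;; posLoop ;;
      .ite (.eq 29 4) (.succ 18 18) .skip) .skip ;;
  .copy 16 19 ;; .succ 17 17

/-- Processes the pieces selected by the binary digits of register `11`. Register `18` counts the pieces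
touched by the variable in register `15`, register `22` the closed segments with fewer than `D`
neighbours, and register `23` those of them touched by the variable. Register `16` is left with the
digits of register `11` beyond the number of pieces. -/
def scan : Prog :=
  .copy 16 11 ;; .const 18 0 ;; .const 22 0 ;; .const 23 0 ;; .const 17 0 ;;
  .while (.lt 17 5) pieceBody

section Spec

open Classical

variable {F : CNF} {ps : List (List F.IncVertex)} {k r ν D pw : ℕ}

/-- The part of the memory that stays fixed after the initialization: the input, and in the registers
`4` to `10` the number `1`, the number of pieces, the bound `pw`, the thresholds `ν` and `D`, the
number of literals of the formula, and `0`. -/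
structure Env (F : CNF) (ps : List (List F.IncVertex)) (k r ν D pw : ℕ) (σ : State) : Prop where
  reg_k : σ.reg 0 = k
  reg_r : σ.reg 2 = r
  reg_one : σ.reg 4 = 1
  reg_pieces : σ.reg 5 = ps.length
  reg_pw : σ.reg 6 = pw
  reg_nu : σ.reg 7 = ν
  reg_D : σ.reg 8 = D
  reg_len : σ.reg 9 = F.clauses.flatten.length
  reg_zero : σ.reg 10 = 0
  arr0 : σ.arr 0 = ofList (offsets F.clauses)
  arr1 : σ.arr 1 = ofList (F.clauses.flatten.map Prod.fst)
  arr3 : σ.arr 3 = ofList (offsets ps)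
  arr4 : σ.arr 4 = ofList (ps.flatten.map (Sum.elim (fun _ => 0) (fun _ => 1)))
  arr5 : σ.arr 5 = ofList (ps.flatten.map (Sum.elim Subtype.val Fin.val))

theorem Env.keeps {σ σ' : State} (h : Env F ps k r ν D pw σ) {n : ℕ} {A : List ℕ}
    (hk : Keeps n A σ σ') (hn : 11 ≤ n) (hA : ∀ a ∈ A, 6 ≤ a) : Env F ps k r ν D pw σ' := by
  have hA' : ∀ a < 6, a ∉ A := fun a ha h' => by have := hA a h'; omega
  constructor
  · rw [hk.1 _ (by omega), h.reg_k]
  · rw [hk.1 _ (by omega), h.reg_r]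
  · rw [hk.1 _ (by omega), h.reg_one]
  · rw [hk.1 _ (by omega), h.reg_pieces]
  · rw [hk.1 _ (by omega), h.reg_pw]
  · rw [hk.1 _ (by omega), h.reg_nu]
  · rw [hk.1 _ (by omega), h.reg_D]
  · rw [hk.1 _ (by omega), h.reg_len]
  · rw [hk.1 _ (by omega), h.reg_zero]
  · rw [hk.2 _ (hA' _ (by norm_num)), h.arr0]
  · rw [hk.2 _ (hA' _ (by norm_num)), h.arr1]
  · rw [hk.2 _ (hA' _ (by norm_num)), h.arr3]
  · rw [hk.2 _ (hA' _ (by norm_num)), h.arr4]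
  · rw [hk.2 _ (hA' _ (by norm_num)), h.arr5]

/-- The registers and the array describing the current segment: its set `cur` of neighbours, whether it
is touched (`f`), and whether the current piece has been touched (`tf`). A new stamp in register `26`
empties `cur` without clearing array `7`. -/
structure SegState (σ : State) (cur : Finset ℕ) (f tf : Prop) : Prop where
  stamp_le : ∀ y, σ.arr 7 y ≤ σ.reg 26
  mem : ∀ y, σ.arr 7 y = σ.reg 26 ↔ y ∈ cur
  card : σ.reg 27 = cur.card
  hf : σ.reg 28 = 1 ↔ f
  htf : σ.reg 29 = 1 ↔ tf

theorem SegState.congr {σ : State} {cur cur' : Finset ℕ} {f f' tf tf' : Prop}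
    (h : SegState σ cur f tf) (hc : cur = cur') (hf : f ↔ f') (htf : tf ↔ tf') :
    SegState σ cur' f' tf' := by
  subst hc
  exact ⟨h.stamp_le, h.mem, h.card, h.hf.trans hf, h.htf.trans htf⟩

theorem litLoop_runs {σ : State} (hE : Env F ps k r ν D pw σ) (vs : List ℕ) (a : ℕ)
    (hread : ∀ i, (hi : i < vs.length) → σ.arr 1 (a + i) = vs[i])
    (hl : σ.reg 24 = a) (hle : σ.reg 25 = a + vs.length)
    {cur : Finset ℕ} {f tf : Prop} (h : SegState σ cur f tf) :
    Runs litLoop σ (vs.length * 13 + 1) fun σ' => Keeps 24 [7] σ σ' ∧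
      SegState σ' (cur ∪ vs.toFinset.filter fun y => σ.arr 6 y = 1)
        (f ∨ σ.reg 15 ∈ vs) (tf ∨ σ.reg 15 ∈ vs) := by
  refine Runs.mono (Runs.while_uniform (fun i σ' => Keeps 24 [7] σ σ' ∧ σ'.reg 24 = a + i ∧
    σ'.reg 25 = a + vs.length ∧ SegState σ' (cur ∪ (vs.take i).toFinset.filter fun y => σ.arr 6 y = 1)
      (f ∨ σ.reg 15 ∈ vs.take i) (tf ∨ σ.reg 15 ∈ vs.take i)) vs.length 12 ?_ ?_ ?_) ?_
  · exact ⟨Keeps.refl _ _ _, hl, hle, by simpa using h⟩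
  · rintro i hi σ' ⟨hk, h24, h25, hS⟩
    refine ⟨by simp [h24, h25, hi], ?_⟩
    have h1 : σ'.arr 1 (a + i) = vs[i] := by rw [hk.2 1 (by simp), hread i hi]
    have h10 : σ'.reg 10 = 0 := by rw [hk.1 10 (by norm_num), hE.reg_zero]
    have h4 : σ'.reg 4 = 1 := by rw [hk.1 4 (by norm_num), hE.reg_one]
    have h15 : σ'.reg 15 = σ.reg 15 := hk.1 15 (by norm_num)
    have h6 : σ'.arr 6 = σ.arr 6 := hk.2 6 (by simp)
    have htake : vs.take (i + 1) = vs.take i ++ [vs[i]] := List.take_succ_eq_append_getElem hi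
    set y := vs[i] with hy
    set cur' := cur ∪ (vs.take i).toFinset.filter fun y => σ.arr 6 y = 1 with hcur'
    have hcur1 : (cur ∪ (vs.take (i + 1)).toFinset.filter fun y => σ.arr 6 y = 1) =
        if σ.arr 6 y = 1 then insert y cur' else cur' := by
      rw [htake, hcur']
      ext z
      split_ifs with h
      · simp only [Finset.mem_union, Finset.mem_filter, List.mem_toFinset, List.mem_append,
          List.mem_singleton, Finset.mem_insert]
        constructor
        · rintro (h1 | ⟨h1 | rfl, h2⟩) <;> tauto
        · rintro (rfl | h1 | h1) <;> tauto
      · simp only [Finset.mem_union, Finset.mem_filter, List.mem_toFinset, List.mem_append,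
          List.mem_singleton]
        constructor
        · rintro (h1 | ⟨h1 | rfl, h2⟩) <;> tauto
        · rintro (h1 | h1) <;> tauto
    have hmem1 : ∀ g : Prop, ((g ∨ σ.reg 15 ∈ vs.take i) ∨ y = σ.reg 15) ↔
        (g ∨ σ.reg 15 ∈ vs.take (i + 1)) := by
      intro g
      rw [htake, List.mem_append, List.mem_singleton, or_assoc, eq_comm (a := y)]
    rw [hcur1]
    refine Runs.load_seq ?_
    refine Runs.seq_mid 3 8 le_rfl (fun τ => Keeps 24 [7] σ τ ∧ τ.reg 24 = a + i ∧
        τ.reg 25 = a + vs.length ∧ τ.reg 30 = y ∧ SegState τ cur' (f ∨ σ.reg 15 ∈ vs.take (i + 1))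
          (tf ∨ σ.reg 15 ∈ vs.take (i + 1))) ?_ ?_
    · refine Runs.ite (fun hb => ?_) (fun hb => ?_)
      · simp [h10, h24, h1, h15] at hb
        refine Runs.const_seq (Runs.const ?_)
        refine ⟨by repeat (first | exact hk | refine Keeps.setReg ?_ (by norm_num)), by simp [h24],
          by simp [h25], by simp [h10, h24, h1], ?_⟩
        refine ⟨by simpa using hS.stamp_le, by simpa using hS.mem, by simpa using hS.card, ?_, ?_⟩
        · rw [← hmem1]; simp [hb]
        · rw [← hmem1]; simp [hb]
      · simp [h10, h24, h1, h15] at hb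
        refine Runs.skip ?_
        refine ⟨by repeat (first | exact hk | refine Keeps.setReg ?_ (by norm_num)), by simp [h24],
          by simp [h25], by simp [h10, h24, h1], ?_⟩
        refine ⟨by simpa using hS.stamp_le, by simpa using hS.mem, by simpa using hS.card, ?_, ?_⟩
        · rw [← hmem1]; simpa [hb] using hS.hf
        · rw [← hmem1]; simpa [hb] using hS.htf
    clear hS h10 h4 h15 h24 h25 h6 h1 hk
    rintro τ ⟨hk, h24, h25, h30, hS⟩
    have h10 : τ.reg 10 = 0 := by rw [hk.1 10 (by norm_num), hE.reg_zero]
    have h4 : τ.reg 4 = 1 := by rw [hk.1 4 (by norm_num), hE.reg_one]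
    have h6 : τ.arr 6 = σ.arr 6 := hk.2 6 (by simp)
    refine Runs.load_seq ?_
    refine Runs.seq (N₁ := 5) (N₂ := 2) (Runs.ite (fun hb => ?_) (fun hb => ?_))
    · simp [h10, h4, h30, h6] at hb
      refine Runs.load_seq ?_
      refine Runs.ite (fun hb' => ?_) (fun hb' => ?_)
      · simp [h10, h30, hS.mem] at hb'
        refine Runs.skip (Runs.succ ?_)
        refine ⟨by repeat (first | exact hk | refine Keeps.setReg ?_ (by norm_num)),
          by simp [h24, add_assoc], by simp [h25], ?_⟩
        refine ⟨by simpa using hS.stamp_le, ?_, ?_, by simpa using hS.hf, by simpa using hS.htf⟩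
        · simpa [hb, hb'] using hS.mem
        · simpa [hb, hb'] using hS.card
      · simp [h10, h30, hS.mem] at hb'
        refine Runs.store_seq (Runs.succ (Runs.succ ?_))
        refine ⟨?_, by simp [h24, add_assoc], by simp [h25], ?_⟩
        · refine Keeps.setReg (Keeps.setReg (Keeps.setArr ?_ (by simp)) (by norm_num)) (by norm_num)
          repeat (first | exact hk | refine Keeps.setReg ?_ (by norm_num))
        refine ⟨?_, ?_, ?_, by simpa using hS.hf, by simpa using hS.htf⟩
        · intro z
          have := hS.stamp_le z
          by_cases hzy : z = y
          · simp [h30, h10, hzy]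
          · simp [h30, h10, hzy, this]
        · intro z
          have := hS.mem z
          by_cases hzy : z = y
          · simp [h30, h10, hzy, hb]
          · simp [h30, h10, hzy, hb, this]
        · simp [hb, hb', hS.card]
    · simp [h10, h4, h30, h6] at hb
      refine Runs.skip (Runs.succ ?_)
      refine ⟨by repeat (first | exact hk | refine Keeps.setReg ?_ (by norm_num)),
        by simp [h24, add_assoc], by simp [h25], ?_⟩
      refine ⟨by simpa using hS.stamp_le, ?_, ?_, by simpa using hS.hf, by simpa using hS.htf⟩
      · simpa [hb] using hS.mem
      · simpa [hb] using hS.card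
  · rintro σ' ⟨-, h24, h25, -⟩
    simp [h24, h25]
  · rintro σ' ⟨hk, -, -, hS⟩
    rw [List.take_length] at hS
    exact ⟨hk, hS⟩

end Spec

/-! ### Scanning a piece -/

section Scan

open Classical

variable {F : CNF} {ps : List (List F.IncVertex)} {k r ν D pw : ℕ}

/-- A segment is small if it has fewer than `D` neighbours in `Z`. -/
def IsSmall (F : CNF) (Z : Finset ℕ) (D : ℕ) (c : List F.IncVertex) : Prop := (zNbr F Z c).card < D

theorem isSmall_iff {Z : Finset ℕ} {c : List F.IncVertex} :
    IsSmall F Z D c ↔ (zNbr F Z c).card < D := Iff.rfl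

/-- A segment is closed as soon as it has `ν` neighbours in `Z`. -/
def IsFull (F : CNF) (Z : Finset ℕ) (ν : ℕ) (c : List F.IncVertex) : Prop := ν ≤ (zNbr F Z c).card

theorem closeSegment_runs {σ : State} (hE : Env F ps k r ν D pw σ) {cur : Finset ℕ} {f tf : Prop}
    (hS : SegState σ cur f tf) : Runs closeSegment σ 9 fun σ' => Keeps 22 [7] σ σ' ∧
      SegState σ' (if ν ≤ cur.card then ∅ else cur) (¬ ν ≤ cur.card ∧ f) tf ∧
      σ'.reg 22 = σ.reg 22 + (if ν ≤ cur.card ∧ cur.card < D then 1 else 0) ∧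
      σ'.reg 23 = σ.reg 23 + (if ν ≤ cur.card ∧ cur.card < D ∧ f then 1 else 0) := by
  have h4 := hE.reg_one
  have h7 := hE.reg_nu
  have h8 := hE.reg_D
  refine Runs.ite (fun hb => ?_) (fun hb => ?_)
  · simp [h7, hS.card] at hb
    have hb' : ¬ ν ≤ cur.card := by omega
    refine Runs.skip ⟨Keeps.refl _ _ _, ?_, by simp [hb'], by simp [hb']⟩
    exact hS.congr (by simp [hb']) (by simp [hb']) Iff.rfl
  · simp [h7, hS.card] at hb
    refine Runs.seq_mid 4 4 le_rfl (fun τ => Keeps 22 [7] σ τ ∧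
      SegState τ cur f tf ∧
      τ.reg 22 = σ.reg 22 + (if ν ≤ cur.card ∧ cur.card < D then 1 else 0) ∧
      τ.reg 23 = σ.reg 23 + (if ν ≤ cur.card ∧ cur.card < D ∧ f then 1 else 0)) ?_ ?_
    · refine Runs.ite (fun hc => ?_) (fun hc => ?_)
      · simp [h8, hS.card] at hc
        refine Runs.succ_seq (Runs.ite (fun hd => ?_) (fun hd => ?_))
        · simp [h4, hS.hf] at hd
          refine Runs.succ ⟨((Keeps.refl _ _ _).setReg (by norm_num)).setReg (by norm_num), ?_,
            by simp [hb, hc], by simp [hb, hc, hd]⟩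
          exact ⟨by simpa using hS.stamp_le, by simpa using hS.mem, by simpa using hS.card,
            by simpa using hS.hf, by simpa using hS.htf⟩
        · simp [h4, hS.hf] at hd
          refine Runs.skip ⟨(Keeps.refl _ _ _).setReg (by norm_num), ?_,
            by simp [hb, hc], by simp [hb, hc, hd]⟩
          exact ⟨by simpa using hS.stamp_le, by simpa using hS.mem, by simpa using hS.card,
            by simpa using hS.hf, by simpa using hS.htf⟩
      · simp [h8, hS.card] at hc
        have hc' : ¬ cur.card < D := by omega
        exact Runs.skip ⟨Keeps.refl _ _ _, hS, by simp [hc'], by simp [hc']⟩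
    · rintro τ ⟨hk, hT, h22, h23⟩
      refine Runs.const_seq (Runs.const_seq (Runs.succ ⟨?_, ?_, by simpa using h22,
        by simpa using h23⟩))
      · exact ((hk.setReg (by norm_num)).setReg (by norm_num)).setReg (by norm_num)
      · refine ⟨fun y => ?_, fun y => ?_, by simp [hb], by simp [hb], by simpa using hT.htf⟩
        · have := hT.stamp_le y
          simp
          omega
        · have := hT.stamp_le y
          simp [hb]
          omega

/-- The contribution of a vertex of the incidence graph to the size of the formula. -/
def weight (F : CNF) : F.IncVertex → ℕ
  | .inl _ => 1
  | .inr j => 1 + F.clauses[j].length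

/-- A piece has no repeated vertices, so a scan of it takes linear time. -/
theorem sum_weight_le {l : List F.IncVertex} (hl : l.Nodup) : (l.map (weight F)).sum ≤ F.size := by
  rw [← List.sum_toFinset _ hl]
  refine (Finset.sum_le_sum_of_subset (Finset.subset_univ _)).trans_eq ?_
  rw [Fintype.sum_sum_type, CNF.size]
  congr 1
  · simp [weight]
  · simp only [weight]
    rw [← List.ofFn_getElem (xs := F.clauses.map fun c => 1 + c.length), List.sum_ofFn]
    simp only [List.getElem_map]
    exact Fintype.sum_equiv (finCongr (by simp)) _ _ fun j => by simp

/-- The scan of a piece `l` performs the greedy segmentation of `l`; its cost is linear in the total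
weight of the vertices. -/
theorem posLoop_runs {σ : State} (hE : Env F ps k r ν D pw σ) (hν : 0 < ν) {Z : Finset ℕ}
    (hZ : ∀ y ∈ F.vars, σ.arr 6 y = 1 ↔ y ∈ Z) (l : List F.IncVertex) (a : ℕ)
    (hr4 : ∀ i, (hi : i < l.length) → σ.arr 4 (a + i) = Sum.elim (fun _ => 0) (fun _ => 1) l[i])
    (hr5 : ∀ i, (hi : i < l.length) → σ.arr 5 (a + i) = Sum.elim Subtype.val Fin.val l[i])
    (h20 : σ.reg 20 = a) (h21 : σ.reg 21 = a + l.length) (hS : SegState σ ∅ False False) :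
    Runs posLoop σ (17 * (l.map (weight F)).sum + 1) fun σ' => Keeps 20 [7] σ σ' ∧
      (∃ cur f, SegState σ' cur f (Touches F (σ.reg 15) l)) ∧
      σ'.reg 22 = σ.reg 22 + (chunks (IsFull F Z ν) l).1.countP (fun c => IsSmall F Z D c) ∧
      σ'.reg 23 = σ.reg 23 + (chunks (IsFull F Z ν) l).1.countP
        (fun c => IsSmall F Z D c ∧ Touches F (σ.reg 15) c) := by
  set x := σ.reg 15 with hx
  -- the costs of the rounds, extended to all natural numbers
  have hcost : ∀ i, ∃ c, (hi : i < l.length) → c = 16 * weight F l[i] := fun i => by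
    by_cases hi : i < l.length
    · exact ⟨16 * weight F l[i], fun _ => rfl⟩
    · exact ⟨0, fun h => absurd h hi⟩
  choose f hf using hcost
  have hsum : ∑ i ∈ Finset.range l.length, (f i + 1) ≤ 17 * (l.map (weight F)).sum := by
    have h1 : (l.map (weight F)).sum = ∑ i : Fin l.length, weight F l[i] := by
      rw [← List.sum_ofFn]
      congr 1
      apply List.ext_getElem <;> simp
    rw [h1, Finset.mul_sum, Finset.sum_range]
    refine Finset.sum_le_sum fun i _ => ?_
    have h2 := hf i i.2
    have h3 : 1 ≤ weight F l[i] := by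
      cases h : l[i] <;> simp [weight]
    change f i + 1 ≤ 17 * weight F l[i.1]
    change 1 ≤ weight F l[i.1] at h3
    omega
  refine Runs.of_le (Runs.mono (Runs.while_loop (fun i σ' => Keeps 20 [7] σ σ' ∧
    σ'.reg 20 = a + i ∧ σ'.reg 21 = a + l.length ∧
    SegState σ' (zNbr F Z (chunks (IsFull F Z ν) (l.take i)).2)
      (Touches F x (chunks (IsFull F Z ν) (l.take i)).2) (Touches F x (l.take i)) ∧
    σ'.reg 22 = σ.reg 22 +
      (chunks (IsFull F Z ν) (l.take i)).1.countP (fun c => IsSmall F Z D c) ∧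
    σ'.reg 23 = σ.reg 23 + (chunks (IsFull F Z ν) (l.take i)).1.countP
        (fun c => IsSmall F Z D c ∧ Touches F x c)) l.length f ?_ ?_ ?_) ?_) (by omega)
  · refine ⟨Keeps.refl _ _ _, h20, h21, hS.congr ?_ ?_ ?_, ?_, ?_⟩ <;>
      simp [chunks, zNbr_nil, not_touches_nil]
  · rintro i hi σ' ⟨hk, h20, h21, hS, h22, h23⟩
    refine ⟨by simp [h20, h21, hi], ?_⟩
    have hE' : Env F ps k r ν D pw σ' := hE.keeps hk (by norm_num) (by simp)
    have h4 : σ'.arr 4 (a + i) = _ := (congrFun (hk.2 4 (by simp)) _).trans (hr4 i hi)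
    have h5 : σ'.arr 5 (a + i) = _ := (congrFun (hk.2 5 (by simp)) _).trans (hr5 i hi)
    have h10 := hE'.reg_zero
    have h1 := hE'.reg_one
    have htake : l.take (i + 1) = l.take i ++ [l[i]] := List.take_succ_eq_append_getElem hi
    have hrest := chunks_rest (IsFull F Z ν) (l.take i)
    have hstep : chunks (IsFull F Z ν) (l.take (i + 1)) =
        chunkStep (IsFull F Z ν) (chunks (IsFull F Z ν) (l.take i)) l[i] := by
      rw [htake, chunks_concat]
    set st := chunks (IsFull F Z ν) (l.take i) with hst
    rw [hf i hi, hstep, htake]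
    cases hv : l[i] with
    | inl y =>
      rw [hv] at h4
      have hnot : ¬ IsFull F Z ν (st.2 ++ [.inl y]) := by
        rw [IsFull, zNbr_append, zNbr_singleton_inl, Finset.union_empty]
        rcases hrest with h | h
        · rw [h, zNbr_nil, Finset.card_empty]
          omega
        · exact h
      have hno : ¬ Touches F x [.inl y] := by simp [touches_singleton, CNF.nbr]
      rw [chunkStep, if_neg hnot]
      refine Runs.load_seq (N := 15) (Runs.seq_mid 2 13 le_rfl (fun τ => τ = σ'.setReg 32 0) ?_ ?_)
      · refine Runs.ite (fun hb => ?_) (fun hb => ?_)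
        · simp [h20, h10, h4, h1] at hb
        · refine Runs.skip ?_
          simp [h20, h10, h4]
      · rintro τ rfl
        refine Runs.succ ⟨(hk.setReg (by norm_num)).setReg (by norm_num), by simp [h20, add_assoc],
          by simpa using h21, ?_, by simpa using h22, by simpa using h23⟩
        refine SegState.congr (cur := zNbr F Z st.2) (f := Touches F x st.2)
          (tf := Touches F x (l.take i)) ?_ ?_ ?_ ?_
        · exact ⟨by simpa using hS.stamp_le, by simpa using hS.mem, by simpa using hS.card,
            by simpa using hS.hf, by simpa using hS.htf⟩
        · rw [zNbr_append, zNbr_singleton_inl, Finset.union_empty]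
        · simp [touches_append, hno]
        · simp [touches_append, hno]
    | inr j =>
      rw [hv] at h4 h5
      simp only [Sum.elim_inr] at h4 h5
      set vs := F.clauses[j].map Prod.fst with hvs
      have hw : 16 * weight F (.inr j) = vs.length * 13 + 1 + (3 * vs.length + 15) := by
        simp [weight, hvs]
        ring
      have htouch : Touches F x [.inr j] ↔ x ∈ vs := by
        simp [touches_singleton, CNF.nbr, hvs]
      have hz : zNbr F Z st.2 ∪ vs.toFinset.filter (fun y => σ'.arr 6 y = 1) =
          zNbr F Z (st.2 ++ [.inr j]) := by
        rw [zNbr_append]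
        congr 1
        ext y
        have h6 : σ'.arr 6 = σ.arr 6 := hk.2 6 (by simp)
        have h7 : Touches F y [.inr j] ↔ y ∈ vs := by
          simp [touches_singleton, CNF.nbr, hvs]
        rw [Finset.mem_filter, mem_zNbr, h7, List.mem_toFinset, h6]
        constructor
        · rintro ⟨h8, h9⟩
          refine ⟨(hZ y ?_).1 h9, h8⟩
          exact CNF.nbr_subset_vars (.inr j) (by simpa [CNF.nbr, hvs] using h8)
        · rintro ⟨h8, h9⟩
          refine ⟨h9, (hZ y ?_).2 h8⟩
          exact CNF.nbr_subset_vars (.inr j) (by simpa [CNF.nbr, hvs] using h9)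
      rw [hw]
      refine Runs.of_le (N := (vs.length * 13 + 1) + 15) ?_ (by omega)
      refine Runs.load_seq (N := (vs.length * 13 + 1) + 14) ?_
      refine Runs.seq_mid ((vs.length * 13 + 1) + 13) 1 (by omega) (fun τ => Keeps 20 [7] σ τ ∧
        τ.reg 20 = a + i ∧ τ.reg 21 = a + l.length ∧
        SegState τ (zNbr F Z (chunkStep (IsFull F Z ν) st (.inr j)).2)
          (Touches F x (chunkStep (IsFull F Z ν) st (.inr j)).2)
          (Touches F x (l.take i ++ [.inr j])) ∧
        τ.reg 22 = σ.reg 22 +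
          (chunkStep (IsFull F Z ν) st (.inr j)).1.countP (fun c => IsSmall F Z D c) ∧
        τ.reg 23 = σ.reg 23 + (chunkStep (IsFull F Z ν) st (.inr j)).1.countP
            (fun c => IsSmall F Z D c ∧ Touches F x c)) ?_ ?_
      · refine Runs.ite (N := (vs.length * 13 + 1) + 12) (fun hb => ?_) (fun hb => ?_)
        swap
        · simp [h20, h10, h4, h1] at hb
        clear hb
        refine Runs.load_seq (N := (vs.length * 13 + 1) + 11)
          (Runs.load_seq (N := (vs.length * 13 + 1) + 10)
            (Runs.load_seq (N := (vs.length * 13 + 1) + 9) ?_))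
        have hs1 : σ'.arr 0 j.1 = start F.clauses j.1 := by
          rw [hE'.arr0, ofList_offsets _ j.2.le]
        have hs2 : σ'.arr 0 (j.1 + 1) = start F.clauses j.1 + vs.length := by
          rw [hE'.arr0, ofList_offsets _ j.2, start_succ _ j.2]
          simp [hvs]
        simp [h20, h10, h5, h4, h1, hs1, hs2]
        set τ₀ := (((σ'.setReg 32 1).setReg 32 j).setReg 24 (start F.clauses j)).setReg 25
          (start F.clauses j.1 + vs.length) with hτ₀
        have hk₀ : Keeps 20 [7] σ τ₀ :=
          (((hk.setReg (by norm_num)).setReg (by norm_num)).setReg (by norm_num)).setReg (by norm_num)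
        have hE₀ : Env F ps k r ν D pw τ₀ := hE.keeps hk₀ (by norm_num) (by simp)
        have hS₀ : SegState τ₀ (zNbr F Z st.2) (Touches F x st.2) (Touches F x (l.take i)) :=
          ⟨by simpa [τ₀] using hS.stamp_le, by simpa [τ₀] using hS.mem, by simpa [τ₀] using hS.card,
            by simpa [τ₀] using hS.hf, by simpa [τ₀] using hS.htf⟩
        refine Runs.seq_mid (vs.length * 13 + 1) 9 le_rfl _ (litLoop_runs hE₀ vs (start F.clauses j)
          (fun m hm => ?_) (by simp [τ₀]) (by simp [τ₀]) hS₀) ?_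
        · have hm' : m < F.clauses[j].length := by simpa [hvs] using hm
          rw [hE₀.arr1, ofList_map_flatten F.clauses Prod.fst j.2 hm']
          simp [hvs]
        · rintro τ ⟨hkτ, hSτ⟩
          have hx₀ : τ₀.reg 15 = x := by rw [hk₀.1 15 (by norm_num)]
          have h6₀ : τ₀.arr 6 = σ'.arr 6 := by simp [τ₀]
          rw [hx₀, h6₀, hz, ← htouch, ← touches_append, ← touches_append] at hSτ
          have hEτ := hE₀.keeps hkτ (by norm_num) (by simp)
          refine (closeSegment_runs hEτ hSτ).mono ?_
          rintro τ' ⟨hk', hS', h22', h23'⟩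
          have hr22 : τ.reg 22 = σ'.reg 22 := by rw [hkτ.1 22 (by norm_num)]; simp [τ₀]
          have hr23 : τ.reg 23 = σ'.reg 23 := by rw [hkτ.1 23 (by norm_num)]; simp [τ₀]
          refine ⟨hk₀.trans ((hkτ.weaken (by norm_num) (by simp)).trans
            (hk'.weaken (by norm_num) (by simp))), ?_, ?_, ?_⟩
          · rw [hk'.1 20 (by norm_num), hkτ.1 20 (by norm_num)]
            simp [τ₀, h20]
          · rw [hk'.1 21 (by norm_num), hkτ.1 21 (by norm_num)]
            simp [τ₀, h21]
          · rw [h22', h23', hr22, hr23, h22, h23, chunkStep]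
            by_cases hfull : IsFull F Z ν (st.2 ++ [.inr j])
            · have hfull' : ν ≤ (zNbr F Z (st.2 ++ [.inr j])).card := hfull
              rw [if_pos hfull]
              refine ⟨hS'.congr (by simp [hfull', zNbr_nil]) (by simp [hfull', not_touches_nil])
                Iff.rfl, ?_, ?_⟩
              · simp only [← isSmall_iff, hfull', true_and, List.countP_append,
                  List.countP_singleton, decide_eq_true_eq, add_assoc]
              · simp only [← isSmall_iff, hfull', true_and, List.countP_append,
                  List.countP_singleton, Bool.decide_and,
                  Bool.and_eq_true, decide_eq_true_eq, add_assoc]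
            · have hfull' : ¬ ν ≤ (zNbr F Z (st.2 ++ [.inr j])).card := hfull
              rw [if_neg hfull]
              refine ⟨hS'.congr (by simp [hfull']) (by simp [hfull']) Iff.rfl, ?_, ?_⟩
              · simp [hfull']
              · simp [hfull']
      · rintro τ ⟨hkτ, h20τ, h21τ, hSτ, h22τ, h23τ⟩
        refine Runs.succ ⟨hkτ.setReg (by norm_num), by simp [h20τ, add_assoc], by simpa using h21τ,
          ?_, by simpa using h22τ, by simpa using h23τ⟩
        exact ⟨by simpa using hSτ.stamp_le, by simpa using hSτ.mem, by simpa using hSτ.card,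
            by simpa using hSτ.hf, by simpa using hSτ.htf⟩
  · rintro σ' ⟨-, h20, h21, -⟩
    simp [h20, h21]
  · rintro σ' ⟨hk, -, -, hS, h22, h23⟩
    rw [List.take_length] at hS h22 h23
    exact ⟨hk, ⟨_, _, hS⟩, h22, h23⟩

end Scan

/-! ### Scanning the selected pieces -/

section Scan

open Classical

variable {F : CNF} {ps : List (List F.IncVertex)} {k r ν D pw : ℕ}

theorem halve_runs {σ : State} (h4 : σ.reg 4 = 1) {h : ℕ} (h16 : σ.reg 16 = h) :
    Runs halve σ (2 * h + 2) fun σ' => (∀ y, y ≠ 16 → y ≠ 19 → σ'.reg y = σ.reg y) ∧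
      σ'.arr = σ.arr ∧ σ'.reg 16 = h % 2 ∧ σ'.reg 19 = h / 2 := by
  refine Runs.of_le (N := h / 2 * 4 + 1 + 1) (Runs.const_seq ?_) (by omega)
  refine Runs.mono (Runs.while_uniform (fun i σ' => (∀ y, y ≠ 16 → y ≠ 19 → σ'.reg y = σ.reg y) ∧
    σ'.arr = σ.arr ∧ σ'.reg 16 = h - 2 * i ∧ σ'.reg 19 = i) (h / 2) 3 ?_ ?_ ?_) ?_
  · refine ⟨fun y _ hy => by simp [hy], rfl, by simp [h16], by simp⟩
  · rintro i hi σ' ⟨hk, ha, h16, h19⟩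
    have h4' : σ'.reg 4 = 1 := by rw [hk 4 (by norm_num) (by norm_num), h4]
    refine ⟨by simp [h4', h16]; omega, Runs.sub_seq (Runs.sub_seq (Runs.succ ⟨?_, ?_, ?_, ?_⟩))⟩
    · intro y hy hy'
      simp [hy, hy', hk y hy hy']
    · simpa using ha
    · simp [h4', h16]
      omega
    · simp [h19]
  · rintro σ' ⟨hk, -, h16, -⟩
    have h4' : σ'.reg 4 = 1 := by rw [hk 4 (by norm_num) (by norm_num), h4]
    simp [h4', h16]
    omega
  · rintro σ' ⟨hk, ha, h16, h19⟩
    exact ⟨hk, ha, by omega, h19⟩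

/-- The sum of the values of `f` at the positions below `P` of the binary digits `1` of `q`. -/
def bitSum (q P : ℕ) (f : ℕ → ℕ) : ℕ := ∑ p ∈ Finset.range P, if q / 2 ^ p % 2 = 1 then f p else 0

theorem bitSum_succ (q P : ℕ) (f : ℕ → ℕ) :
    bitSum q (P + 1) f = bitSum q P f + if q / 2 ^ P % 2 = 1 then f P else 0 :=
  Finset.sum_range_succ _ _

/-- The state of the scan after `p` pieces, for the marked set `Z`, the variable `x` and the selection
of pieces encoded by `q`. -/
structure ScanState (F : CNF) (ps : List (List F.IncVertex)) (ν D : ℕ) (Z : Finset ℕ) (x q p : ℕ)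
    (σ : State) : Prop where
  stamp_le : ∀ y, σ.arr 7 y ≤ σ.reg 26
  rest : σ.reg 16 = q / 2 ^ p
  touch : σ.reg 18 = bitSum q p fun p => if Touches F x (ps.getD p []) then 1 else 0
  small : σ.reg 22 = bitSum q p fun p =>
    (chunks (IsFull F Z ν) (ps.getD p [])).1.countP fun c => IsSmall F Z D c
  hit : σ.reg 23 = bitSum q p fun p =>
    (chunks (IsFull F Z ν) (ps.getD p [])).1.countP fun c => IsSmall F Z D c ∧ Touches F x c

theorem pieceBody_runs {σ : State} (hE : Env F ps k r ν D pw σ) (hν : 0 < ν) {Z : Finset ℕ}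
    (hZ : ∀ y ∈ F.vars, σ.arr 6 y = 1 ↔ y ∈ Z) (hps : ∀ l ∈ ps, l.Nodup) {q p : ℕ}
    (hp : p < ps.length) (h17 : σ.reg 17 = p) (hS : ScanState F ps ν D Z (σ.reg 15) q p σ) :
    Runs pieceBody σ (2 * q + 17 * F.size + 14) fun σ' => Keeps 16 [7] σ σ' ∧
      σ'.reg 17 = p + 1 ∧ ScanState F ps ν D Z (σ.reg 15) q (p + 1) σ' := by
  have hq : q / 2 ^ p ≤ q := Nat.div_le_self _ _
  have hget : ps.getD p [] = ps[p] := by simp [hp]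
  refine Runs.of_le (N := 2 * (q / 2 ^ p) + 2 + (17 * F.size + 12)) ?_ (by omega)
  refine Runs.seq_mid _ _ le_rfl _ (halve_runs hE.reg_one hS.rest) ?_
  rintro τ ⟨hτ, hτa, h16, h19⟩
  have hkτ : Keeps 16 [7] σ τ :=
    ⟨fun y hy => hτ y (by omega) (by omega), fun a _ => by rw [hτa]⟩
  have hEτ := hE.keeps hkτ (by norm_num) (by simp)
  have h4 := hEτ.reg_one
  have h10 := hEτ.reg_zero
  have h17τ : τ.reg 17 = p := by rw [hτ 17 (by norm_num) (by norm_num), h17]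
  set x := σ.reg 15 with hx
  refine Runs.seq_mid (17 * F.size + 10) 2 (by omega) (fun τ' => Keeps 16 [7] σ τ' ∧
    τ'.reg 17 = p ∧ τ'.reg 19 = q / 2 ^ (p + 1) ∧ (∀ y, τ'.arr 7 y ≤ τ'.reg 26) ∧
    (τ'.reg 18 = bitSum q (p + 1) fun p => if Touches F x (ps.getD p []) then 1 else 0) ∧
    (τ'.reg 22 = bitSum q (p + 1) fun p =>
      (chunks (IsFull F Z ν) (ps.getD p [])).1.countP fun c => IsSmall F Z D c) ∧
    τ'.reg 23 = bitSum q (p + 1) fun p =>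
      (chunks (IsFull F Z ν) (ps.getD p [])).1.countP fun c => IsSmall F Z D c ∧ Touches F x c) ?_ ?_
  · have h19' : τ.reg 19 = q / 2 ^ (p + 1) := by rw [h19, Nat.div_div_eq_div_mul, pow_succ]
    have h18 : τ.reg 18 = σ.reg 18 := hτ 18 (by norm_num) (by norm_num)
    have h22 : τ.reg 22 = σ.reg 22 := hτ 22 (by norm_num) (by norm_num)
    have h23 : τ.reg 23 = σ.reg 23 := hτ 23 (by norm_num) (by norm_num)
    have h26 : τ.reg 26 = σ.reg 26 := hτ 26 (by norm_num) (by norm_num)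
    simp only [bitSum_succ, ← hS.touch, ← hS.small, ← hS.hit, hget]
    refine Runs.ite (fun hb => ?_) (fun hb => ?_)
    · simp [h4, h16] at hb
      simp only [hb, if_true]
      refine Runs.succ_seq (Runs.const_seq (Runs.const_seq (Runs.const_seq (Runs.load_seq
        (Runs.load_seq (N := 17 * F.size + 3) ?_)))))
      have hs1 : τ.arr 3 p = start ps p := by rw [hEτ.arr3, ofList_offsets _ hp.le]
      have hs2 : τ.arr 3 (p + 1) = start ps p + ps[p].length := by
        rw [hEτ.arr3, ofList_offsets _ hp, start_succ _ hp]
      simp [h4, h10, h17τ, hs1, hs2]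
      set τ₁ := (((((τ.setReg 26 (τ.reg 26 + 1)).setReg 27 0).setReg 28 0).setReg 29 0).setReg 20
        (start ps p)).setReg 21 (start ps p + ps[p].length) with hτ₁
      have hk₁ : Keeps 20 [7] τ τ₁ := by
        repeat (first | exact Keeps.refl _ _ _ | refine Keeps.setReg ?_ (by norm_num))
      have hE₁ := hEτ.keeps hk₁ (by norm_num) (by simp)
      have hstamp : ∀ y, τ.arr 7 y ≤ τ.reg 26 := by rw [hτa, h26]; exact hS.stamp_le
      have hS₁ : SegState τ₁ ∅ False False := by
        refine ⟨fun y => ?_, fun y => ?_, by simp [τ₁], by simp [τ₁], by simp [τ₁]⟩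
        · have := hstamp y
          simp [τ₁]
          omega
        · have := hstamp y
          simp [τ₁]
          omega
      have hx₁ : τ₁.reg 15 = x := by rw [hk₁.1 15 (by norm_num), hkτ.1 15 (by norm_num)]
      refine Runs.seq_mid (17 * (ps[p].map (weight F)).sum + 1) 2 ?_ _
        (posLoop_runs hE₁ hν (Z := Z) ?_ ps[p] (start ps p) ?_ ?_ (by simp [τ₁]) (by simp [τ₁]) hS₁) ?_
      · have := sum_weight_le (hps ps[p] (List.getElem_mem hp))
        omega
      · intro y hy
        rw [← hZ y hy, hk₁.2 6 (by simp), hτa]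
      · intro i hi
        rw [hE₁.arr4, ofList_map_flatten ps _ hp hi]
      · intro i hi
        rw [hE₁.arr5, ofList_map_flatten ps _ hp hi]
      · rintro υ ⟨hkυ, ⟨cur, f, hSυ⟩, h22υ, h23υ⟩
        rw [hx₁] at hSυ h23υ
        have e22 : τ₁.reg 22 = σ.reg 22 := by rw [← h22]; simp [τ₁]
        have e23 : τ₁.reg 23 = σ.reg 23 := by rw [← h23]; simp [τ₁]
        have e18 : υ.reg 18 = σ.reg 18 := by
          rw [hkυ.1 18 (by norm_num), ← h18]; simp [τ₁]
        have e19 : υ.reg 19 = q / 2 ^ (p + 1) := by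
          rw [hkυ.1 19 (by norm_num), ← h19']; simp [τ₁]
        have e17 : υ.reg 17 = p := by
          rw [hkυ.1 17 (by norm_num), ← h17τ]; simp [τ₁]
        have e4 : υ.reg 4 = 1 := (hE₁.keeps hkυ (by norm_num) (by simp)).reg_one
        rw [e22] at h22υ
        rw [e23] at h23υ
        have hkk : Keeps 16 [7] σ υ := hkτ.trans ((hk₁.weaken (by norm_num) (by simp)).trans
          (hkυ.weaken (by norm_num) (by simp)))
        refine Runs.ite (fun hb => ?_) (fun hb => ?_)
        · simp [e4, hSυ.htf] at hb
          refine Runs.succ ⟨hkk.setReg (by norm_num), by simpa using e17, by simpa using e19,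
            by simpa using hSυ.stamp_le, by simp [e18, hb], by simp [h22υ], by simp [h23υ]⟩
        · simp [e4, hSυ.htf] at hb
          refine Runs.skip ⟨hkk, e17, e19, hSυ.stamp_le, by simp [e18, hb], h22υ, by simp [h23υ]⟩
    · simp [h4, h16] at hb
      refine Runs.skip ⟨hkτ, h17τ, h19', ?_, by simp [hb, h18], by simp [hb, h22], by simp [hb, h23]⟩
      rw [hτa, h26]
      exact hS.stamp_le
  · rintro υ ⟨hk, h17, h19, hst, h18, h22, h23⟩
    refine Runs.copy_seq (Runs.succ ⟨(hk.setReg (by norm_num)).setReg (by norm_num), by simp [h17],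
      ⟨by simpa using hst, by simpa using h19, by simpa using h18, by simpa using h22,
        by simpa using h23⟩⟩)

theorem scan_runs {σ : State} (hE : Env F ps k r ν D pw σ) (hν : 0 < ν) {Z : Finset ℕ}
    (hZ : ∀ y ∈ F.vars, σ.arr 6 y = 1 ↔ y ∈ Z) (hps : ∀ l ∈ ps, l.Nodup)
    (hst : ∀ y, σ.arr 7 y ≤ σ.reg 26) :
    Runs scan σ (ps.length * (2 * σ.reg 11 + 17 * F.size + 15) + 6) fun σ' => Keeps 16 [7] σ σ' ∧
      ScanState F ps ν D Z (σ.reg 15) (σ.reg 11) ps.length σ' := by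
  refine Runs.copy_seq (Runs.const_seq (Runs.const_seq (Runs.const_seq (Runs.const_seq ?_))))
  refine Runs.mono (Runs.while_uniform (fun p σ' => Keeps 16 [7] σ σ' ∧ σ'.reg 17 = p ∧
    ScanState F ps ν D Z (σ.reg 15) (σ.reg 11) p σ') ps.length _ ?_ ?_ ?_) ?_
  · refine ⟨?_, by simp, by simpa using hst, by simp, by simp [bitSum], by simp [bitSum],
      by simp [bitSum]⟩
    repeat (first | exact Keeps.refl _ _ _ | refine Keeps.setReg ?_ (by norm_num))
  · rintro p hp σ' ⟨hk, h17, hS⟩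
    have hE' := hE.keeps hk (by norm_num) (by simp)
    refine ⟨by simp [h17, hE'.reg_pieces, hp], ?_⟩
    rw [← hk.1 15 (by norm_num)] at hS
    refine (pieceBody_runs hE' hν (Z := Z) (fun y hy => ?_) hps hp h17 hS).mono ?_
    · rw [← hZ y hy, hk.2 6 (by simp)]
    · rintro σ'' ⟨hk', h17', hS'⟩
      rw [hk.1 15 (by norm_num)] at hS'
      exact ⟨hk.trans hk', h17', hS'⟩
  · rintro σ' ⟨hk, h17, -⟩
    have hE' := hE.keeps hk (by norm_num) (by simp)
    simp [h17, hE'.reg_pieces]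
  · rintro σ' ⟨hk, -, hS⟩
    exact ⟨hk, hS⟩

end Scan

/-! ### Selecting the candidates -/

/-- Subtracts `2 k` times register `y` from register `33`, where `k` is held by register `0`. -/
def subTwice (y : ℕ) : Prog :=
  .const 34 0 ;; .while (.lt 34 0) (.sub 33 33 y ;; .sub 33 33 y ;; .succ 34 34)

/-- Decides whether the variable at position `reg 14` is heavy, and records this in array `6`. -/
def markBody : Prog :=
  .load 15 1 14 10 ;; scan ;; .copy 33 2 ;; subTwice 18 ;; subTwice 18 ;;
  .ite (.eq 33 10) (.const 35 1) (.const 35 0) ;; .store 6 15 10 35 ;; .succ 14 14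

/-- Appends the variable in register `15` to the output, unless `pw` variables have been appended for
the current selection. -/
def appendOutput : Prog :=
  .ite (.lt 13 6) (.store 9 12 10 15 ;; .store 8 15 10 4 ;; .succ 12 12 ;; .succ 13 13) .skip

/-- Appends the variable in register `15` to the output if register `16` is `1` or if it touches many
segments. -/
def testSegments : Prog :=
  scan ;; .copy 33 22 ;; subTwice 23 ;; .ite (.eq 16 4) (.const 33 0) .skip ;;
  .ite (.eq 33 10) appendOutput .skip

/-- Processes the variable at position `reg 14`, if it is heavy and has not been output before. -/
def selectBody : Prog :=
  .load 15 1 14 10 ;; .load 35 6 15 10 ;; .load 36 8 15 10 ;;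
  .ite (.eq 35 4) (.ite (.eq 36 4) .skip testSegments) .skip ;; .succ 14 14

section Collect

open Classical

variable {F : CNF} {ps : List (List F.IncVertex)} {k r ν D pw : ℕ}

theorem subTwice_runs {σ : State} {y : ℕ} (hy : y < 33) (h0 : σ.reg 0 = k) :
    Runs (subTwice y) σ (k * 4 + 2) fun σ' => Keeps 33 [] σ σ' ∧
      σ'.reg 33 = σ.reg 33 - 2 * k * σ.reg y := by
  refine Runs.const_seq ?_
  refine Runs.mono (Runs.while_uniform (fun i σ' => Keeps 33 [] σ σ' ∧ σ'.reg 34 = i ∧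
    σ'.reg 33 = σ.reg 33 - 2 * i * σ.reg y) k 3 ?_ ?_ ?_) ?_
  · exact ⟨(Keeps.refl _ _ _).setReg (by norm_num), by simp, by simp⟩
  · rintro i hi σ' ⟨hk, h34, h33⟩
    refine ⟨by simp [h34, hk.1 0 (by norm_num), h0, hi], Runs.sub_seq (Runs.sub_seq
      (Runs.succ ⟨?_, by simp [h34], ?_⟩))⟩
    · repeat (first | exact hk | refine Keeps.setReg ?_ (by norm_num))
    · have h1 : y ≠ 33 := by omega
      simp [h33, h1, hk.1 y hy, Nat.sub_sub]
      congr 1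
      ring
  · rintro σ' ⟨hk, h34, -⟩
    simp [h34, hk.1 0 (by norm_num), h0]
  · rintro σ' ⟨hk, -, h33⟩
    exact ⟨hk, h33⟩

/-- The variables of all literals, with repetitions. -/
def occurrences (F : CNF) : List ℕ := F.clauses.flatten.map Prod.fst

theorem mem_occurrences {F : CNF} {x : ℕ} : x ∈ occurrences F ↔ x ∈ F.vars := by
  simp only [occurrences, CNF.vars, List.mem_toFinset]

theorem length_occurrences (F : CNF) : (occurrences F).length = F.clauses.flatten.length := by
  simp only [occurrences, List.length_map]

/-- The number of selected pieces touched by `x`. -/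
noncomputable def touchSum (F : CNF) (ps : List (List F.IncVertex)) (q x : ℕ) : ℕ :=
  bitSum q ps.length fun p => if Touches F x (ps.getD p []) then 1 else 0

/-- The number of small segments of the selected pieces. -/
noncomputable def smallSum (F : CNF) (ps : List (List F.IncVertex)) (ν D : ℕ) (Z : Finset ℕ)
    (q : ℕ) : ℕ :=
  bitSum q ps.length fun p =>
    (chunks (IsFull F Z ν) (ps.getD p [])).1.countP fun c => IsSmall F Z D c

/-- The number of small segments of the selected pieces that are touched by `x`. -/
noncomputable def hitSum (F : CNF) (ps : List (List F.IncVertex)) (ν D : ℕ) (Z : Finset ℕ)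
    (q x : ℕ) : ℕ :=
  bitSum q ps.length fun p =>
    (chunks (IsFull F Z ν) (ps.getD p [])).1.countP fun c => IsSmall F Z D c ∧ Touches F x c

/-- The heavy variables for the selection of pieces encoded by `q`. -/
noncomputable def heavyOf (F : CNF) (ps : List (List F.IncVertex)) (k r q : ℕ) : Finset ℕ :=
  F.vars.filter fun x => r ≤ 4 * k * touchSum F ps q x

/-- The candidates for the selection of pieces encoded by the last `ps.length` digits of `q`. The digit
before them tells whether all heavy variables are candidates. -/
noncomputable def candidates (F : CNF) (ps : List (List F.IncVertex)) (k r ν D q : ℕ) : Finset ℕ :=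
  (heavyOf F ps k r q).filter fun x => q / 2 ^ ps.length = 1 ∨
    smallSum F ps ν D (heavyOf F ps k r q) q ≤ 2 * k * hitSum F ps ν D (heavyOf F ps k r q) q x

/-- A bound on the number of steps of `scan`. -/
def scanCost (P pw S : ℕ) : ℕ := P * (2 * pw + 17 * S + 15) + 6

theorem markBody_runs {σ : State} (hE : Env F ps k r ν D pw σ) (hν : 0 < ν)
    (hps : ∀ l ∈ ps, l.Nodup) (hq : σ.reg 11 ≤ pw) (hst : ∀ y, σ.arr 7 y ≤ σ.reg 26) {i : ℕ}
    (hi : i < (occurrences F).length) (h14 : σ.reg 14 = i) :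
    Runs markBody σ (scanCost ps.length pw F.size + 8 * k + 10) fun σ' => Keeps 14 [6, 7] σ σ' ∧
      σ'.reg 14 = i + 1 ∧ (∀ y, σ'.arr 7 y ≤ σ'.reg 26) ∧
      (σ'.arr 6 (occurrences F)[i] = 1 ↔
        r ≤ 4 * k * touchSum F ps (σ.reg 11) (occurrences F)[i]) ∧
      ∀ y ≠ (occurrences F)[i], σ'.arr 6 y = σ.arr 6 y := by
  set x := (occurrences F)[i] with hx
  have h1 : σ.arr 1 i = x := by
    rw [hE.arr1, ofList, List.getD_eq_getElem?_getD]
    change ((occurrences F)[i]?).getD 0 = x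
    rw [List.getElem?_eq_getElem hi, hx]
    rfl
  refine Runs.of_le (N := scanCost ps.length pw F.size + (8 * k + 9) + 1) ?_ (by omega)
  refine Runs.load_seq ?_
  simp only [h14, hE.reg_zero, h1, add_zero]
  set τ := σ.setReg 15 x with hτ
  have hk₀ : Keeps 14 [6, 7] σ τ := (Keeps.refl _ _ _).setReg (by norm_num)
  have hE₀ := hE.keeps hk₀ (by norm_num) (by simp)
  have h14τ : τ.reg 14 = i := by simp [τ, h14]
  have h11τ : τ.reg 11 = σ.reg 11 := by simp [τ]
  have h15τ : τ.reg 15 = x := by simp [τ]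
  refine Runs.seq_mid (scanCost ps.length pw F.size) (8 * k + 9) le_rfl _
    ((scan_runs hE₀ hν (Z := F.vars.filter fun y => σ.arr 6 y = 1) ?_ hps ?_).of_le ?_) ?_
  · intro y hy
    simp [hτ, hy]
  · simpa [hτ] using hst
  · rw [scanCost, h11τ]
    gcongr
  rintro τ₁ ⟨hk₁, hS₁⟩
  rw [h11τ, h15τ] at hS₁
  have hE₁ := hE₀.keeps hk₁ (by norm_num) (by simp)
  have h14₁ : τ₁.reg 14 = i := by rw [hk₁.1 14 (by norm_num), h14τ]
  have h15₁ : τ₁.reg 15 = x := by rw [hk₁.1 15 (by norm_num), h15τ]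
  have hst₁ := hS₁.stamp_le
  have h18 : τ₁.reg 18 = touchSum F ps (σ.reg 11) x := hS₁.touch
  have h2 := hE₁.reg_r
  have h6 : τ₁.arr 6 = σ.arr 6 := by rw [hk₁.2 6 (by simp), hτ, arr_setReg]
  have hkk₁ : Keeps 14 [6, 7] σ τ₁ := hk₀.trans (hk₁.weaken (by norm_num) (by simp))
  refine Runs.copy_seq (N := 8 * k + 8) ?_
  refine Runs.seq_mid (k * 4 + 2) (k * 4 + 6) (by omega) _ (subTwice_runs (by norm_num)
    (by simpa using hE₁.reg_k)) ?_
  rintro τ₂ ⟨hk₂, h33⟩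
  refine Runs.seq_mid (k * 4 + 2) 4 (by omega) _ (subTwice_runs (k := k) (by norm_num)
    (by rw [hk₂.1 0 (by norm_num)]; simpa using hE₁.reg_k)) ?_
  rintro τ₃ ⟨hk₃, h33'⟩
  rw [h33, hk₂.1 18 (by norm_num)] at h33'
  simp [h2, h18] at h33'
  have hkk₂ : Keeps 33 [] τ₁ τ₃ := ((Keeps.refl _ _ _).setReg (by norm_num)).trans (hk₂.trans hk₃)
  have hkk₃ : Keeps 14 [6, 7] σ τ₃ := hkk₁.trans (hkk₂.weaken (by norm_num) (by simp))
  have hdec : τ₃.reg 33 = 0 ↔ r ≤ 4 * k * touchSum F ps (σ.reg 11) x := by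
    rw [h33', Nat.sub_sub, Nat.sub_eq_zero_iff_le]
    ring_nf
  have e10 : τ₃.reg 10 = 0 := (hE.keeps hkk₃ (by norm_num) (by simp)).reg_zero
  have e14 : τ₃.reg 14 = i := by rw [hkk₂.1 14 (by norm_num), h14₁]
  have e15 : τ₃.reg 15 = x := by rw [hkk₂.1 15 (by norm_num), h15₁]
  have e7 : ∀ y, τ₃.arr 7 y ≤ τ₃.reg 26 := by
    rw [hkk₂.2 7 (by simp), hkk₂.1 26 (by norm_num)]
    exact hst₁
  have e6 : τ₃.arr 6 = σ.arr 6 := by rw [hkk₂.2 6 (by simp), h6]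
  refine Runs.seq (N₁ := 2) (N₂ := 2) (Runs.ite (fun hb => ?_) (fun hb => ?_))
  · simp [e10, hdec] at hb
    refine Runs.const (Runs.store_seq (Runs.succ ⟨?_, by simp [e14], ?_, ?_, ?_⟩))
    · exact ((hkk₃.setReg (by norm_num)).setArr (by simp)).setReg (by norm_num)
    · simpa using e7
    · simp [e15, e10, hb]
    · intro y hy
      simp [e15, e10, hy, e6]
  · simp only [eval_eq, e10, hdec, decide_eq_false_iff_not] at hb
    refine Runs.const (Runs.store_seq (Runs.succ ⟨?_, by simp [e14], ?_, ?_, ?_⟩))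
    · exact ((hkk₃.setReg (by norm_num)).setArr (by simp)).setReg (by norm_num)
    · simpa using e7
    · simp only [hb, iff_false]
      simp [e15, e10]
    · intro y hy
      simp [e15, e10, hy, e6]

end Collect

/-- Collects the candidates for all selections of pieces in array `9`. -/
def collect : Prog :=
  .while (.lt 11 6) <|
    .const 14 0 ;; .while (.lt 14 9) markBody ;; .const 13 0 ;; .const 14 0 ;;
    .while (.lt 14 9) selectBody ;; .succ 11 11

section Collect

open Classical

variable {F : CNF} {ps : List (List F.IncVertex)} {k r ν D pw : ℕ}

/-- The list `O` of variables has been collected: array `9` holds its members, and array `8` marks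
them. -/
structure OutState (F : CNF) (O : List ℕ) (σ : State) : Prop where
  len : σ.reg 12 = O.length
  cell : ∀ i, (hi : i < O.length) → σ.arr 9 i = O[i]
  flag : ∀ y, σ.arr 8 y = 1 ↔ y ∈ O
  sub : ∀ y ∈ O, y ∈ F.vars

theorem OutState.keeps {O : List ℕ} {σ σ' : State} (h : OutState F O σ) {n : ℕ} {A : List ℕ}
    (hk : Keeps n A σ σ') (hn : 13 ≤ n) (hA : 8 ∉ A ∧ 9 ∉ A) : OutState F O σ' :=
  ⟨by rw [hk.1 12 (by omega), h.len], by rw [hk.2 9 hA.2]; exact h.cell,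
    by rw [hk.2 8 hA.1]; exact h.flag, h.sub⟩

/-- The effect of processing the variable `x`, where `R` is the set of candidates: nothing has been
appended to the output, or `x` has been appended, which is a new candidate. -/
def Processed (F : CNF) (pw x : ℕ) (R : Finset ℕ) (O : List ℕ) (σ σ' : State) : Prop :=
  (OutState F O σ' ∧ σ'.reg 13 = σ.reg 13 ∧ (x ∈ R → x ∈ O ∨ σ.reg 13 = pw)) ∨
  (OutState F (O ++ [x]) σ' ∧ σ'.reg 13 = σ.reg 13 + 1 ∧ σ.reg 13 < pw ∧ x ∈ R ∧ x ∉ O)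

theorem appendOutput_runs {σ : State} (hE : Env F ps k r ν D pw σ) {x : ℕ} (h15 : σ.reg 15 = x)
    (hx : x ∈ F.vars) {R : Finset ℕ} (hxR : x ∈ R) {O : List ℕ} (hO : OutState F O σ) (hxO : x ∉ O)
    (h13 : σ.reg 13 ≤ pw) :
    Runs appendOutput σ 5 fun σ' => Keeps 12 [8, 9] σ σ' ∧ σ'.reg 14 = σ.reg 14 ∧
      σ'.reg 26 = σ.reg 26 ∧ Processed F pw x R O σ σ' := by
  refine Runs.ite (fun hb => ?_) (fun hb => ?_)
  · simp [hE.reg_pw] at hb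
    refine Runs.store_seq (Runs.store_seq (Runs.succ_seq (Runs.succ ⟨?_, by simp, by simp,
      Or.inr ⟨?_, by simp, hb, hxR, hxO⟩⟩)))
    · exact ((((Keeps.refl _ _ _).setArr (by simp)).setArr (by simp)).setReg (by norm_num)).setReg
        (by norm_num)
    · refine ⟨by simp [hO.len], fun i hi => ?_, fun y => ?_, fun y hy => ?_⟩
      · rw [List.length_append, List.length_singleton] at hi
        rcases Nat.lt_succ_iff_lt_or_eq.1 hi with h | h
        · have h' : i ≠ O.length := by omega
          simp [hE.reg_zero, hO.len, h', hO.cell i h, List.getElem_append_left h]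
        · subst h
          simp [hE.reg_zero, hO.len, h15]
      · have := hO.flag y
        by_cases hy : y = x
        · simp [hE.reg_zero, hE.reg_one, h15, hy]
        · simp [hE.reg_zero, hE.reg_one, h15, hy, this]
      · rcases List.mem_append.1 hy with h | h
        · exact hO.sub y h
        · rwa [List.mem_singleton.1 h]
  · simp [hE.reg_pw] at hb
    exact Runs.skip ⟨Keeps.refl _ _ _, rfl, rfl, Or.inl ⟨hO, rfl, fun _ => Or.inr (by omega)⟩⟩

theorem testSegments_runs {σ : State} (hE : Env F ps k r ν D pw σ) (hν : 0 < ν)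
    (hps : ∀ l ∈ ps, l.Nodup) {q : ℕ} (h11 : σ.reg 11 = q) (hq : q ≤ pw)
    (hst : ∀ y, σ.arr 7 y ≤ σ.reg 26)
    (hZ : ∀ y ∈ F.vars, σ.arr 6 y = 1 ↔ y ∈ heavyOf F ps k r q) {x : ℕ} (h15 : σ.reg 15 = x)
    (hxZ : x ∈ heavyOf F ps k r q) {O : List ℕ} (hO : OutState F O σ) (hxO : x ∉ O)
    (h13 : σ.reg 13 ≤ pw) :
    Runs testSegments σ (scanCost ps.length pw F.size + 4 * k + 11) fun σ' =>
      Keeps 12 [7, 8, 9] σ σ' ∧ σ'.reg 14 = σ.reg 14 ∧ (∀ y, σ'.arr 7 y ≤ σ'.reg 26) ∧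
      Processed F pw x (candidates F ps k r ν D q) O σ σ' := by
  set Z := heavyOf F ps k r q with hZdef
  refine Runs.seq_mid (scanCost ps.length pw F.size) (4 * k + 11) (by omega) _
    ((scan_runs hE hν hZ hps hst).of_le ?_) ?_
  · rw [scanCost, h11]
    gcongr
  rintro τ ⟨hk, hS⟩
  rw [h11, h15] at hS
  have hEτ := hE.keeps hk (by norm_num) (by simp)
  have h22 : τ.reg 22 = smallSum F ps ν D Z q := hS.small
  have h23 : τ.reg 23 = hitSum F ps ν D Z q x := hS.hit
  have h16 := hS.rest
  have hst₁ := hS.stamp_le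
  refine Runs.copy_seq (N := 4 * k + 10) ?_
  refine Runs.seq_mid (k * 4 + 2) 8 (by omega) _ (subTwice_runs (by norm_num)
    (by simpa using hEτ.reg_k)) ?_
  rintro τ₁ ⟨hk₁, h33⟩
  simp only [reg_setReg, if_true, h22, if_neg (show ¬ (23 : ℕ) = 33 by norm_num), h23] at h33
  have hkk₁ : Keeps 33 [] τ τ₁ := ((Keeps.refl _ _ _).setReg (by norm_num)).trans hk₁
  have hE₁ := hEτ.keeps hkk₁ (by norm_num) (by simp)
  have h16₁ : τ₁.reg 16 = q / 2 ^ ps.length := by rw [hkk₁.1 16 (by norm_num), h16]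
  refine Runs.seq_mid 2 6 le_rfl (fun τ₂ => Keeps 33 [] τ τ₂ ∧
    (τ₂.reg 33 = 0 ↔ x ∈ candidates F ps k r ν D q)) ?_ ?_
  · have hc : x ∈ candidates F ps k r ν D q ↔ q / 2 ^ ps.length = 1 ∨
        smallSum F ps ν D Z q ≤ 2 * k * hitSum F ps ν D Z q x := by
      rw [candidates, Finset.mem_filter, ← hZdef]
      simp only [hxZ, true_and]
    rw [hc]
    refine Runs.ite (fun hb => ?_) (fun hb => ?_)
    · simp [hE₁.reg_one, h16₁] at hb
      exact Runs.const ⟨hkk₁.setReg (by norm_num), by simp [hb]⟩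
    · simp [hE₁.reg_one, h16₁] at hb
      exact Runs.skip ⟨hkk₁, by simp [hb, h33, Nat.sub_eq_zero_iff_le]⟩
  rintro τ₂ ⟨hk₂, h33₂⟩
  have hE₂ := hEτ.keeps hk₂ (by norm_num) (by simp)
  have hkk : Keeps 16 [7] σ τ₂ := hk.trans (hk₂.weaken (by norm_num) (by simp))
  have hO₂ := hO.keeps hkk (by norm_num) (by simp)
  have e13 : τ₂.reg 13 = σ.reg 13 := hkk.1 13 (by norm_num)
  have hst₂ : ∀ y, τ₂.arr 7 y ≤ τ₂.reg 26 := by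
    rw [hk₂.2 7 (by simp), hk₂.1 26 (by norm_num)]
    exact hst₁
  refine Runs.ite (fun hb => ?_) (fun hb => ?_)
  · simp [hE₂.reg_zero, h33₂] at hb
    refine (appendOutput_runs hE₂ (by rw [hkk.1 15 (by norm_num), h15])
      (Finset.mem_filter.1 hxZ).1 hb hO₂ hxO (by rwa [e13])).mono ?_
    rintro υ ⟨hkυ, h14, h26, hP⟩
    refine ⟨(hkk.weaken (by norm_num) (by simp)).trans (hkυ.weaken le_rfl (by simp)), ?_, ?_, ?_⟩
    · rw [h14, hkk.1 14 (by norm_num)]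
    · rw [h26, hkυ.2 7 (by simp)]
      exact hst₂
    · rwa [Processed, ← e13]
  · simp [hE₂.reg_zero, h33₂] at hb
    exact Runs.skip ⟨hkk.weaken (by norm_num) (by simp), hkk.1 14 (by norm_num), hst₂,
      Or.inl ⟨hO₂, e13, fun h => absurd h hb⟩⟩

theorem selectBody_runs {σ : State} (hE : Env F ps k r ν D pw σ) (hν : 0 < ν)
    (hps : ∀ l ∈ ps, l.Nodup) {q : ℕ} (h11 : σ.reg 11 = q) (hq : q ≤ pw)
    (hst : ∀ y, σ.arr 7 y ≤ σ.reg 26)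
    (hZ : ∀ y ∈ F.vars, σ.arr 6 y = 1 ↔ y ∈ heavyOf F ps k r q) {i : ℕ}
    (hi : i < (occurrences F).length) (h14 : σ.reg 14 = i) {O : List ℕ} (hO : OutState F O σ)
    (h13 : σ.reg 13 ≤ pw) :
    Runs selectBody σ (scanCost ps.length pw F.size + 4 * k + 17) fun σ' =>
      Keeps 12 [7, 8, 9] σ σ' ∧ σ'.reg 14 = i + 1 ∧ (∀ y, σ'.arr 7 y ≤ σ'.reg 26) ∧
      Processed F pw (occurrences F)[i] (candidates F ps k r ν D q) O σ σ' := by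
  set x := (occurrences F)[i] with hx
  have hxF : x ∈ F.vars := mem_occurrences.1 (List.getElem_mem hi)
  have h1 : σ.arr 1 i = x := by
    rw [hE.arr1, ofList, List.getD_eq_getElem?_getD]
    change ((occurrences F)[i]?).getD 0 = x
    rw [List.getElem?_eq_getElem hi, hx]
    rfl
  refine Runs.of_le (N := scanCost ps.length pw F.size + 4 * k + 14 + 1 + 1 + 1) ?_ (by omega)
  refine Runs.load_seq (Runs.load_seq (Runs.load_seq ?_))
  simp [h14, hE.reg_zero, h1]
  set τ := ((σ.setReg 15 x).setReg 35 (σ.arr 6 x)).setReg 36 (σ.arr 8 x) with hτ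
  have hk₀ : Keeps 15 [] σ τ :=
    (((Keeps.refl _ _ _).setReg (by norm_num)).setReg (by norm_num)).setReg (by norm_num)
  have hE₀ := hE.keeps hk₀ (by norm_num) (by simp)
  have hO₀ := hO.keeps hk₀ (by norm_num) (by simp)
  have h35 : τ.reg 35 = 1 ↔ x ∈ heavyOf F ps k r q := by
    rw [← hZ x hxF]
    simp [τ]
  have h36 : τ.reg 36 = 1 ↔ x ∈ O := by
    rw [← hO.flag]
    simp [τ]
  have h26 : τ.reg 26 = σ.reg 26 := by simp [τ]
  have e13 : τ.reg 13 = σ.reg 13 := by simp [τ]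
  have hst₀ : ∀ y, τ.arr 7 y ≤ τ.reg 26 := by
    rw [h26]
    exact hst
  refine Runs.seq_mid (scanCost ps.length pw F.size + 4 * k + 13) 1 le_rfl (fun σ' =>
    Keeps 12 [7, 8, 9] σ σ' ∧ σ'.reg 14 = i ∧ (∀ y, σ'.arr 7 y ≤ σ'.reg 26) ∧
      Processed F pw x (candidates F ps k r ν D q) O σ σ') ?_ ?_
  · have hskip : (x ∈ candidates F ps k r ν D q → x ∈ O) → Keeps 12 [7, 8, 9] σ τ ∧
        τ.reg 14 = i ∧ (∀ y, τ.arr 7 y ≤ τ.reg 26) ∧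
        Processed F pw x (candidates F ps k r ν D q) O σ τ := fun h =>
      ⟨hk₀.weaken (by norm_num) (by simp), by rw [hk₀.1 14 (by norm_num), h14], hst₀,
        Or.inl ⟨hO₀, e13, fun h' => Or.inl (h h')⟩⟩
    refine Runs.ite (fun hb => ?_) (fun hb => ?_)
    · simp only [eval_eq, hE₀.reg_one, h35, decide_eq_true_eq] at hb
      refine Runs.ite (fun hc => ?_) (fun hc => ?_)
      · simp only [eval_eq, hE₀.reg_one, h36, decide_eq_true_eq] at hc
        exact Runs.skip (hskip fun _ => hc)
      · simp only [eval_eq, hE₀.reg_one, h36, decide_eq_false_iff_not] at hc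
        refine (testSegments_runs hE₀ hν hps (by rw [hk₀.1 11 (by norm_num), h11]) hq hst₀ hZ
          (by simp [τ]) hb hO₀ hc (by rwa [e13])).mono ?_
        rintro υ ⟨hkυ, h14', hstυ, hP⟩
        exact ⟨(hk₀.weaken (by norm_num) (by simp)).trans hkυ,
          by rw [h14', hk₀.1 14 (by norm_num), h14], hstυ, by rwa [Processed, ← e13]⟩
    · simp only [eval_eq, hE₀.reg_one, h35, decide_eq_false_iff_not] at hb
      exact Runs.skip (hskip fun h => absurd (Finset.mem_filter.1 h).1 hb)
  · rintro υ ⟨hkυ, h14', hstυ, hP⟩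
    refine Runs.succ ⟨hkυ.setReg (by norm_num), by simp [h14'], by simpa using hstυ, ?_⟩
    refine hP.imp (fun ⟨h1, h2, h3⟩ => ⟨⟨?_, ?_, ?_, h1.sub⟩, ?_, h3⟩)
      (fun ⟨h1, h2, h3⟩ => ⟨⟨?_, ?_, ?_, h1.sub⟩, ?_, h3⟩)
    · simpa using h1.len
    · simpa using h1.cell
    · simpa using h1.flag
    · simpa using h2
    · simpa using h1.len
    · simpa using h1.cell
    · simpa using h1.flag
    · simpa using h2

end Collect

/-! ### The loops over all literals and all selections -/

section Collect

open Classical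

variable {F : CNF} {ps : List (List F.IncVertex)} {k r ν D pw : ℕ}

theorem mem_heavyOf {q x : ℕ} (hx : x ∈ F.vars) :
    x ∈ heavyOf F ps k r q ↔ r ≤ 4 * k * touchSum F ps q x := by
  simp [heavyOf, hx]

theorem Env.reg_occurrences {σ : State} (hE : Env F ps k r ν D pw σ) :
    σ.reg 9 = (occurrences F).length := by rw [hE.reg_len, length_occurrences]

/-- The first loop over all literals marks the heavy variables. -/
theorem markLoop_runs {σ : State} (hE : Env F ps k r ν D pw σ) (hν : 0 < ν)
    (hps : ∀ l ∈ ps, l.Nodup) {q : ℕ} (h11 : σ.reg 11 = q) (hq : q ≤ pw)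
    (hst : ∀ y, σ.arr 7 y ≤ σ.reg 26) (h14 : σ.reg 14 = 0) :
    Runs (.while (.lt 14 9) markBody) σ
      ((occurrences F).length * (scanCost ps.length pw F.size + 8 * k + 11) + 1) fun σ' =>
      Keeps 14 [6, 7] σ σ' ∧ (∀ y, σ'.arr 7 y ≤ σ'.reg 26) ∧
      ∀ y ∈ F.vars, σ'.arr 6 y = 1 ↔ y ∈ heavyOf F ps k r q := by
  refine Runs.mono (Runs.while_uniform (fun i σ' => Keeps 14 [6, 7] σ σ' ∧ σ'.reg 14 = i ∧
    (∀ y, σ'.arr 7 y ≤ σ'.reg 26) ∧ ∀ j, (hj : j < (occurrences F).length) → j < i →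
      (σ'.arr 6 (occurrences F)[j] = 1 ↔ (occurrences F)[j] ∈ heavyOf F ps k r q))
    (occurrences F).length (scanCost ps.length pw F.size + 8 * k + 10) ?_ ?_ ?_) ?_
  · exact ⟨Keeps.refl _ _ _, h14, hst, fun j _ hj => absurd hj (Nat.not_lt_zero j)⟩
  · rintro i hi σ' ⟨hk, h14', hst', hm⟩
    have hE' := hE.keeps hk (by norm_num) (by simp)
    have h11' : σ'.reg 11 = q := by rw [hk.1 11 (by norm_num), h11]
    refine ⟨by simp [h14', hE'.reg_occurrences, hi], ?_⟩
    refine (markBody_runs hE' hν hps (h11'.le.trans hq) hst' hi h14').mono ?_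
    rintro υ ⟨hkυ, h14υ, hstυ, hnew, hold⟩
    refine ⟨hk.trans hkυ, h14υ, hstυ, fun j hj hji => ?_⟩
    rw [h11'] at hnew
    by_cases he : (occurrences F)[j] = (occurrences F)[i]
    · rw [he, hnew, mem_heavyOf (mem_occurrences.1 (List.getElem_mem hi))]
    · have hne : j ≠ i := fun h => he (by subst h; rfl)
      rw [hold _ he, hm j hj (by omega)]
  · rintro σ' ⟨hk, h14', -⟩
    have hE' := hE.keeps hk (by norm_num) (by simp)
    simp [h14', hE'.reg_occurrences]
  · rintro σ' ⟨hk, -, hst', hm⟩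
    refine ⟨hk, hst', fun y hy => ?_⟩
    obtain ⟨j, hj, rfl⟩ := List.getElem_of_mem (mem_occurrences.2 hy)
    exact hm j hj hj

/-- The second loop over all literals collects the candidates, provided that there are at most
`pw`. -/
theorem selectLoop_runs {σ : State} (hE : Env F ps k r ν D pw σ) (hν : 0 < ν)
    (hps : ∀ l ∈ ps, l.Nodup) {q : ℕ} (h11 : σ.reg 11 = q) (hq : q ≤ pw)
    (hst : ∀ y, σ.arr 7 y ≤ σ.reg 26)
    (hZ : ∀ y ∈ F.vars, σ.arr 6 y = 1 ↔ y ∈ heavyOf F ps k r q) (h13 : σ.reg 13 = 0)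
    (h14 : σ.reg 14 = 0) {O : List ℕ} (hO : OutState F O σ) :
    Runs (.while (.lt 14 9) selectBody) σ
      ((occurrences F).length * (scanCost ps.length pw F.size + 4 * k + 18) + 1) fun σ' =>
      Keeps 12 [7, 8, 9] σ σ' ∧ (∀ y, σ'.arr 7 y ≤ σ'.reg 26) ∧
      ∃ O', OutState F O' σ' ∧ O ⊆ O' ∧ O'.length ≤ O.length + pw ∧
        ((candidates F ps k r ν D q).card ≤ pw → ∀ y ∈ candidates F ps k r ν D q, y ∈ O') := by
  set R := candidates F ps k r ν D q with hR
  refine Runs.mono (Runs.while_uniform (fun i σ' => Keeps 12 [7, 8, 9] σ σ' ∧ σ'.reg 14 = i ∧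
    (∀ y, σ'.arr 7 y ≤ σ'.reg 26) ∧ ∃ (O' : List ℕ) (N : Finset ℕ), OutState F O' σ' ∧ O ⊆ O' ∧
      O'.length = O.length + σ'.reg 13 ∧ σ'.reg 13 ≤ pw ∧ N.card = σ'.reg 13 ∧ N ⊆ R ∧
      (∀ y ∈ N, y ∈ O') ∧ ∀ j, (hj : j < (occurrences F).length) → j < i →
        (occurrences F)[j] ∈ R → (occurrences F)[j] ∈ O' ∨ σ'.reg 13 = pw)
    (occurrences F).length (scanCost ps.length pw F.size + 4 * k + 17) ?_ ?_ ?_) ?_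
  · refine ⟨Keeps.refl _ _ _, h14, hst, O, ∅, hO, fun _ h => h, ?_, ?_, ?_, ?_, ?_, ?_⟩
    · rw [h13, add_zero]
    · omega
    · simp [h13]
    · simp
    · simp
    · exact fun j _ hj => absurd hj (Nat.not_lt_zero j)
  · rintro i hi σ' ⟨hk, h14', hst', O', N, hO', hsub, hlen, h13', hN, hNR, hNO, hold⟩
    have hE' := hE.keeps hk (by norm_num) (by simp)
    have h11' : σ'.reg 11 = q := by rw [hk.1 11 (by norm_num), h11]
    refine ⟨by simp [h14', hE'.reg_occurrences, hi], ?_⟩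
    have hZ' : ∀ y ∈ F.vars, σ'.arr 6 y = 1 ↔ y ∈ heavyOf F ps k r q := by
      rw [hk.2 6 (by simp)]
      exact hZ
    refine (selectBody_runs hE' hν hps h11' hq hst' hZ' hi h14' hO' h13').mono ?_
    rintro υ ⟨hkυ, h14υ, hstυ, hP⟩
    refine ⟨hk.trans hkυ, h14υ, hstυ, ?_⟩
    rcases hP with ⟨hOυ, e13, hnew⟩ | ⟨hOυ, e13, hlt, hxR, hxO⟩
    · refine ⟨O', N, hOυ, hsub, by rw [e13, hlen], by rwa [e13], by rw [e13, hN], hNR, hNO,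
        fun j hj hji hjR => ?_⟩
      rw [e13]
      rcases Nat.lt_succ_iff_lt_or_eq.1 hji with h | rfl
      · exact hold j hj h hjR
      · exact hnew hjR
    · set x := (occurrences F)[i] with hx
      have hxN : x ∉ N := fun h => hxO (hNO x h)
      refine ⟨O' ++ [x], insert x N, hOυ, fun y hy => List.mem_append_left _ (hsub hy), ?_, ?_, ?_,
        ?_, ?_, fun j hj hji hjR => ?_⟩
      · rw [List.length_append, hlen, e13, List.length_singleton, add_assoc]
      · omega
      · rw [Finset.card_insert_of_notMem hxN, hN, e13]
      · exact Finset.insert_subset hxR hNR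
      · intro y hy
        rcases Finset.mem_insert.1 hy with rfl | h
        · simp
        · exact List.mem_append_left _ (hNO y h)
      · left
        rcases Nat.lt_succ_iff_lt_or_eq.1 hji with h | rfl
        · exact List.mem_append_left _ ((hold j hj h hjR).resolve_right hlt.ne)
        · simp [x]
  · rintro σ' ⟨hk, h14', -⟩
    have hE' := hE.keeps hk (by norm_num) (by simp)
    simp [h14', hE'.reg_occurrences]
  · rintro σ' ⟨hk, -, hst', O', N, hO', hsub, hlen, h13', hN, hNR, hNO, hold⟩
    refine ⟨hk, hst', O', hO', hsub, by omega, fun hcard y hy => ?_⟩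
    obtain ⟨j, hj, rfl⟩ := List.getElem_of_mem
      (mem_occurrences.2 (Finset.mem_filter.1 (Finset.mem_filter.1 hy).1).1)
    rcases hold j hj hj hy with h | h
    · exact h
    · -- all candidates have been appended
      have hNeq : N = R := Finset.eq_of_subset_of_card_le hNR (by omega)
      exact hNO _ (hNeq ▸ hy)

/-- A bound on the number of steps for one selection of pieces. -/
def roundCost (P pw S L k : ℕ) : ℕ := 2 * (L * (scanCost P pw S + 8 * k + 18)) + 7

theorem collect_runs {σ : State} (hE : Env F ps k r ν D pw σ) (hν : 0 < ν)
    (hps : ∀ l ∈ ps, l.Nodup) (h11 : σ.reg 11 = 0) (hst : ∀ y, σ.arr 7 y ≤ σ.reg 26)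
    (hO : OutState F [] σ) :
    Runs collect σ (pw * roundCost ps.length pw F.size (occurrences F).length k + 1) fun σ' =>
      Keeps 11 [6, 7, 8, 9] σ σ' ∧ ∃ O, OutState F O σ' ∧ O.length ≤ pw * pw ∧
        ∀ q < pw, (candidates F ps k r ν D q).card ≤ pw →
          ∀ y ∈ candidates F ps k r ν D q, y ∈ O := by
  set L := (occurrences F).length with hL
  set c := scanCost ps.length pw F.size with hc
  refine Runs.mono (Runs.while_uniform (fun q σ' => Keeps 11 [6, 7, 8, 9] σ σ' ∧ σ'.reg 11 = q ∧
    (∀ y, σ'.arr 7 y ≤ σ'.reg 26) ∧ ∃ O, OutState F O σ' ∧ O.length ≤ q * pw ∧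
      ∀ q' < q, (candidates F ps k r ν D q').card ≤ pw →
        ∀ y ∈ candidates F ps k r ν D q', y ∈ O) pw (2 * (L * (c + 8 * k + 18)) + 6) ?_ ?_ ?_) ?_
  · exact ⟨Keeps.refl _ _ _, h11, hst, [], hO, by simp, fun q hq => absurd hq (Nat.not_lt_zero q)⟩
  · rintro q hq σ₁ ⟨hk, h11', hst', O, hO', hlen, hold⟩
    have hE' := hE.keeps hk (by norm_num) (by simp)
    refine ⟨by simp [h11', hE'.reg_pw, hq], ?_⟩
    refine Runs.of_le (N := (L * (c + 8 * k + 11) + 1) + ((L * (c + 4 * k + 18) + 1) + 1 + 1 + 1) + 1)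
      (Runs.const_seq ?_) ?_
    swap
    · have h1 : L * (c + 8 * k + 11) ≤ L * (c + 8 * k + 18) := Nat.mul_le_mul_left _ (by omega)
      have h2 : L * (c + 4 * k + 18) ≤ L * (c + 8 * k + 18) := Nat.mul_le_mul_left _ (by omega)
      omega
    have hk₀ : Keeps 14 [] σ₁ (σ₁.setReg 14 0) := (Keeps.refl _ _ _).setReg (by norm_num)
    refine Runs.seq_mid _ _ le_rfl _ (markLoop_runs (hE'.keeps hk₀ (by norm_num) (by simp)) hν hps
      (q := q) (by simpa using h11') hq.le (by simpa using hst') (by simp)) ?_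
    rintro σ₂ ⟨hk₂, hst₂, hm⟩
    refine Runs.const_seq (Runs.const_seq ?_)
    have hkk₂ : Keeps 14 [6, 7] σ₁ σ₂ := (hk₀.weaken le_rfl (by simp)).trans hk₂
    have hkk₃ : Keeps 13 [6, 7] σ₁ ((σ₂.setReg 13 0).setReg 14 0) :=
      ((hkk₂.weaken (by norm_num) (by simp)).setReg (by norm_num)).setReg (by norm_num)
    refine Runs.seq_mid _ 1 le_rfl _ (selectLoop_runs (hE'.keeps hkk₃ (by norm_num) (by simp)) hν hps
      (q := q) (by rw [hkk₃.1 11 (by norm_num), h11']) hq.le (by simpa using hst₂)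
      (by simpa using hm) (by simp) (by simp) (hO'.keeps hkk₃ (by norm_num) (by simp))) ?_
    rintro σ₃ ⟨hk₃, hst₃, O', hOO, hsub, hlen', hR⟩
    have hkk : Keeps 12 [6, 7, 8, 9] σ₁ σ₃ := (hkk₃.weaken (by norm_num) (by simp)).trans
      (hk₃.weaken le_rfl (by simp))
    refine Runs.succ ⟨hk.trans ((hkk.weaken (by norm_num) (by simp)).setReg (by norm_num)), ?_,
      by simpa using hst₃, O', ⟨by simpa using hOO.len, by simpa using hOO.cell,
        by simpa using hOO.flag, hOO.sub⟩, ?_, fun q' hq' hcard y hy => ?_⟩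
    · simp [hkk.1 11 (by norm_num), h11']
    · rw [add_mul, one_mul]
      omega
    · rcases Nat.lt_succ_iff_lt_or_eq.1 hq' with h | rfl
      · exact hsub (hold q' h hcard y hy)
      · exact hR hcard y hy
  · rintro σ' ⟨hk, h11', -⟩
    have hE' := hE.keeps hk (by norm_num) (by simp)
    simp [h11', hE'.reg_pw]
  · rintro σ' ⟨hk, -, -, h⟩
    exact ⟨hk, h⟩

/-- Copies the collected variables to the output. -/
def copyOut : Prog :=
  .const 14 0 ;; .while (.lt 14 12) (.load 15 9 14 10 ;; .store 0 14 10 15 ;; .succ 14 14) ;;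
  .copy 0 12

theorem copyOut_runs {σ : State} (h10 : σ.reg 10 = 0) {O : List ℕ} (hO : OutState F O σ) :
    Runs copyOut σ (O.length * 4 + 3) fun σ' => σ'.output = O := by
  refine Runs.const_seq ?_
  refine Runs.seq_mid (O.length * 4 + 1) 1 le_rfl _ (Runs.while_uniform (fun i σ' =>
    Keeps 14 [0] σ σ' ∧ σ'.reg 14 = i ∧ ∀ j, (hj : j < O.length) → j < i → σ'.arr 0 j = O[j])
    O.length 3 ?_ ?_ ?_) ?_
  · exact ⟨(Keeps.refl _ _ _).setReg (by norm_num), by simp,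
      fun j _ hj => absurd hj (Nat.not_lt_zero j)⟩
  · rintro i hi σ' ⟨hk, h14, hold⟩
    have h12 : σ'.reg 12 = O.length := by rw [hk.1 12 (by norm_num), hO.len]
    have h10' : σ'.reg 10 = 0 := by rw [hk.1 10 (by norm_num), h10]
    have h9 : σ'.arr 9 i = O[i] := by rw [hk.2 9 (by simp), hO.cell i hi]
    refine ⟨by simp [h14, h12, hi], Runs.load_seq (Runs.store_seq (Runs.succ ⟨?_, by simp [h14],
      fun j hj hji => ?_⟩))⟩
    · exact ((hk.setReg (by norm_num)).setArr (by simp)).setReg (by norm_num)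
    · rcases Nat.lt_succ_iff_lt_or_eq.1 hji with h | rfl
      · have hne : j ≠ i := by omega
        simp [h14, h10', hne, hold j hj h]
      · simp [h14, h10', h9]
  · rintro σ' ⟨hk, h14, -⟩
    have h12 : σ'.reg 12 = O.length := by rw [hk.1 12 (by norm_num), hO.len]
    simp [h14, h12]
  · rintro σ' ⟨hk, -, h⟩
    have h12 : σ'.reg 12 = O.length := by rw [hk.1 12 (by norm_num), hO.len]
    refine Runs.copy ?_
    rw [State.output]
    refine List.ext_getElem (by simp [h12]) fun j h1 h2 => ?_
    simp [h j h2 h2]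

end Collect

/-! ### Setting up the memory -/

/-- Adds `2 r ^ 2` to register `5`. -/
def countPieces : Prog :=
  .while (.lt 16 2) <|
    .const 17 0 ;; .while (.lt 17 2) (.succ 5 5 ;; .succ 5 5 ;; .succ 17 17) ;; .succ 16 16

/-- Computes `2 ^ (P + 1)` in register `6`, where `P` is held by register `5`. -/
def powerOfTwo : Prog :=
  .const 6 2 ;; .const 16 0 ;;
  .while (.lt 16 5) (.copy 18 6 ;; .const 17 0 ;;
    .while (.lt 17 18) (.succ 6 6 ;; .succ 17 17) ;; .succ 16 16)

/-- Adds `2 t` to register `7` and `4 t + 2 k` to register `8`. -/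
def thresholds : Prog :=
  .const 16 0 ;;
  .while (.lt 16 1) (.succ 7 7 ;; .succ 7 7 ;; .succ 8 8 ;; .succ 8 8 ;; .succ 8 8 ;; .succ 8 8 ;;
    .succ 16 16) ;;
  .const 16 0 ;; .while (.lt 16 0) (.succ 8 8 ;; .succ 8 8 ;; .succ 16 16)

/-- Outputs the first variable of the formula. -/
def firstVariable : Prog := .load 15 1 10 10 ;; .store 0 10 10 15 ;; .const 0 1

/-- The program computing a set of variables that meets all small strong backdoor sets. -/
def backdoorProg : Prog :=
  .const 4 1 ;;
  .ite (.lt 10 1)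
    (.load 9 0 3 10 ;; countPieces ;; powerOfTwo ;; thresholds ;; collect ;; copyOut) firstVariable

/-- `σ'` differs from `σ` only in the registers belonging to `X`. -/
def Only (X : List ℕ) (σ σ' : State) : Prop := σ'.arr = σ.arr ∧ ∀ y, y ∉ X → σ'.reg y = σ.reg y

namespace Only

variable {X Y : List ℕ} {σ σ₁ σ₂ : State}

theorem refl (X : List ℕ) (σ : State) : Only X σ σ := ⟨rfl, fun _ _ => rfl⟩

theorem trans (h : Only X σ σ₁) (h' : Only X σ₁ σ₂) : Only X σ σ₂ :=
  ⟨h'.1.trans h.1, fun y hy => (h'.2 y hy).trans (h.2 y hy)⟩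

theorem weaken (h : Only X σ σ₁) (hX : X ⊆ Y) : Only Y σ σ₁ :=
  ⟨h.1, fun y hy => h.2 y fun h' => hy (hX h')⟩

theorem setReg (h : Only X σ σ₁) {x v : ℕ} (hx : x ∈ X) : Only X σ (σ₁.setReg x v) :=
  ⟨h.1, fun y hy => by rw [reg_setReg, if_neg (fun e : y = x => hy (e ▸ hx)), h.2 y hy]⟩

end Only

section Setup

variable {σ : State} {k t r P : ℕ}

theorem countPieces_runs (h2 : σ.reg 2 = r) (h5 : σ.reg 5 = 0) (h16 : σ.reg 16 = 0) :
    Runs countPieces σ (r * (4 * r + 4) + 1) fun σ' => Only [5, 16, 17] σ σ' ∧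
      σ'.reg 5 = 2 * (r * r) := by
  refine Runs.mono (Runs.while_uniform (fun i σ' => Only [5, 16, 17] σ σ' ∧ σ'.reg 16 = i ∧
    σ'.reg 5 = 2 * (i * r)) r (4 * r + 3) ?_ ?_ ?_) ?_
  · exact ⟨Only.refl _ _, h16, by simp [h5]⟩
  · rintro i hi τ ⟨hk, h16', h5'⟩
    have h2' : τ.reg 2 = r := by rw [hk.2 2 (by simp), h2]
    refine ⟨by simp [h16', h2', hi], Runs.const_seq ?_⟩
    refine Runs.seq_mid (r * 4 + 1) 1 (by omega) _ (Runs.while_uniform (fun j υ =>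
      Only [5, 16, 17] σ υ ∧ υ.reg 16 = i ∧ υ.reg 17 = j ∧ υ.reg 5 = 2 * (i * r) + 2 * j) r 3
      ?_ ?_ ?_) ?_
    · exact ⟨hk.setReg (by simp), by simp [h16'], by simp, by simp [h5']⟩
    · rintro j hj υ ⟨hk', h16', h17', h5'⟩
      have h2' : υ.reg 2 = r := by rw [hk'.2 2 (by simp), h2]
      refine ⟨by simp [h17', h2', hj], Runs.succ_seq (Runs.succ_seq (Runs.succ ⟨?_, by simp [h16'],
        by simp [h17'], ?_⟩))⟩
      · exact ((hk'.setReg (by simp)).setReg (by simp)).setReg (by simp)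
      · simp [h5']
        ring
    · rintro υ ⟨hk', -, h17', -⟩
      simp [h17', hk'.2 2 (by simp), h2]
    · rintro υ ⟨hk', h16', -, h5'⟩
      refine Runs.succ ⟨hk'.setReg (by simp), by simp [h16'], ?_⟩
      simp [h5']
      ring
  · rintro τ ⟨hk, h16', -⟩
    simp [h16', hk.2 2 (by simp), h2]
  · rintro τ ⟨hk, -, h⟩
    exact ⟨hk, h⟩

theorem powerOfTwo_runs (h5 : σ.reg 5 = P) :
    Runs powerOfTwo σ (P * (3 * 2 ^ P + 5) + 3) fun σ' => Only [6, 16, 17, 18] σ σ' ∧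
      σ'.reg 6 = 2 ^ (P + 1) := by
  refine Runs.const_seq (Runs.const_seq ?_)
  refine Runs.mono (Runs.while_uniform (fun i σ' => Only [6, 16, 17, 18] σ σ' ∧ σ'.reg 16 = i ∧
    σ'.reg 6 = 2 ^ (i + 1)) P (3 * 2 ^ P + 4) ?_ ?_ ?_) ?_
  · exact ⟨((Only.refl _ _).setReg (by simp)).setReg (by simp), by simp, by simp⟩
  · rintro i hi τ ⟨hk, h16', h6'⟩
    have h5' : τ.reg 5 = P := by rw [hk.2 5 (by simp), h5]
    have hle : 2 ^ (i + 1) ≤ 2 ^ P := Nat.pow_le_pow_right (by norm_num) hi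
    refine ⟨by simp [h16', h5', hi], ?_⟩
    refine Runs.of_le (N := 3 * 2 ^ (i + 1) + 4) ?_ (by omega)
    refine Runs.copy_seq (Runs.const_seq ?_)
    refine Runs.seq_mid (2 ^ (i + 1) * 3 + 1) 1 (by omega) _ (Runs.while_uniform (fun j υ =>
      Only [6, 16, 17, 18] σ υ ∧ υ.reg 16 = i ∧ υ.reg 17 = j ∧ υ.reg 18 = 2 ^ (i + 1) ∧
      υ.reg 6 = 2 ^ (i + 1) + j) (2 ^ (i + 1)) 2 ?_ ?_ ?_) ?_
    · exact ⟨(hk.setReg (by simp)).setReg (by simp), by simp [h16'], by simp, by simp [h6'],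
        by simp [h6']⟩
    · rintro j hj υ ⟨hk', h16', h17', h18', h6'⟩
      refine ⟨by simp [h17', h18', hj], Runs.succ_seq (Runs.succ ⟨?_, by simp [h16'],
        by simp [h17'], by simp [h18'], by simp [h6', add_assoc]⟩)⟩
      exact (hk'.setReg (by simp)).setReg (by simp)
    · rintro υ ⟨hk', -, h17', h18', -⟩
      simp [h17', h18']
    · rintro υ ⟨hk', h16', -, -, h6'⟩
      refine Runs.succ ⟨hk'.setReg (by simp), by simp [h16'], ?_⟩
      simp [h6']
      ring
  · rintro τ ⟨hk, h16', -⟩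
    simp [h16', hk.2 5 (by simp), h5]
  · rintro τ ⟨hk, -, h⟩
    exact ⟨hk, h⟩

theorem thresholds_runs (h0 : σ.reg 0 = k) (h1 : σ.reg 1 = t) (h7 : σ.reg 7 = 0)
    (h8 : σ.reg 8 = 0) : Runs thresholds σ (8 * t + 4 * k + 4) fun σ' => Only [7, 8, 16] σ σ' ∧
      σ'.reg 7 = 2 * t ∧ σ'.reg 8 = 4 * t + 2 * k := by
  refine Runs.of_le (N := 8 * t + 4 * k + 3 + 1) (Runs.const_seq ?_) le_rfl
  refine Runs.seq_mid (t * 8 + 1) (4 * k + 2) (by omega) _ (Runs.while_uniform (fun i σ' =>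
    Only [7, 8, 16] σ σ' ∧ σ'.reg 16 = i ∧ σ'.reg 7 = 2 * i ∧ σ'.reg 8 = 4 * i) t 7 ?_ ?_ ?_) ?_
  · exact ⟨(Only.refl _ _).setReg (by simp), by simp, by simp [h7], by simp [h8]⟩
  · rintro i hi τ ⟨hk, h16', h7', h8'⟩
    refine ⟨by simp [h16', hk.2 1 (by simp), h1, hi], Runs.succ_seq (Runs.succ_seq (Runs.succ_seq
      (Runs.succ_seq (Runs.succ_seq (Runs.succ_seq (Runs.succ ⟨?_, by simp [h16'], ?_, ?_⟩))))))⟩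
    · repeat (first | exact hk | refine Only.setReg ?_ (by simp))
    · simp [h7']
      ring
    · simp [h8']
      ring
  · rintro τ ⟨hk, h16', -⟩
    simp [h16', hk.2 1 (by simp), h1]
  rintro τ ⟨hk, -, h7', h8'⟩
  refine Runs.of_le (N := k * 4 + 1 + 1) (Runs.const_seq ?_) (by omega)
  refine Runs.mono (Runs.while_uniform (fun i σ' => Only [7, 8, 16] σ σ' ∧ σ'.reg 16 = i ∧
    σ'.reg 7 = 2 * t ∧ σ'.reg 8 = 4 * t + 2 * i) k 3 ?_ ?_ ?_) ?_
  · exact ⟨hk.setReg (by simp), by simp, by simp [h7'], by simp [h8']⟩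
  · rintro i hi τ ⟨hk, h16', h7', h8'⟩
    refine ⟨by simp [h16', hk.2 0 (by simp), h0, hi], Runs.succ_seq (Runs.succ_seq
      (Runs.succ ⟨?_, by simp [h16'], by simp [h7'], ?_⟩))⟩
    · repeat (first | exact hk | refine Only.setReg ?_ (by simp))
    · simp [h8']
      ring
  · rintro τ ⟨hk, h16', -⟩
    simp [h16', hk.2 0 (by simp), h0]
  · rintro τ ⟨hk, -, h⟩
    exact ⟨hk, h⟩

/-- A bound on the number of steps before the collection of the candidates. -/
def setupCost (k t r P : ℕ) : ℕ :=
  r * (4 * r + 4) + P * (3 * 2 ^ P + 5) + 8 * t + 4 * k + 20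

/-- A bound on the number of steps of the program, divided by the square of the size of the
formula. -/
def totalCost (k t r P pw : ℕ) : ℕ :=
  setupCost k t r P + pw * (2 * (P * (2 * pw + 32) + (8 * k + 24)) + 7) + 1 + (pw * pw * 4 + 3)

theorem roundCost_le {P pw S L k : ℕ} (hS : 1 ≤ S) (hL : L ≤ S) :
    roundCost P pw S L k ≤ (2 * (P * (2 * pw + 32) + (8 * k + 24)) + 7) * S ^ 2 := by
  have h1 : P * (2 * pw + 17 * S + 15) + 6 + 8 * k + 18 ≤
      (P * (2 * pw + 32) + (8 * k + 24)) * S := by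
    have h2 : 2 * pw + 17 * S + 15 ≤ (2 * pw + 32) * S := by nlinarith [Nat.le_mul_of_pos_right pw hS]
    have h3 : P * (2 * pw + 17 * S + 15) ≤ P * ((2 * pw + 32) * S) := Nat.mul_le_mul_left _ h2
    have h4 : 8 * k + 24 ≤ (8 * k + 24) * S := Nat.le_mul_of_pos_right _ hS
    calc _ = P * (2 * pw + 17 * S + 15) + (8 * k + 24) := by ring
      _ ≤ P * ((2 * pw + 32) * S) + (8 * k + 24) * S := add_le_add h3 h4
      _ = _ := by ring
  have h5 : L * (P * (2 * pw + 17 * S + 15) + 6 + 8 * k + 18) ≤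
      S * ((P * (2 * pw + 32) + (8 * k + 24)) * S) := Nat.mul_le_mul hL h1
  have h6 : 1 ≤ S ^ 2 := Nat.one_le_pow _ _ hS
  calc roundCost P pw S L k = 2 * (L * (P * (2 * pw + 17 * S + 15) + 6 + 8 * k + 18)) + 7 := rfl
    _ ≤ 2 * (S * ((P * (2 * pw + 32) + (8 * k + 24)) * S)) + 7 * S ^ 2 := by omega
    _ = _ := by ring

end Setup

end RAM

/-! ### The run of the program -/

section Main

open Classical RAM

variable {F : CNF} {k t r : ℕ}

theorem length_occurrences_le_size (F : CNF) : (occurrences F).length ≤ F.size := by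
  rw [length_occurrences, List.length_flatten, CNF.size]
  refine le_trans (List.sum_le_sum fun c _ => ?_) (Nat.le_add_left _ _)
  omega

/-- For `t ≥ 1`, the output contains the candidates for all selections with few candidates. -/
theorem backdoorProg_runs_of_pos (ht : 1 ≤ t) (M : TopologicalModel (wall r) F.inc)
    (hF : 1 ≤ F.size) :
    Runs backdoorProg (inputState k t F M)
      (totalCost k t r (2 * (r * r)) (2 ^ (2 * (r * r) + 1)) * F.size ^ 2) fun σ =>
      σ.output.length ≤ 2 ^ (2 * (r * r) + 1) * 2 ^ (2 * (r * r) + 1) ∧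
      σ.output.toFinset ⊆ F.vars ∧
      ∀ q < 2 ^ (2 * (r * r) + 1),
        (candidates F (wallPaths M) k r (2 * t) (4 * t + 2 * k) q).card ≤ 2 ^ (2 * (r * r) + 1) →
        candidates F (wallPaths M) k r (2 * t) (4 * t + 2 * k) q ⊆ σ.output.toFinset := by
  have hP : (wallPaths M).length = 2 * (r * r) := by
    rw [wallPaths_eq_map_piece, List.length_map, length_wallLabels]
  set P := 2 * (r * r) with hPdef
  set pw := 2 ^ (P + 1) with hpw
  have hps : ∀ l ∈ wallPaths M, l.Nodup := by
    rw [wallPaths_eq_map_piece]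
    intro l hl
    obtain ⟨e, -, rfl⟩ := List.mem_map.1 hl
    exact nodup_piece e
  set σ := inputState k t F M with hσ
  have h0 : σ.reg 0 = k := rfl
  have h1 : σ.reg 1 = t := rfl
  have h2 : σ.reg 2 = r := rfl
  have h3 : σ.reg 3 = F.clauses.length := rfl
  have hz : ∀ y, 4 ≤ y → σ.reg y = 0 := fun y hy => by
    change ([k, t, r, F.clauses.length].getD y 0) = 0
    exact List.getD_eq_default _ _ (by simpa using hy)
  have ha : ∀ a, 6 ≤ a → ∀ y, σ.arr a y = 0 := fun a ha y => by
    obtain ⟨b, rfl⟩ : ∃ b, a = b + 6 := ⟨a - 6, by omega⟩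
    rfl
  refine Runs.of_le (N := setupCost k t r P + (pw * roundCost P pw F.size (occurrences F).length k + 1) +
    (pw * pw * 4 + 3)) ?_ ?_
  swap
  · have h5 := roundCost_le (P := P) (pw := pw) (k := k) hF (length_occurrences_le_size F)
    have h6 : 1 ≤ F.size ^ 2 := Nat.one_le_pow _ _ hF
    have h7 := Nat.mul_le_mul_left pw h5
    have h8 : setupCost k t r P + 1 + (pw * pw * 4 + 3) ≤
        (setupCost k t r P + 1 + (pw * pw * 4 + 3)) * F.size ^ 2 := Nat.le_mul_of_pos_right _ h6
    calc _ = pw * roundCost P pw F.size (occurrences F).length k +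
          (setupCost k t r P + 1 + (pw * pw * 4 + 3)) := by ring
      _ ≤ _ := add_le_add h7 h8
      _ = _ := by rw [totalCost]; ring
  set c := pw * roundCost P pw F.size (occurrences F).length k + 1 with hc
  set d := pw * pw * 4 + 3 with hd
  refine Runs.of_le (N := (r * (4 * r + 4) + 1) + ((P * (3 * 2 ^ P + 5) + 3) +
    ((8 * t + 4 * k + 4) + (c + d))) + 1 + 1 + 1) ?_ (by rw [setupCost]; omega)
  refine Runs.const_seq (Runs.ite (fun _ => ?_) (fun hb => ?_))
  swap
  · simp [hz 10 (by norm_num), h1] at hb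
    omega
  refine Runs.load_seq ?_
  have hread : σ.arr 0 (F.clauses.length) = F.clauses.flatten.length := by
    change ofList (offsets F.clauses) _ = _
    rw [ofList_offsets _ le_rfl, start_length]
  simp only [reg_setReg, arr_setReg, h3, hz 10 (by norm_num), if_neg (show ¬ (3 : ℕ) = 4 by norm_num),
    if_neg (show ¬ (10 : ℕ) = 4 by norm_num), add_zero, hread]
  set τ := (σ.setReg 4 1).setReg 9 F.clauses.flatten.length with hτ
  have hk₀ : Only [4, 9] σ τ := ((Only.refl _ _).setReg (by simp)).setReg (by simp)
  refine Runs.seq_mid _ _ le_rfl _ (countPieces_runs (σ := τ) (r := r) (by simp [τ, h2])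
    (by simp [τ, hz]) (by simp [τ, hz])) ?_
  rintro τ₁ ⟨hk₁, h5₁⟩
  refine Runs.seq_mid _ _ le_rfl _ (powerOfTwo_runs h5₁) ?_
  rintro τ₂ ⟨hk₂, h6₂⟩
  have hkk : Only [4, 5, 6, 9, 16, 17, 18] σ τ₂ := ((hk₀.weaken (by simp)).trans
    (hk₁.weaken (by simp))).trans (hk₂.weaken (by simp))
  refine Runs.seq_mid _ _ le_rfl _ (thresholds_runs (k := k) (t := t) (by rw [hkk.2 0 (by simp), h0])
    (by rw [hkk.2 1 (by simp), h1]) (by rw [hkk.2 7 (by simp), hz 7 (by norm_num)])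
    (by rw [hkk.2 8 (by simp), hz 8 (by norm_num)])) ?_
  rintro τ₃ ⟨hk₃, h7₃, h8₃⟩
  have hkk₃ : Only [4, 5, 6, 7, 8, 9, 16, 17, 18] σ τ₃ := (hkk.weaken (by simp)).trans
    (hk₃.weaken (by simp))
  have hE : Env F (wallPaths M) k r (2 * t) (4 * t + 2 * k) pw τ₃ :=
    { reg_k := by rw [hkk₃.2 0 (by simp), h0]
      reg_r := by rw [hkk₃.2 2 (by simp), h2]
      reg_one := by rw [hk₃.2 4 (by simp), hk₂.2 4 (by simp), hk₁.2 4 (by simp)]; simp [τ]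
      reg_pieces := by rw [hk₃.2 5 (by simp), hk₂.2 5 (by simp), h5₁, hP]
      reg_pw := by rw [hk₃.2 6 (by simp), h6₂]
      reg_nu := h7₃
      reg_D := h8₃
      reg_len := by rw [hk₃.2 9 (by simp), hk₂.2 9 (by simp), hk₁.2 9 (by simp)]; simp [τ]
      reg_zero := by rw [hkk₃.2 10 (by simp), hz 10 (by norm_num)]
      arr0 := by rw [hkk₃.1]; rfl
      arr1 := by rw [hkk₃.1]; rfl
      arr3 := by rw [hkk₃.1]; rfl
      arr4 := by rw [hkk₃.1]; rfl
      arr5 := by rw [hkk₃.1]; rfl }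
  have hO : OutState F [] τ₃ :=
    ⟨by rw [hkk₃.2 12 (by simp), hz 12 (by norm_num)]; rfl, fun i hi => absurd hi (Nat.not_lt_zero i),
      fun y => by rw [hkk₃.1, ha 8 (by norm_num)]; simp, by simp⟩
  rw [← hP] at hc
  refine Runs.seq_mid c d le_rfl _ (hc ▸ collect_runs hE (by omega) hps
    (by rw [hkk₃.2 11 (by simp), hz 11 (by norm_num)])
    (fun y => by rw [hkk₃.1, ha 7 (by norm_num)]; exact Nat.zero_le _) hO) ?_
  rintro υ ⟨hkυ, O, hOυ, hlen, hcand⟩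
  have h10 := (hE.keeps hkυ (by norm_num) (by simp)).reg_zero
  refine Runs.mono (Runs.of_le (copyOut_runs h10 hOυ) (by rw [hd]; omega)) ?_
  rintro ω hω
  rw [hω]
  refine ⟨hlen, fun y hy => hOυ.sub y (List.mem_toFinset.1 hy), fun q hq hcard y hy => ?_⟩
  exact List.mem_toFinset.2 (hcand q hq hcard y hy)

theorem backdoorProg_runs_of_zero (M : TopologicalModel (wall r) F.inc) (hF : F.vars.Nonempty) :
    Runs backdoorProg (inputState k 0 F M) 5 fun σ => ∃ x ∈ F.vars, σ.output = [x] := by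
  refine Runs.const_seq (Runs.ite (fun hb => ?_) (fun _ => ?_))
  · simp [inputState, ofList] at hb
  obtain ⟨y, hy⟩ := hF
  have hpos : 0 < (occurrences F).length := List.length_pos_of_mem (mem_occurrences.2 hy)
  refine Runs.load_seq (Runs.store_seq (Runs.const ⟨(occurrences F)[0],
    mem_occurrences.1 (List.getElem_mem hpos), ?_⟩))
  have h1 : (inputState k 0 F M).arr 1 0 = (occurrences F)[0] := by
    change ((occurrences F).getD 0 0) = _
    simp [hpos]
  have h10 : (inputState k 0 F M).reg 10 = 0 := rfl
  simp [State.output, h10, h1]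

end Main

/-! ### Encoding selections of pieces by numbers -/

section Encoding

open Classical RAM

theorem exists_binary_digits (P : ℕ) (s : ℕ → Prop) :
    ∃ q < 2 ^ P, ∀ p < P, q / 2 ^ p % 2 = 1 ↔ s p := by
  induction P generalizing s with
  | zero => exact ⟨0, by simp, fun p hp => absurd hp (Nat.not_lt_zero p)⟩
  | succ P ih =>
    obtain ⟨q, hq, h⟩ := ih fun p => s (p + 1)
    refine ⟨2 * q + if s 0 then 1 else 0, ?_, fun p hp => ?_⟩
    · rw [pow_succ]
      split_ifs <;> omega
    · cases p with
      | zero => by_cases hs : s 0 <;> simp [hs]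
      | succ p =>
        rw [← h p (by omega), pow_succ', ← Nat.div_div_eq_div_mul]
        have h2 : (2 * q + if s 0 then 1 else 0) / 2 = q := by split_ifs <;> omega
        rw [h2]

variable {F : CNF} {r : ℕ} {M : TopologicalModel (wall r) F.inc} {Q : Finset (WallLabel r)} {q : ℕ}

/-- The digits of `q` at the positions below `2 r ^ 2` select the pieces in `Q`. -/
def Encodes (Q : Finset (WallLabel r)) (q : ℕ) : Prop :=
  ∀ p, (hp : p < (wallLabels r).length) → (q / 2 ^ p % 2 = 1 ↔ (wallLabels r)[p] ∈ Q)

theorem Encodes.bitSum_eq (h : Encodes Q q) (f : List F.IncVertex → ℕ) :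
    bitSum q (wallPaths M).length (fun p => f ((wallPaths M).getD p [])) =
      ∑ e ∈ Q, f (piece M e) := by
  have hlen : (wallPaths M).length = (wallLabels r).length := by
    rw [wallPaths_eq_map_piece, List.length_map]
  have huniv : (wallLabels r).toFinset = Finset.univ :=
    Finset.eq_univ_iff_forall.2 fun e => List.mem_toFinset.2 (mem_wallLabels e)
  have h1 : ∑ e ∈ Q, f (piece M e) =
      ((wallLabels r).map fun e => if e ∈ Q then f (piece M e) else 0).sum := by
    rw [← List.sum_toFinset _ (nodup_wallLabels r), huniv, Finset.sum_ite_mem, Finset.univ_inter]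
  have h2 : ((wallLabels r).map fun e => if e ∈ Q then f (piece M e) else 0) =
      List.ofFn fun i : Fin (wallLabels r).length =>
        if (wallLabels r)[i] ∈ Q then f (piece M (wallLabels r)[i]) else 0 := by
    apply List.ext_getElem <;> simp
  rw [h1, h2, List.sum_ofFn, bitSum, hlen, Finset.sum_range]
  refine Finset.sum_congr rfl fun i _ => ?_
  have h3 : (wallPaths M).getD i [] = piece M (wallLabels r)[i] := by
    simp [wallPaths_eq_map_piece]
  rw [h3]
  exact if_congr (h i i.2) rfl rfl

theorem Encodes.touchSum_eq (h : Encodes Q q) (x : ℕ) :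
    touchSum F (wallPaths M) q x = touchCount M Q x := by
  rw [touchSum, h.bitSum_eq fun l => if Touches F x l then 1 else 0, touchCount, Finset.card_filter]

theorem Encodes.heavyOf_eq (h : Encodes Q q) (k : ℕ) :
    heavyOf F (wallPaths M) k r q = heavy M k Q := by
  rw [heavyOf, heavy]
  exact Finset.filter_congr fun x _ => by rw [h.touchSum_eq]

/-- The scan and the counting argument cut pieces in the same way. -/
theorem chunks_isFull {Z : Finset ℕ} {ν : ℕ} (e : WallLabel r) :
    (chunks (IsFull F Z ν) (piece M e)).1 = segs M Z ν e := by
  unfold segs IsFull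
  congr!

theorem Encodes.smallSum_eq (h : Encodes Q q) (ν D : ℕ) (Z : Finset ℕ) :
    smallSum F (wallPaths M) ν D Z q = smallCount M Z ν D Q := by
  rw [smallSum, h.bitSum_eq fun l => (chunks (IsFull F Z ν) l).1.countP fun c => IsSmall F Z D c,
    smallCount, card_segSet]
  simp only [chunks_isFull, IsSmall]
  congr!

theorem Encodes.hitSum_eq (h : Encodes Q q) (ν D : ℕ) (Z : Finset ℕ) (x : ℕ) :
    hitSum F (wallPaths M) ν D Z q x = hitCount M Z ν D Q x := by
  rw [hitSum, h.bitSum_eq fun l => (chunks (IsFull F Z ν) l).1.countP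
      fun c => IsSmall F Z D c ∧ Touches F x c, hitCount, card_segSet]
  simp only [chunks_isFull, IsSmall]
  congr! 3
  exact decide_eq_decide.2 Iff.rfl

/-- Every selection of pieces has an encoding for which all heavy variables are candidates. -/
theorem exists_candidates_eq_heavy (M : TopologicalModel (wall r) F.inc) (Q : Finset (WallLabel r))
    (k ν D : ℕ) :
    ∃ q < 2 ^ (2 * (r * r) + 1), candidates F (wallPaths M) k r ν D q = heavy M k Q := by
  obtain ⟨q, hq, h⟩ := exists_binary_digits (2 * (r * r) + 1)
    fun p => ∀ hp : p < (wallLabels r).length, (wallLabels r)[p] ∈ Q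
  have henc : Encodes Q q := fun p hp => by
    rw [h p (by rw [length_wallLabels] at hp; omega)]
    exact ⟨fun h => h hp, fun h _ => h⟩
  refine ⟨q, hq, ?_⟩
  have hlen : (wallPaths M).length = 2 * (r * r) := by
    rw [wallPaths_eq_map_piece, List.length_map, length_wallLabels]
  have hmode : q / 2 ^ (2 * (r * r)) = 1 := by
    have h1 : q / 2 ^ (2 * (r * r)) % 2 = 1 :=
      (h (2 * (r * r)) (by omega)).2 fun hp => by rw [length_wallLabels] at hp; omega
    have h2 : q / 2 ^ (2 * (r * r)) < 2 := Nat.div_lt_of_lt_mul (by rwa [pow_succ] at hq)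
    generalize q / 2 ^ (2 * (r * r)) = w at h1 h2 ⊢
    omega
  rw [candidates, henc.heavyOf_eq]
  exact Finset.filter_true_of_mem fun x _ => Or.inl (by rw [hlen, hmode])

/-- Every selection of pieces has an encoding for which the candidates are the heavy variables touching
many segments. -/
theorem exists_candidates_eq_filter (M : TopologicalModel (wall r) F.inc) (Q : Finset (WallLabel r))
    (k ν D : ℕ) : ∃ q < 2 ^ (2 * (r * r) + 1), candidates F (wallPaths M) k r ν D q =
      (heavy M k Q).filter fun x => smallCount M (heavy M k Q) ν D Q ≤
        2 * k * hitCount M (heavy M k Q) ν D Q x := by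
  obtain ⟨q, hq, h⟩ := exists_binary_digits (2 * (r * r))
    fun p => ∀ hp : p < (wallLabels r).length, (wallLabels r)[p] ∈ Q
  have henc : Encodes Q q := fun p hp => by
    rw [h p (by rw [length_wallLabels] at hp; omega)]
    exact ⟨fun h => h hp, fun h _ => h⟩
  refine ⟨q, by rw [pow_succ]; omega, ?_⟩
  have hlen : (wallPaths M).length = 2 * (r * r) := by
    rw [wallPaths_eq_map_piece, List.length_map, length_wallLabels]
  rw [candidates, henc.heavyOf_eq, henc.smallSum_eq, hlen, Nat.div_eq_of_lt hq]
  exact Finset.filter_congr fun x _ => by rw [henc.hitSum_eq]; simp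

end Encoding

/-! ### Conclusion -/

theorem vars_nonempty {F : CNF} {r : ℕ} (hr : 2 ≤ r) (M : TopologicalModel (wall r) F.inc) :
    F.vars.Nonempty := by
  have hadj := wall_adj_right (i := (⟨0, by omega⟩ : Fin r)) (j := ⟨0, by omega⟩)
    (show 0 + 1 < r by omega)
  obtain ⟨v, h, -⟩ := (M.path hadj).exists_eq_cons_of_ne (M.branch_injective.ne hadj.ne)
  obtain ⟨x, -⟩ := CNF.inc_adj_iff.1 h
  exact ⟨x.1, x.2⟩

theorem one_le_size {F : CNF} (h : F.vars.Nonempty) : 1 ≤ F.size := by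
  have := h.card_pos
  rw [CNF.size]
  omega

/-- The bounds on the numbers of candidates do not exceed the number `pw` of variables that the
program accepts for each selection. -/
theorem bounds_le_two_pow {k t r : ℕ}
    (hr : 4 * k * (32 * 2 ^ k * t + 4 * (4 * t + 2 * k) + 1) ≤ r) (hk : 1 ≤ k) :
    (2 * t + 4 * (4 * t + 2 * k)) * (2 * (r * r)) ≤ 2 ^ (2 * (r * r) + 1) ∧
      2 * k * (4 * t + 2 * k) ≤ 2 ^ (2 * (r * r) + 1) := by
  set s := 2 * t + 4 * (4 * t + 2 * k) with hs
  have h1 : s ≤ r := by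
    refine le_trans ?_ hr
    have : t ≤ 32 * 2 ^ k * t := Nat.le_mul_of_pos_left _ (by positivity)
    nlinarith
  have h2 : 2 * k * (4 * t + 2 * k) ≤ r := by
    refine le_trans ?_ hr
    nlinarith [Nat.zero_le (32 * 2 ^ k * t), Nat.zero_le k]
  have h3 : r * r < 2 ^ (r * r) := Nat.lt_two_pow_self
  have h4 : r ≤ r * r := by nlinarith
  have h5 : 2 ^ (2 * (r * r) + 1) = 2 * (2 ^ (r * r) * 2 ^ (r * r)) := by ring
  rw [h5]
  constructor
  · calc s * (2 * (r * r)) ≤ (r * r) * (2 * (r * r)) := Nat.mul_le_mul_right _ (h1.trans h4)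
      _ = 2 * ((r * r) * (r * r)) := by ring
      _ ≤ _ := by gcongr
  · nlinarith

end Backdoor

theorem mainTheorem3 :
    ∃ (P : Backdoor.RAM.Prog) (C g : ℕ → ℕ → ℕ), ∀ k t : ℕ, 1 ≤ k →
      ∀ (F : Backdoor.CNF)
        (M : Backdoor.TopologicalModel (Backdoor.wall ⌊Backdoor.wallSize k t⌋₊) F.inc),
        ∃ (σ : Backdoor.RAM.State) (T : ℕ),
          Backdoor.RAM.Exec P (Backdoor.inputState k t F M) σ T ∧
          T ≤ C k t * F.size ^ 2 ∧
          σ.output.length ≤ g k t ∧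
          σ.output.toFinset ⊆ F.vars ∧
          ∀ B : Finset ℕ,
            Backdoor.CNF.IsStrongBackdoor (Backdoor.CNF.treewidthAtMost t) F B → B.card ≤ k →
              ∃ x ∈ B, x ∈ σ.output.toFinset := by
  -- the program accepts `pw` variables for each of the `pw` encodings of selections; the summands `5`
  -- and `1` account for the case `t = 0`
  let r : ℕ → ℕ → ℕ := fun k t => ⌊Backdoor.wallSize k t⌋₊
  let pw : ℕ → ℕ → ℕ := fun k t => 2 ^ (2 * (r k t * r k t) + 1)
  refine ⟨Backdoor.RAM.backdoorProg,
    fun k t => 5 + Backdoor.RAM.totalCost k t (r k t) (2 * (r k t * r k t)) (pw k t),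
    fun k t => 1 + pw k t * pw k t, fun k t hk F M => ?_⟩
  have hr4 : 4 ≤ r k t := Backdoor.four_le_floor_wallSize hk
  have hvars := Backdoor.vars_nonempty (le_trans (by norm_num) hr4) M
  have hsize := Backdoor.one_le_size hvars
  rcases Nat.eq_zero_or_pos t with rfl | ht
  · obtain ⟨σ, T, hexec, hT, x, hx, hout⟩ := Backdoor.backdoorProg_runs_of_zero M hvars
    refine ⟨σ, T, hexec, ?_, ?_, ?_, fun B hB _ => ⟨x, ?_, ?_⟩⟩
    · have h6 : 1 ≤ F.size ^ 2 := Nat.one_le_pow _ _ hsize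
      calc T ≤ 5 := hT
        _ ≤ 5 + Backdoor.RAM.totalCost k 0 (r k 0) (2 * (r k 0 * r k 0)) (pw k 0) :=
          Nat.le_add_right _ _
        _ ≤ _ := Nat.le_mul_of_pos_right _ h6
    · simp [hout]
    · simpa [hout] using hx
    · exact Backdoor.CNF.vars_subset_of_isStrongBackdoor_zero hB hx
    · simp [hout]
  · obtain ⟨σ, T, hexec, hT, hlen, hsub, hcand⟩ := Backdoor.backdoorProg_runs_of_pos ht M hsize
    refine ⟨σ, T, hexec, hT.trans (Nat.mul_le_mul_right _ (Nat.le_add_left _ _)),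
      hlen.trans (Nat.le_add_left _ _), hsub, fun B hB hBk => ?_⟩
    have hr := Backdoor.le_floor_wallSize hk ht
    obtain ⟨hb1, hb2⟩ := Backdoor.bounds_le_two_pow hr hk
    obtain ⟨Q, ⟨hc, b, hbB, hb⟩ | ⟨hc, b, hbB, hb⟩⟩ :=
      Backdoor.exists_good_labels hk ht hr hB hBk M
    · obtain ⟨q, hq, he⟩ := Backdoor.exists_candidates_eq_heavy M Q k (2 * t) (4 * t + 2 * k)
      exact ⟨b, hbB, hcand q hq (by rw [he]; exact hc.trans hb1) (by rw [he]; exact hb)⟩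
    · obtain ⟨q, hq, he⟩ := Backdoor.exists_candidates_eq_filter M Q k (2 * t) (4 * t + 2 * k)
      refine ⟨b, hbB, hcand q hq (by rw [he]; exact hc.trans hb2) ?_⟩
      rw [he]
      exact Finset.mem_filter.2 hb
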